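/- Let $\mathcal M$ be a complex manifold of dimension $n_V=n_C+n'_V$ with a (projective) special-Kähler structure: a holomorphic section $\Omega=(X^{\mathbf\Lambda},F_{\mathbf\Lambda})$, $\mathbf\Lambda=0,\dots,n_V$, of $\mathcal L\otimes\mathcal S$ ($\mathcal L$ a holomorphic line bundle, $\mathcal S$ a flat $Sp(2n_V+2,\mathbb R)$ bundle) with $\mathrm i\langle\Omega,\bar\Omega\rangle=\mathrm i(\bar X^{\mathbf\Lambda}F_{\mathbf\Lambda}-X^{\mathbf\Lambda}\bar F_{\mathbf\Lambda})=e^{-\mathcal K}>0$, $\langle\Omega,\partial_{\mathcal I}\Omega\rangle=0$ and $g_{\mathcal I\bar{\mathcal J}}=\partial_{\mathcal I}\partial_{\bar{\mathcal J}}\mathcal K$ positive definite. Put $V=(L^{\mathbf\Lambda},M_{\mathbf\Lambda})=e^{\mathcal K/2}\Omega$, $\nabla_{\mathcal I}V=(f^{\mathbf\Lambda}_{\mathcal I},h_{\mathbf\Lambda\mathcal I})=(\partial_{\mathcal I}+\tfrac12\partial_{\mathcal I}\mathcal K)V$, $C_{\mathcal{IJK}}=\langle\nabla_{\mathcal I}\nabla_{\mathcal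 J}V,\nabla_{\mathcal K}V\rangle$, and let the period matrix $\mathcal N$ be defined by $M_{\mathbf\Lambda}=\mathcal N_{\mathbf{\Lambda\Sigma}}L^{\mathbf\Sigma}$, $\bar h_{\mathbf\Lambda\bar{\mathcal I}}=\mathcal N_{\mathbf{\Lambda\Sigma}}\bar f^{\mathbf\Sigma}_{\bar{\mathcal I}}$. Write $R^{\mathcal K}{}_{\mathcal{JI}\bar{\mathcal L}}=-\partial_{\bar{\mathcal L}}\Gamma^{\mathcal K}_{\mathcal{IJ}}$ for the curvature of $g$. Split $\mathbf\Lambda=(\Lambda,X)$, $X=0,\dots,n_C$, $\Lambda=1,\dots,n'_V$. Let $\mathcal M_R\to\mathcal M$ be a complex submanifold of dimension $n_C$ such that near each of its points there are coordinates $(z^i,z^\alpha)$ of $\mathcal M$, $i=1,\dots,n_C$, $\alpha=1,\dots,n'_V$, in which $\mathcal M_R$ is $\{z^\alpha=0\}$ with coordinates $z^i$, and $g_{i\bar\alpha}=0$ on $\mathcal M_R$. Assume that in all such coordinates, and for the section $\Omega$ in every local trivialization of $\mathcal L\otimes\mathcal S$ of the given trivializing cover, $L^\Lambda=0$ and $f^\Lambda_i=0$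 on $\mathcal M_R$. Then in all such coordinates and trivializations the following hold on $\mathcal M_R$. 1. $\nabla_i\nabla_jL^\Lambda=0$, $\mathrm i\,C_{ij\alpha}g^{\alpha\bar\beta}\bar f^\Lambda_{\bar\beta}=0$, and $C_{ij\alpha}=0$. 2. The mixed curvature along $\mathcal M_R$ is $R^i{}_{\alpha k\bar l}=g^{i\bar q}\bigl(C_{\alpha kp}g^{p\bar r}\bar C_{\bar q\bar l\bar r}+C_{\alpha k\beta}g^{\beta\bar\gamma}\bar C_{\bar q\bar l\bar\gamma}\bigr)=0$, and $R^\alpha{}_{ik\bar l}=0$. 3. At the points of $\mathcal M_R$ where, in addition, $C_{\alpha\beta\gamma}=0$ for all $\alpha,\beta,\gamma$, one has $R^i{}_{\alpha\beta\bar\gamma}=0$. 4. $\mathcal N_{XY}$ is the period matrix of $\mathcal M_R$ computed from the section $(X^X,F_X)|_{\mathcal M_R}$, and the metric of $\mathcal M_R$ computed from this section is the induced one, $g_{i\bar\jmath}=-2f^X_i\,\mathrm{Im}\,\mathcal N_{XY}\,\bar f^Y_{\bar\jmath}$. 5. If moreover $\mathcal N_{X\Lambda}=0$ on $\mathcal M_R$,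 then: $f^X_\alpha=0$ and $h_{X\alpha}=0$; $\mathcal N_{\Lambda\Sigma}|_{\mathcal M_R}$ is antiholomorphic in $z^i$; whenever near the point considered $F_{\mathbf\Lambda}=\partial F/\partial X^{\mathbf\Lambda}$ for a holomorphic prepotential $F(X)$, homogeneous of degree two, $\mathcal N_{\Lambda\Sigma}=\bar F_{\Lambda\Sigma}$, the conjugate of $F_{\Lambda\Sigma}=\partial_\Lambda\partial_\Sigma F$ evaluated at $X(z^i)$; and $\mathcal M_R$ with the section $(X^X,F_X)|_{\mathcal M_R}$ is itself a special-Kähler manifold. -/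

import Mathlib

open Complex Topology
open scoped Manifold ContDiff ComplexOrder ComplexConjugate

noncomputable section

namespace SpecialGeometry

/-- Values of a symplectic section `(X^Λ, F_Λ)` over a manifold of complex dimension `#ι`.
The vector index runs over `{0} ⊔ ι`, written `Option ι`, with `0 = none`.
The summand `inl` carries the upper components `X^Λ`, the summand `inr` the lower ones `F_Λ`. -/
abbrev SympVec (ι : Type) : Type := Option ι ⊕ Option ι → ℂ

/-- The symplectic product `⟨v, w⟩ = v_Λ w^Λ - v^Λ w_Λ`. -/
def symp {ι : Type} [Fintype ι] (v w : SympVec ι) : ℂ :=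
  ∑ l, (v (Sum.inr l) * w (Sum.inl l) - v (Sum.inl l) * w (Sum.inr l))

/-- Componentwise complex conjugate of a symplectic vector. -/
def cbar {ι : Type} (v : SympVec ι) : SympVec ι := fun s => conj (v s)

/-- The Wirtinger derivative `∂f/∂z^i`. -/
def dz {ι : Type} [Fintype ι] [DecidableEq ι] (i : ι) (f : (ι → ℂ) → ℂ) (z : ι → ℂ) : ℂ :=
  (1 / 2) * (fderiv ℝ f z (Pi.single i 1) - I * fderiv ℝ f z (Pi.single i I))

/-- The Wirtinger derivative `∂f/∂z̄^i`. -/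
def dzbar {ι : Type} [Fintype ι] [DecidableEq ι] (i : ι) (f : (ι → ℂ) → ℂ) (z : ι → ℂ) : ℂ :=
  (1 / 2) * (fderiv ℝ f z (Pi.single i 1) + I * fderiv ℝ f z (Pi.single i I))

section Local

/-! Objects built from the coordinate expression `Ω` of a local holomorphic section. -/

variable {ι : Type} [Fintype ι] [DecidableEq ι] (Ω : (ι → ℂ) → SympVec ι)

/-- `i ⟨Ω, Ω̄⟩ = i (X̄^Λ F_Λ - X^Λ F̄_Λ)`, which is a real number. -/
def hermNorm (z : ι → ℂ) : ℝ := (I * symp (Ω z) (cbar (Ω z))).re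

/-- The Kähler potential `K = - log (i ⟨Ω, Ω̄⟩)`. -/
def kahlerPot (z : ι → ℂ) : ℝ := - Real.log (hermNorm Ω z)

/-- `∂_i K`. -/
def dK (i : ι) (z : ι → ℂ) : ℂ := dz i (fun w => (kahlerPot Ω w : ℂ)) z

/-- The Kähler metric `g_{i j̄} = ∂_i ∂_j̄ K`; the row index is the holomorphic one. -/
def metric (z : ι → ℂ) : Matrix ι ι ℂ :=
  Matrix.of fun i j => dz i (fun w => dzbar j (fun y => (kahlerPot Ω y : ℂ)) w) z

/-- The inverse metric: `invMetric Ω z k l = g^{k l̄}`, so that `∑ l, g_{j l̄} g^{k l̄} = δ_j^k`. -/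
def invMetric (z : ι → ℂ) (k l : ι) : ℂ := (metric Ω z)⁻¹ l k

/-- The Levi-Civita connection `Γ^k_{ij} = g^{k l̄} ∂_i g_{j l̄}`. -/
def christoffel (k i j : ι) (z : ι → ℂ) : ℂ :=
  ∑ l, invMetric Ω z k l * dz i (fun w => metric Ω w j l) z

/-- The curvature components `R^k_{j m l̄} = - ∂_l̄ Γ^k_{m j}`. -/
def curv (k j m l : ι) (z : ι → ℂ) : ℂ := - dzbar l (fun w => christoffel Ω k m j w) z

/-- The covariantly holomorphic section `V = (L^Λ, M_Λ) = e^{K/2} (X^Λ, F_Λ)`. -/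
def covSec (z : ι → ℂ) : SympVec ι := fun s => (Real.exp (kahlerPot Ω z / 2) : ℂ) * Ω z s

/-- `U_i = ∇_i V = (f_i^Λ, h_{Λ i}) = (∂_i + ½ ∂_i K) V`. -/
def covD (i : ι) (z : ι → ℂ) : SympVec ι := fun s =>
  dz i (fun w => covSec Ω w s) z + (1 / 2) * dK Ω i z * covSec Ω z s

/-- `∇_i ∇_j V = (∂_i + ½ ∂_i K) U_j - Γ^k_{ij} U_k`. -/
def covDD (i j : ι) (z : ι → ℂ) : SympVec ι := fun s =>
  dz i (fun w => covD Ω j w s) z + (1 / 2) * dK Ω i z * covD Ω j z s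
    - ∑ k, christoffel Ω k i j z * covD Ω k z s

/-- The tensor `C_{ijk} = ⟨∇_i ∇_j V, ∇_k V⟩`. -/
def cTensor (i j k : ι) (z : ι → ℂ) : ℂ := symp (covDD Ω i j z) (covD Ω k z)

/-- `L^Λ`. -/
def secL (l : Option ι) (z : ι → ℂ) : ℂ := covSec Ω z (Sum.inl l)

/-- `f_i^Λ = ∇_i L^Λ`. -/
def secf (i : ι) (l : Option ι) (z : ι → ℂ) : ℂ := covD Ω i z (Sum.inl l)

/-- `h_{Λ i} = ∇_i M_Λ`. -/
def sech (i : ι) (l : Option ι) (z : ι → ℂ) : ℂ := covD Ω i z (Sum.inr l)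

/-- The square matrix with columns `L^Λ` and `f̄_ī^Λ`. -/
def upperMat (z : ι → ℂ) : Matrix (Option ι) (Option ι) ℂ :=
  Matrix.of fun l c => c.elim (secL Ω l z) (fun i => conj (secf Ω i l z))

/-- The square matrix with columns `M_Λ` and `h̄_{Λ ī}`. -/
def lowerMat (z : ι → ℂ) : Matrix (Option ι) (Option ι) ℂ :=
  Matrix.of fun l c => c.elim (covSec Ω z (Sum.inr l)) (fun i => conj (sech Ω i l z))

/-- The period matrix `N_{ΛΣ}`, determined by `M_Λ = N_{ΛΣ} L^Σ` and `h̄_{Λ ī} = N_{ΛΣ} f̄_ī^Σ`. -/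
def period (z : ι → ℂ) : Matrix (Option ι) (Option ι) ℂ := lowerMat Ω z * (upperMat Ω z)⁻¹

/-- The conditions on a holomorphic section at a point: `i ⟨Ω, Ω̄⟩ > 0`, `⟨Ω, ∂_i Ω⟩ = 0`,
and the metric `∂_i ∂_j̄ K` is positive definite. -/
structure SpecialAt (z : ι → ℂ) : Prop where
  norm_pos : 0 < hermNorm Ω z
  legendre : ∀ i, symp (Ω z) (fun s => dz i (fun w => Ω w s) z) = 0
  metric_pos : (metric Ω z).PosDef

end Local

/-- `W` is an open cone and `F` a holomorphic function on it, homogeneous of degree two. -/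
structure IsPrepotential {ι : Type} [Fintype ι] (W : Set (Option ι → ℂ))
    (F : (Option ι → ℂ) → ℂ) : Prop where
  isOpen : IsOpen W
  cone : ∀ x ∈ W, ∀ c : ℂ, c ≠ 0 → c • x ∈ W
  holomorphic : DifferentiableOn ℂ F W
  homogeneous : ∀ x ∈ W, ∀ c : ℂ, c ≠ 0 → F (c • x) = c ^ 2 * F x

/-- `F_Λ = ∂F/∂X^Λ`. -/
def gradF {ι : Type} [Fintype ι] [DecidableEq ι] (F : (Option ι → ℂ) → ℂ) (l : Option ι)
    (x : Option ι → ℂ) : ℂ := fderiv ℂ F x (Pi.single l 1)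

/-- `F_{ΛΣ} = ∂²F/∂X^Λ∂X^Σ`. -/
def hessF {ι : Type} [Fintype ι] [DecidableEq ι] (F : (Option ι → ℂ) → ℂ) (l m : Option ι)
    (x : Option ι → ℂ) : ℂ := fderiv ℂ (fun y => gradF F m y) x (Pi.single l 1)

/-- The section `Ω` derives from the prepotential `F` near `z`:
`F_Λ(z') = ∂F/∂X^Λ (X(z'))` for all `z'` close to `z`. -/
def HasPrepotential {ι : Type} [Fintype ι] [DecidableEq ι] (Ω : (ι → ℂ) → SympVec ι)
    (W : Set (Option ι → ℂ)) (F : (Option ι → ℂ) → ℂ) (z : ι → ℂ) : Prop :=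
  IsPrepotential W F ∧ ∀ᶠ w in 𝓝 z,
    (fun l => Ω w (Sum.inl l)) ∈ W ∧
      ∀ l, Ω w (Sum.inr l) = gradF F l (fun m => Ω w (Sum.inl m))

/-- A (local, projective) special Kähler structure on a complex manifold `M` of dimension `#ι`:
a holomorphic section of `ℒ ⊗ 𝒮` with `ℒ` a holomorphic line bundle and `𝒮` a flat bundle with
structure group `Sp(2#ι + 2, ℝ)`, given in a trivializing open cover `dom` by the
holomorphic functions `sec a = (X^Λ, F_Λ)`. The functions `c a b` are the transition functions
of `ℒ`, the locally constant real symplectic matrices `S a b` those of `𝒮`. -/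
structure IsSpecialKahler {ι : Type} [Fintype ι] [DecidableEq ι] {M P : Type*}
    [TopologicalSpace M] [ChartedSpace (ι → ℂ) M]
    (dom : P → Set M) (sec : P → M → SympVec ι) : Prop where
  isOpen_dom : ∀ a, IsOpen (dom a)
  cover : ∀ p, ∃ a, p ∈ dom a
  holomorphic : ∀ a, MDifferentiableOn 𝓘(ℂ, ι → ℂ) 𝓘(ℂ, SympVec ι) (sec a) (dom a)
  transition : ∃ (c : P → P → M → ℂ)
      (S : P → P → M → Matrix (Option ι ⊕ Option ι) (Option ι ⊕ Option ι) ℝ),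
    (∀ a b, MDifferentiableOn 𝓘(ℂ, ι → ℂ) 𝓘(ℂ, ℂ) (c a b) (dom a ∩ dom b)) ∧
    (∀ a b, ∀ p ∈ dom a ∩ dom b,
      c a b p ≠ 0 ∧ S a b p ∈ Matrix.symplecticGroup (Option ι) ℝ ∧
      (∀ᶠ q in 𝓝 p, S a b q = S a b p) ∧
      sec a p = c a b p • ((S a b p).map Complex.ofReal).mulVec (sec b p)) ∧
    (∀ a b d, ∀ p ∈ dom a ∩ dom b ∩ dom d,
      c a d p = c a b p * c b d p ∧ S a d p = S a b p * S b d p)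
  special : ∀ φ ∈ IsManifold.maximalAtlas 𝓘(ℂ, ι → ℂ) ω M, ∀ a, ∀ p ∈ φ.source, p ∈ dom a →
    SpecialAt (sec a ∘ φ.symm) (φ p)

section Truncation

variable {nC nV' : ℕ}

/-- The vector index `X ∈ {0, …, nC}` inside `{0} ⊔ (nC ⊔ nV')`. -/
def vecX (x : Option (Fin nC)) : Option (Fin nC ⊕ Fin nV') := x.map Sum.inl

/-- The vector index `Λ ∈ {1, …, nV'}` inside `{0} ⊔ (nC ⊔ nV')`. -/
def vecΛ (l : Fin nV') : Option (Fin nC ⊕ Fin nV') := some (Sum.inr l)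

/-- The components `(X^X, F_X)` of a symplectic vector. -/
def restrictVec (v : SympVec (Fin nC ⊕ Fin nV')) : SympVec (Fin nC) :=
  Sum.elim (fun x => v (Sum.inl (vecX x))) (fun x => v (Sum.inr (vecX x)))

variable {M R P : Type*} [TopologicalSpace M] [ChartedSpace (Fin nC ⊕ Fin nV' → ℂ) M]
  [TopologicalSpace R] [ChartedSpace (Fin nC → ℂ) R]

/-- Coordinates `φ = (z^i, z^α)` of `M` and `ψ = (z^i)` of the submanifold `j : R → M`, in which
the submanifold is `z^α = 0` and `g_{i ᾱ} = 0` along it. -/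
structure AdaptedCharts (dom : P → Set M) (sec : P → M → SympVec (Fin nC ⊕ Fin nV')) (j : R → M)
    (φ : OpenPartialHomeomorph M (Fin nC ⊕ Fin nV' → ℂ))
    (ψ : OpenPartialHomeomorph R (Fin nC → ℂ)) : Prop where
  mem_φ : φ ∈ IsManifold.maximalAtlas 𝓘(ℂ, Fin nC ⊕ Fin nV' → ℂ) ω M
  mem_ψ : ψ ∈ IsManifold.maximalAtlas 𝓘(ℂ, Fin nC → ℂ) ω R
  mapsTo : Set.MapsTo j ψ.source φ.source
  slice : ∀ r ∈ ψ.source, φ (j r) = Sum.elim (ψ r) 0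
  orthogonal : ∀ a, ∀ r ∈ ψ.source, j r ∈ dom a → ∀ i α,
    metric (sec a ∘ φ.symm) (φ (j r)) (Sum.inl i) (Sum.inr α) = 0

/-- `j : R → M` is a complex submanifold with adapted coordinates around each of its points. -/
def IsAdaptedSubmanifold (dom : P → Set M) (sec : P → M → SympVec (Fin nC ⊕ Fin nV'))
    (j : R → M) : Prop :=
  ∀ r, ∃ φ ψ, AdaptedCharts dom sec j φ ψ ∧ r ∈ ψ.source

/-- `Q Ω z` holds along the submanifold: at all its points, in all adapted coordinates and for
all local sections; `Ω` is the local section in these coordinates, `z` the point. -/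
def Along (dom : P → Set M) (sec : P → M → SympVec (Fin nC ⊕ Fin nV')) (j : R → M)
    (Q : ((Fin nC ⊕ Fin nV' → ℂ) → SympVec (Fin nC ⊕ Fin nV')) →
      (Fin nC ⊕ Fin nV' → ℂ) → Prop) : Prop :=
  ∀ φ ψ, AdaptedCharts dom sec j φ ψ → ∀ a, ∀ r ∈ ψ.source, j r ∈ dom a →
    Q (sec a ∘ φ.symm) (φ (j r))

end Truncation

end SpecialGeometry

end

noncomputable section

namespace SpecialGeometry

set_option linter.unusedSectionVars false

section Holomorphic

open MeasureTheory Metric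

variable {E : Type*} [NormedAddCommGroup E] [NormedSpace ℂ E] [FiniteDimensional ℂ E]

/-- Directional derivatives of a holomorphic function of several variables are holomorphic. -/
theorem differentiableOn_fderiv_apply {U : Set E} (hU : IsOpen U) {f : E → ℂ}
    (hf : DifferentiableOn ℂ f U) (v : E) : DifferentiableOn ℂ (fun x => fderiv ℂ f x v) U := by
  intro x₀ hx₀
  apply DifferentiableAt.differentiableWithinAt
  obtain ⟨ρ, hρ, hρU⟩ : ∃ ρ > 0, ∀ x ∈ ball x₀ (3 * ρ), x ∈ U ∧ dist (f x) (f x₀) < 1 := by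
    have h1 : ∀ᶠ x in 𝓝 x₀, x ∈ U ∧ dist (f x) (f x₀) < 1 :=
      Filter.Eventually.and (hU.mem_nhds hx₀) ((hf.continuousOn.continuousAt (hU.mem_nhds hx₀)).eventually
        (ball_mem_nhds _ one_pos))
    obtain ⟨ε, hε, h⟩ := Metric.eventually_nhds_iff_ball.1 h1
    exact ⟨ε / 3, by positivity, fun x hx => h x (by convert hx using 2; ring)⟩
  have hd : ∀ x ∈ ball x₀ (3 * ρ), DifferentiableAt ℂ f x := fun x hx =>
    hf.differentiableAt (hU.mem_nhds (hρU x hx).1)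
  set c : ℝ := ρ / (‖v‖ + 1) with hc
  have hc0 : 0 < c := by positivity
  have hmem : ∀ x ∈ ball x₀ ρ, ∀ ζ : ℂ, ‖ζ‖ ≤ c → x + ζ • v ∈ ball x₀ (2 * ρ) := by
    intro x hx ζ hζ
    rw [mem_ball, dist_eq_norm] at hx ⊢
    have h1 : ‖ζ • v‖ ≤ ρ := by
      rw [norm_smul]
      calc ‖ζ‖ * ‖v‖ ≤ c * (‖v‖ + 1) := by gcongr; linarith
        _ = ρ := by rw [hc]; field_simp
    calc ‖x + ζ • v - x₀‖ = ‖(x - x₀) + ζ • v‖ := by congr 1; abel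
      _ ≤ ‖x - x₀‖ + ‖ζ • v‖ := norm_add_le _ _
      _ < 2 * ρ := by linarith
  have hsub : ball x₀ (2 * ρ) ⊆ ball x₀ (3 * ρ) := ball_subset_ball (by linarith)
  have hcm : ∀ θ : ℝ, ‖circleMap 0 c θ‖ ≤ c := fun θ => by simp [abs_of_pos hc0]
  let k : ℝ → ℂ := fun θ => deriv (circleMap 0 c) θ * (1 / (circleMap 0 c θ - 0) ^ 2)
  have hk : Continuous k := by
    have h2 : ∀ θ, (circleMap 0 c θ - 0) ^ 2 ≠ 0 := fun θ => by
      simpa using hc0.ne'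
    have h3 : Continuous (deriv (circleMap 0 c)) := by
      have : deriv (circleMap 0 c) = fun θ => circleMap 0 c θ * I := by
        ext θ; exact deriv_circleMap 0 c θ
      rw [this]; fun_prop
    refine h3.mul (continuous_const.div₀ ?_ h2)
    fun_prop
  let F : E → ℝ → ℂ := fun x θ => k θ * f (x + circleMap 0 c θ • v)
  let F' : E → ℝ → E →L[ℂ] ℂ := fun x θ => k θ • fderiv ℂ f (x + circleMap 0 c θ • v)
  let μ : Measure ℝ := volume.restrict (Set.Ioc 0 (2 * Real.pi))
  have hrep : ∀ x ∈ ball x₀ ρ, fderiv ℂ f x v = (2 * Real.pi * I)⁻¹ * ∫ θ, F x θ ∂μ := by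
    intro x hx
    have hline : ∀ ζ : ℂ, ‖ζ‖ ≤ c →
        HasDerivAt (fun ζ : ℂ => f (x + ζ • v)) (fderiv ℂ f (x + ζ • v) v) ζ := by
      intro ζ hζ
      have h1 : HasDerivAt (fun ζ : ℂ => x + ζ • v) v ζ := by
        simpa using ((hasDerivAt_id ζ).smul_const v).const_add x
      exact (hd _ (hsub (hmem x hx ζ hζ))).hasFDerivAt.comp_hasDerivAt ζ h1
    have hdiff : DifferentiableOn ℂ (fun ζ : ℂ => f (x + ζ • v)) (closedBall 0 c) := fun ζ hζ =>
      (hline ζ (by simpa using hζ)).differentiableAt.differentiableWithinAt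
    have h1 := hdiff.deriv_eq_smul_circleIntegral hc0
    have h2 : deriv (fun ζ : ℂ => f (x + ζ • v)) 0 = fderiv ℂ f x v := by
      simpa using (hline 0 (by simpa using hc0.le)).deriv
    rw [h2, circleIntegral, intervalIntegral.integral_of_le (by positivity)] at h1
    rw [eq_inv_mul_iff_mul_eq₀ (by simp [Real.pi_ne_zero]), ← smul_eq_mul, ← h1]
    refine integral_congr_ae (Filter.Eventually.of_forall fun θ => ?_)
    simp [F, k, mul_assoc]
  have hFcont : ∀ x ∈ ball x₀ ρ, Continuous (F x) := by
    intro x hx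
    refine hk.mul ?_
    rw [continuous_iff_continuousAt]
    intro θ
    have h1 : ContinuousAt f (x + circleMap 0 c θ • v) :=
      (hd _ (hsub (hmem x hx _ (hcm θ)))).continuousAt
    exact ContinuousAt.comp (f := fun θ : ℝ => x + circleMap 0 c θ • v) h1
      (Continuous.continuousAt (by fun_prop))
  obtain ⟨B, hB⟩ := (isCompact_Icc (a := (0 : ℝ)) (b := 2 * Real.pi)).exists_bound_of_continuousOn
    hk.continuousOn
  have key : HasFDerivAt (fun x => ∫ θ, F x θ ∂μ) (∫ θ, F' x₀ θ ∂μ) x₀ := by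
    borelize E
    refine hasFDerivAt_integral_of_dominated_of_fderiv_le (bound := fun _ => B * (2 / ρ))
      (ball_mem_nhds x₀ hρ) ?_ ?_ ?_ ?_ ?_ ?_
    · filter_upwards [ball_mem_nhds x₀ hρ] with x hx
      exact (hFcont x hx).aestronglyMeasurable
    · exact ((hFcont x₀ (mem_ball_self hρ)).continuousOn.integrableOn_Icc).mono_set
        Set.Ioc_subset_Icc_self
    · have h1 : Measurable (fun θ : ℝ => fderiv ℂ f (x₀ + circleMap 0 c θ • v)) :=
        (measurable_fderiv ℂ f).comp (Continuous.measurable (by fun_prop))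
      have := FiniteDimensional.proper ℂ (E →L[ℂ] ℂ)
      exact hk.aestronglyMeasurable.smul h1.aestronglyMeasurable
    · refine (ae_restrict_iff' measurableSet_Ioc).2 (Filter.Eventually.of_forall fun θ hθ x hx => ?_)
      rw [norm_smul]
      refine mul_le_mul (hB θ (Set.Ioc_subset_Icc_self hθ)) ?_ (norm_nonneg _)
        ((norm_nonneg _).trans (hB θ (Set.Ioc_subset_Icc_self hθ)))
      have hy := hmem x hx _ (hcm θ)
      set y := x + circleMap 0 c θ • v
      have hby : ball y ρ ⊆ ball x₀ (3 * ρ) := by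
        intro w hw
        rw [mem_ball] at *
        linarith [dist_triangle w y x₀]
      refine Complex.norm_fderiv_le_div_of_mapsTo_ball
        (fun w hw => (hd w (hby hw)).differentiableWithinAt) ?_ hρ
      intro w hw
      have h1 := (hρU w (hby hw)).2
      have h2 := (hρU y (hsub hy)).2
      rw [mem_closedBall]
      linarith [dist_triangle_right (f w) (f y) (f x₀)]
    · exact integrable_const _
    · refine Filter.Eventually.of_forall fun θ x hx => ?_
      have h1 := (hd _ (hsub (hmem x hx _ (hcm θ)))).hasFDerivAt
      exact ((h1.comp x ((hasFDerivAt_id x).add_const _)).const_mul (k θ))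
  have h2 := (key.const_mul ((2 * Real.pi * I)⁻¹)).differentiableAt
  refine h2.congr_of_eventuallyEq ?_
  filter_upwards [ball_mem_nhds x₀ hρ] with x hx using hrep x hx

/-- A holomorphic function of several variables is smooth. -/
theorem contDiffOn_of_differentiableOn {U : Set E} (hU : IsOpen U) {f : E → ℂ}
    (hf : DifferentiableOn ℂ f U) : ContDiffOn ℂ ∞ f U := by
  rw [contDiffOn_infty]
  intro n
  induction n generalizing f with
  | zero => exact contDiffOn_zero.2 hf.continuousOn
  | succ n ih =>
    rw [Nat.cast_succ, contDiffOn_succ_iff_fderiv_of_isOpen hU]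
    refine ⟨hf, by simp, contDiffOn_clm_apply.2 fun v => ?_⟩
    exact ih (differentiableOn_fderiv_apply hU hf v)

theorem contDiffAt_of_differentiableOn {U : Set E} (hU : IsOpen U) {f : E → ℂ}
    (hf : DifferentiableOn ℂ f U) {x : E} (hx : x ∈ U) : ContDiffAt ℂ ∞ f x :=
  (contDiffOn_of_differentiableOn hU hf).contDiffAt (hU.mem_nhds hx)

end Holomorphic

section Wirtinger

variable {ι : Type} [Fintype ι] [DecidableEq ι] {f g : (ι → ℂ) → ℂ} {z : ι → ℂ}

theorem dz_congr (i : ι) (h : f =ᶠ[𝓝 z] g) : dz i f z = dz i g z := by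
  simp only [dz, h.fderiv_eq]

theorem dzbar_congr (i : ι) (h : f =ᶠ[𝓝 z] g) : dzbar i f z = dzbar i g z := by
  simp only [dzbar, h.fderiv_eq]

theorem dz_const (i : ι) (c : ℂ) : dz i (fun _ => c) z = 0 := by simp [dz]

theorem dzbar_const (i : ι) (c : ℂ) : dzbar i (fun _ => c) z = 0 := by simp [dzbar]

theorem dz_add (i : ι) (hf : DifferentiableAt ℝ f z) (hg : DifferentiableAt ℝ g z) :
    dz i (fun w => f w + g w) z = dz i f z + dz i g z := by
  simp only [dz, fderiv_fun_add hf hg, add_apply]; ring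

theorem dzbar_add (i : ι) (hf : DifferentiableAt ℝ f z) (hg : DifferentiableAt ℝ g z) :
    dzbar i (fun w => f w + g w) z = dzbar i f z + dzbar i g z := by
  simp only [dzbar, fderiv_fun_add hf hg, add_apply]; ring

theorem dz_sub (i : ι) (hf : DifferentiableAt ℝ f z) (hg : DifferentiableAt ℝ g z) :
    dz i (fun w => f w - g w) z = dz i f z - dz i g z := by
  simp only [dz, fderiv_fun_sub hf hg, sub_apply]; ring

theorem dzbar_sub (i : ι) (hf : DifferentiableAt ℝ f z) (hg : DifferentiableAt ℝ g z) :
    dzbar i (fun w => f w - g w) z = dzbar i f z - dzbar i g z := by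
  simp only [dzbar, fderiv_fun_sub hf hg, sub_apply]; ring

theorem dz_mul (i : ι) (hf : DifferentiableAt ℝ f z) (hg : DifferentiableAt ℝ g z) :
    dz i (fun w => f w * g w) z = dz i f z * g z + f z * dz i g z := by
  simp only [dz, fderiv_fun_mul hf hg, add_apply,
    smul_apply, smul_eq_mul]; ring

theorem dzbar_mul (i : ι) (hf : DifferentiableAt ℝ f z) (hg : DifferentiableAt ℝ g z) :
    dzbar i (fun w => f w * g w) z = dzbar i f z * g z + f z * dzbar i g z := by
  simp only [dzbar, fderiv_fun_mul hf hg, add_apply,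
    smul_apply, smul_eq_mul]; ring

theorem dz_const_mul (i : ι) (c : ℂ) (hf : DifferentiableAt ℝ f z) :
    dz i (fun w => c * f w) z = c * dz i f z := by
  rw [dz_mul i (differentiableAt_const c) hf, dz_const]; ring

theorem dzbar_const_mul (i : ι) (c : ℂ) (hf : DifferentiableAt ℝ f z) :
    dzbar i (fun w => c * f w) z = c * dzbar i f z := by
  rw [dzbar_mul i (differentiableAt_const c) hf, dzbar_const]; ring

theorem dz_sum {κ : Type*} (s : Finset κ) {F : κ → (ι → ℂ) → ℂ} (i : ι)
    (hF : ∀ k ∈ s, DifferentiableAt ℝ (F k) z) :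
    dz i (fun w => ∑ k ∈ s, F k w) z = ∑ k ∈ s, dz i (F k) z := by
  simp only [dz, fderiv_fun_sum hF, _root_.sum_apply, Finset.mul_sum,
    ← Finset.sum_sub_distrib]

theorem dzbar_sum {κ : Type*} (s : Finset κ) {F : κ → (ι → ℂ) → ℂ} (i : ι)
    (hF : ∀ k ∈ s, DifferentiableAt ℝ (F k) z) :
    dzbar i (fun w => ∑ k ∈ s, F k w) z = ∑ k ∈ s, dzbar i (F k) z := by
  simp only [dzbar, fderiv_fun_sum hF, _root_.sum_apply, Finset.mul_sum,
    ← Finset.sum_add_distrib]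

theorem fderiv_conj_apply (hf : DifferentiableAt ℝ f z) (v : ι → ℂ) :
    fderiv ℝ (fun w => conj (f w)) z v = conj (fderiv ℝ f z v) := by
  have h := (conjCLE.toContinuousLinearMap.hasFDerivAt (x := f z)).comp z hf.hasFDerivAt
  have h2 : HasFDerivAt (fun w => conj (f w))
    (conjCLE.toContinuousLinearMap.comp (fderiv ℝ f z)) z := h
  rw [h2.fderiv]; rfl

theorem dz_conj (i : ι) (hf : DifferentiableAt ℝ f z) :
    dz i (fun w => conj (f w)) z = conj (dzbar i f z) := by
  simp only [dz, dzbar, fderiv_conj_apply hf, map_mul, map_add, map_div₀, map_one, conj_I,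
    map_ofNat]; ring

theorem dzbar_conj (i : ι) (hf : DifferentiableAt ℝ f z) :
    dzbar i (fun w => conj (f w)) z = conj (dz i f z) := by
  simp only [dz, dzbar, fderiv_conj_apply hf, map_mul, map_sub, map_div₀, map_one, conj_I,
    map_ofNat]; ring

theorem fderiv_real_apply_of_holomorphic (hf : DifferentiableAt ℂ f z) (v : ι → ℂ) :
    fderiv ℝ f z v = fderiv ℂ f z v := by
  rw [(hf.hasFDerivAt.restrictScalars ℝ).fderiv]; rfl

theorem single_I_eq (i : ι) : (Pi.single i I : ι → ℂ) = I • Pi.single i 1 := by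
  rw [← Pi.single_smul]; simp

theorem dz_of_holomorphic (i : ι) (hf : DifferentiableAt ℂ f z) :
    dz i f z = fderiv ℂ f z (Pi.single i 1) := by
  simp only [dz, fderiv_real_apply_of_holomorphic hf, single_I_eq, map_smul, smul_eq_mul]
  linear_combination (-(1 / 2) * fderiv ℂ f z (Pi.single i 1)) * I_mul_I

theorem dzbar_of_holomorphic (i : ι) (hf : DifferentiableAt ℂ f z) : dzbar i f z = 0 := by
  simp only [dzbar, fderiv_real_apply_of_holomorphic hf, single_I_eq, map_smul, smul_eq_mul]
  linear_combination ((1 / 2) * fderiv ℂ f z (Pi.single i 1)) * I_mul_I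

/-- The real derivative in terms of the Wirtinger derivatives. -/
theorem fderiv_eq_sum_dz (v : ι → ℂ) :
    fderiv ℝ f z v = ∑ i, (v i * dz i f z + conj (v i) * dzbar i f z) := by
  have hv : v = ∑ i, ((v i).re • (Pi.single i 1 : ι → ℂ) + (v i).im • (Pi.single i I : ι → ℂ)) := by
    ext k
    simp only [Finset.sum_apply, Pi.add_apply, Pi.smul_apply, Pi.single_apply, smul_ite, smul_zero,
      Finset.sum_add_distrib, Finset.sum_ite_eq, Finset.mem_univ, if_true, real_smul, mul_one]
    exact (re_add_im _).symm
  conv_lhs => rw [hv]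
  rw [map_sum]
  refine Finset.sum_congr rfl fun i _ => ?_
  rw [map_add, map_smul, map_smul, dz, dzbar]
  apply Complex.ext <;> simp <;> ring

theorem contDiffAt_fderiv_apply (hf : ContDiffAt ℝ ∞ f z) (v : ι → ℂ) :
    ContDiffAt ℝ ∞ (fun w => fderiv ℝ f w v) z :=
  (hf.fderiv_right (m := ∞) (by simp)).clm_apply contDiffAt_const

theorem contDiffAt_dz (i : ι) (hf : ContDiffAt ℝ ∞ f z) : ContDiffAt ℝ ∞ (dz i f) z :=
  contDiffAt_const.mul ((contDiffAt_fderiv_apply hf _).sub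
    (contDiffAt_const.mul (contDiffAt_fderiv_apply hf _)))

theorem contDiffAt_dzbar (i : ι) (hf : ContDiffAt ℝ ∞ f z) : ContDiffAt ℝ ∞ (dzbar i f) z :=
  contDiffAt_const.mul ((contDiffAt_fderiv_apply hf _).add
    (contDiffAt_const.mul (contDiffAt_fderiv_apply hf _)))

theorem contDiffAt_conj (hf : ContDiffAt ℝ ∞ f z) : ContDiffAt ℝ ∞ (fun w => conj (f w)) z :=
  conjCLE.toContinuousLinearMap.contDiff.contDiffAt.comp z hf

theorem _root_.ContDiffAt.differentiableAt_top (hf : ContDiffAt ℝ ∞ f z) : DifferentiableAt ℝ f z :=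
  hf.differentiableAt (by simp)

theorem fderiv_fderiv_apply (hf : ContDiffAt ℝ ∞ f z) (u v : ι → ℂ) :
    fderiv ℝ (fun w => fderiv ℝ f w u) z v = fderiv ℝ (fderiv ℝ f) z v u := by
  have h : DifferentiableAt ℝ (fderiv ℝ f) z :=
    (hf.fderiv_right (m := ∞) (by simp)).differentiableAt (by simp)
  have h2 := (h.hasFDerivAt.clm_apply (hasFDerivAt_const u z)).fderiv
  rw [h2]; simp

theorem fderiv_fderiv_comm (hf : ContDiffAt ℝ ∞ f z) (u v : ι → ℂ) :
    fderiv ℝ (fderiv ℝ f) z v u = fderiv ℝ (fderiv ℝ f) z u v :=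
  (hf.isSymmSndFDerivAt (by
    rw [minSmoothness_of_isRCLikeNormedField]; exact WithTop.coe_le_coe.2 (le_top (a := (2 : ℕ∞))))) v u

theorem fderiv_dz_apply (hf : ContDiffAt ℝ ∞ f z) (i : ι) (v : ι → ℂ) :
    fderiv ℝ (dz i f) z v = (1 / 2) * (fderiv ℝ (fderiv ℝ f) z v (Pi.single i 1)
      - I * fderiv ℝ (fderiv ℝ f) z v (Pi.single i I)) := by
  have h1 := fun u => (contDiffAt_fderiv_apply hf u).differentiableAt (by simp)
  have : dz i f = fun w => (1 / 2) * (fderiv ℝ f w (Pi.single i 1)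
    - I * fderiv ℝ f w (Pi.single i I)) := rfl
  rw [this, fderiv_const_mul ((h1 _).fun_sub ((h1 _).const_mul I)),
    fderiv_fun_sub (h1 _) ((h1 _).const_mul I), fderiv_const_mul (h1 _)]
  simp [fderiv_fderiv_apply hf]

theorem fderiv_dzbar_apply (hf : ContDiffAt ℝ ∞ f z) (i : ι) (v : ι → ℂ) :
    fderiv ℝ (dzbar i f) z v = (1 / 2) * (fderiv ℝ (fderiv ℝ f) z v (Pi.single i 1)
      + I * fderiv ℝ (fderiv ℝ f) z v (Pi.single i I)) := by
  have h1 := fun u => (contDiffAt_fderiv_apply hf u).differentiableAt (by simp)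
  have : dzbar i f = fun w => (1 / 2) * (fderiv ℝ f w (Pi.single i 1)
    + I * fderiv ℝ f w (Pi.single i I)) := rfl
  rw [this, fderiv_const_mul ((h1 _).fun_add ((h1 _).const_mul I)),
    fderiv_fun_add (h1 _) ((h1 _).const_mul I), fderiv_const_mul (h1 _)]
  simp [fderiv_fderiv_apply hf]; ring

theorem dz_dz_comm (hf : ContDiffAt ℝ ∞ f z) (i k : ι) :
    dz i (dz k f) z = dz k (dz i f) z := by
  rw [dz, dz]
  simp only [fderiv_dz_apply hf]
  rw [fderiv_fderiv_comm hf (Pi.single k 1) (Pi.single i 1),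
    fderiv_fderiv_comm hf (Pi.single k I) (Pi.single i 1),
    fderiv_fderiv_comm hf (Pi.single k 1) (Pi.single i I),
    fderiv_fderiv_comm hf (Pi.single k I) (Pi.single i I)]
  ring

theorem dz_dzbar_comm (hf : ContDiffAt ℝ ∞ f z) (i k : ι) :
    dz i (dzbar k f) z = dzbar k (dz i f) z := by
  rw [dz, dzbar]
  simp only [fderiv_dz_apply hf, fderiv_dzbar_apply hf]
  rw [fderiv_fderiv_comm hf (Pi.single k 1) (Pi.single i 1),
    fderiv_fderiv_comm hf (Pi.single k I) (Pi.single i 1),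
    fderiv_fderiv_comm hf (Pi.single k 1) (Pi.single i I),
    fderiv_fderiv_comm hf (Pi.single k I) (Pi.single i I)]
  ring

/-- The derivative of the exponential of half a real function. -/
theorem fderiv_exp_half {K : (ι → ℂ) → ℝ} (hK : DifferentiableAt ℝ K z) (v : ι → ℂ) :
    fderiv ℝ (fun w => (Real.exp (K w / 2) : ℂ)) z v =
      (1 / 2) * (Real.exp (K z / 2) : ℂ) * fderiv ℝ (fun w => (K w : ℂ)) z v := by
  have h1 : HasFDerivAt (fun w => (K w : ℂ)) (ofRealCLM.comp (fderiv ℝ K z)) z :=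
    (ofRealCLM.hasFDerivAt (x := K z)).comp z hK.hasFDerivAt
  have h2 := (ofRealCLM.hasFDerivAt (x := Real.exp (K z / 2))).comp z
    ((hK.hasFDerivAt.mul_const (1 / 2)).exp.congr_of_eventuallyEq
      (Filter.Eventually.of_forall fun w => by rw [← div_eq_mul_one_div] :
        (fun w => Real.exp (K w / 2)) =ᶠ[𝓝 z] _)) 
  have h3 : HasFDerivAt (fun w => (Real.exp (K w / 2) : ℂ)) _ z := h2
  rw [h1.fderiv, h3.fderiv]
  simp only [ContinuousLinearMap.comp_apply, smul_apply, ofRealCLM_apply]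
  push_cast
  simp
  ring_nf

theorem dz_exp_half {K : (ι → ℂ) → ℝ} (hK : DifferentiableAt ℝ K z) (i : ι) :
    dz i (fun w => (Real.exp (K w / 2) : ℂ)) z =
      (1 / 2) * (Real.exp (K z / 2) : ℂ) * dz i (fun w => (K w : ℂ)) z := by
  simp only [dz, fderiv_exp_half hK]; ring

theorem dzbar_exp_half {K : (ι → ℂ) → ℝ} (hK : DifferentiableAt ℝ K z) (i : ι) :
    dzbar i (fun w => (Real.exp (K w / 2) : ℂ)) z =
      (1 / 2) * (Real.exp (K z / 2) : ℂ) * dzbar i (fun w => (K w : ℂ)) z := by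
  simp only [dzbar, fderiv_exp_half hK]; ring

end Wirtinger

section Symplectic

variable {ι : Type} [Fintype ι]

theorem symp_add_left (u v w : SympVec ι) : symp (u + v) w = symp u w + symp v w := by
  simp only [symp, Pi.add_apply, ← Finset.sum_add_distrib]
  exact Finset.sum_congr rfl fun _ _ => by ring

theorem symp_smul_left (c : ℂ) (v w : SympVec ι) : symp (c • v) w = c * symp v w := by
  simp only [symp, Pi.smul_apply, smul_eq_mul, Finset.mul_sum]
  exact Finset.sum_congr rfl fun _ _ => by ring

theorem symp_swap (v w : SympVec ι) : symp v w = - symp w v := by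
  simp only [symp, ← Finset.sum_neg_distrib]
  exact Finset.sum_congr rfl fun _ _ => by ring

theorem symp_add_right (u v w : SympVec ι) : symp u (v + w) = symp u v + symp u w := by
  rw [symp_swap, symp_add_left, symp_swap v, symp_swap w]; ring

theorem symp_smul_right (c : ℂ) (v w : SympVec ι) : symp v (c • w) = c * symp v w := by
  rw [symp_swap, symp_smul_left, symp_swap w]; ring

theorem symp_sub_left (u v w : SympVec ι) : symp (u - v) w = symp u w - symp v w := by
  have h := symp_add_left u ((-1 : ℂ) • v) w
  rw [symp_smul_left] at h
  rw [sub_eq_add_neg, ← neg_one_smul ℂ v, h]; ring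

theorem symp_sub_right (u v w : SympVec ι) : symp u (v - w) = symp u v - symp u w := by
  rw [symp_swap, symp_sub_left, symp_swap v, symp_swap w]; ring

theorem symp_zero_left (w : SympVec ι) : symp 0 w = 0 := by simp [symp]

theorem symp_sum_left {κ : Type*} (s : Finset κ) (f : κ → SympVec ι) (w : SympVec ι) :
    symp (∑ k ∈ s, f k) w = ∑ k ∈ s, symp (f k) w := by
  classical
  induction s using Finset.induction_on with
  | empty => simp [symp_zero_left]
  | insert a s ha ih => rw [Finset.sum_insert ha, Finset.sum_insert ha, symp_add_left, ih]

theorem symp_sum_right {κ : Type*} (s : Finset κ) (f : κ → SympVec ι) (w : SympVec ι) :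
    symp w (∑ k ∈ s, f k) = ∑ k ∈ s, symp w (f k) := by
  rw [symp_swap, symp_sum_left, ← Finset.sum_neg_distrib]
  exact Finset.sum_congr rfl fun _ _ => (symp_swap _ _).symm

theorem symp_self (v : SympVec ι) : symp v v = 0 := by
  have := symp_swap v v
  linear_combination this / 2

theorem symp_cbar (v w : SympVec ι) : symp (cbar v) (cbar w) = conj (symp v w) := by
  simp [symp, cbar]

theorem cbar_cbar (v : SympVec ι) : cbar (cbar v) = v := by ext; simp [cbar]

theorem cbar_add (v w : SympVec ι) : cbar (v + w) = cbar v + cbar w := by ext; simp [cbar]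

theorem cbar_sub (v w : SympVec ι) : cbar (v - w) = cbar v - cbar w := by ext; simp [cbar]

theorem cbar_smul (c : ℂ) (v : SympVec ι) : cbar (c • v) = conj c • cbar v := by ext; simp [cbar]

theorem cbar_sum {κ : Type*} (s : Finset κ) (f : κ → SympVec ι) :
    cbar (∑ k ∈ s, f k) = ∑ k ∈ s, cbar (f k) := by ext; simp [cbar]

end Symplectic

section Frame

variable {ι : Type} [Fintype ι] [DecidableEq ι]

/-- A frame `(V, U_i)` of the space of symplectic vectors with the orthogonality relations of
special geometry. -/
structure IsFrame (V : SympVec ι) (u : ι → SympVec ι) (g : Matrix ι ι ℂ) : Prop where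
  symp_V_cbar : symp V (cbar V) = -I
  symp_V_u : ∀ i, symp V (u i) = 0
  symp_u_u : ∀ i k, symp (u i) (u k) = 0
  symp_u_cbar_V : ∀ i, symp (u i) (cbar V) = 0
  symp_u_cbar_u : ∀ i k, symp (u i) (cbar (u k)) = I * g i k
  posDef : g.PosDef

/-- The columns `V` and `Ū_i`. -/
def frameCol (V : SympVec ι) (u : ι → SympVec ι) (c : Option ι) : SympVec ι :=
  c.elim V fun i => cbar (u i)

/-- The upper components of the columns `V` and `Ū_i`. -/
def frameUpper (V : SympVec ι) (u : ι → SympVec ι) : Matrix (Option ι) (Option ι) ℂ :=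
  Matrix.of fun l c => frameCol V u c (Sum.inl l)

/-- The lower components of the columns `V` and `Ū_i`. -/
def frameLower (V : SympVec ι) (u : ι → SympVec ι) : Matrix (Option ι) (Option ι) ℂ :=
  Matrix.of fun l c => frameCol V u c (Sum.inr l)

/-- The period matrix of a frame. -/
def framePeriod (V : SympVec ι) (u : ι → SympVec ι) : Matrix (Option ι) (Option ι) ℂ :=
  frameLower V u * (frameUpper V u)⁻¹

theorem upperMat_eq (Ω : (ι → ℂ) → SympVec ι) (z : ι → ℂ) :
    upperMat Ω z = frameUpper (covSec Ω z) fun i => covD Ω i z := by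
  ext l (_ | i) <;> rfl

theorem period_eq (Ω : (ι → ℂ) → SympVec ι) (z : ι → ℂ) :
    period Ω z = framePeriod (covSec Ω z) fun i => covD Ω i z := by
  rw [period, framePeriod, upperMat_eq]
  congr 1
  ext l (_ | i) <;> rfl

namespace IsFrame

variable {V : SympVec ι} {u : ι → SympVec ι} {g : Matrix ι ι ℂ} (h : IsFrame V u g)
include h

theorem symp_cbar_u_u (i k : ι) : symp (cbar (u i)) (u k) = -I * g k i := by
  rw [symp_swap, h.symp_u_cbar_u]; ring

theorem symp_frameCol (c d : Option ι) : symp (frameCol V u c) (frameCol V u d) = 0 := by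
  have h1 : ∀ i, symp (cbar (u i)) V = 0 := fun i => by
    rw [← cbar_cbar V, symp_cbar, h.symp_u_cbar_V, map_zero]
  rcases c with _ | i <;> rcases d with _ | k <;> simp only [frameCol, Option.elim]
  · exact symp_self V
  · rw [symp_swap, h1, neg_zero]
  · exact h1 i
  · rw [symp_cbar, h.symp_u_u, map_zero]

theorem symp_comb_cbar (c : Option ι → ℂ) :
    symp (∑ d, c d • frameCol V u d) (cbar V) = -I * c none := by
  rw [symp_sum_left, Fintype.sum_option]
  simp only [symp_smul_left, frameCol, Option.elim, h.symp_V_cbar, symp_cbar]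
  simp only [symp_swap _ V, h.symp_V_u, neg_zero, map_zero, mul_zero, Finset.sum_const_zero]
  ring

theorem symp_comb_u (c : Option ι → ℂ) (k : ι) :
    symp (∑ d, c d • frameCol V u d) (u k) = -I * g.mulVec (fun i => c (some i)) k := by
  rw [symp_sum_left, Fintype.sum_option]
  simp only [symp_smul_left, frameCol, Option.elim, h.symp_V_u, h.symp_cbar_u_u, Matrix.mulVec,
    dotProduct, Finset.mul_sum, mul_zero, zero_add]
  exact Finset.sum_congr rfl fun _ _ => by ring

omit h in
theorem frameUpper_mulVec (c : Option ι → ℂ) (l : Option ι) :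
    (frameUpper V u).mulVec c l = (∑ d, c d • frameCol V u d) (Sum.inl l) := by
  simp [Matrix.mulVec, dotProduct, frameUpper, mul_comm]

omit h in
theorem frameLower_mulVec (c : Option ι → ℂ) (l : Option ι) :
    (frameLower V u).mulVec c l = (∑ d, c d • frameCol V u d) (Sum.inr l) := by
  simp [Matrix.mulVec, dotProduct, frameLower, mul_comm]

theorem isUnit_det_upper : IsUnit (frameUpper V u).det := by
  rw [isUnit_iff_ne_zero]
  intro hdet
  obtain ⟨c, hc, hc0⟩ := Matrix.exists_mulVec_eq_zero_iff.2 hdet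
  set W : SympVec ι := ∑ d, c d • frameCol V u d with hW
  have hup : ∀ l, W (Sum.inl l) = 0 := fun l => by rw [hW, ← frameUpper_mulVec, hc0]; rfl
  have h0 : symp W (cbar W) = 0 := by simp [symp, cbar, hup]
  have hcb : cbar W = conj (c none) • cbar V + ∑ k, conj (c (some k)) • u k := by
    rw [hW, cbar_sum, Fintype.sum_option]
    simp [cbar_smul, frameCol, cbar_cbar]
  rw [hcb, symp_add_right, symp_smul_right, symp_sum_right, hW, h.symp_comb_cbar] at h0
  simp only [symp_smul_right, h.symp_comb_u] at h0
  set c' : ι → ℂ := fun i => c (some i) with hc'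
  have h1 : (normSq (c none) : ℂ) + star c' ⬝ᵥ g.mulVec c' = 0 := by
    have h2 : star c' ⬝ᵥ g.mulVec c' = ∑ k, conj (c (some k)) * g.mulVec c' k := rfl
    have h3 : ∑ k, conj (c (some k)) * (-I * g.mulVec c' k) =
      -I * ∑ k, conj (c (some k)) * g.mulVec c' k := by
      rw [Finset.mul_sum]; exact Finset.sum_congr rfl fun _ _ => by ring
    rw [h3] at h0
    rw [h2, normSq_eq_conj_mul_self]
    linear_combination I * h0 + (conj (c none) * c none + ∑ k, conj (c (some k)) * g.mulVec c' k) * I_mul_I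
  have h4 : (0 : ℂ) ≤ star c' ⬝ᵥ g.mulVec c' := h.posDef.posSemidef.dotProduct_mulVec_nonneg c'
  have h5 : (0 : ℂ) ≤ (normSq (c none) : ℂ) := by exact_mod_cast normSq_nonneg _
  have h6 : c' = 0 := by
    by_contra hne
    have := h.posDef.dotProduct_mulVec_pos hne
    exact absurd h1 (add_pos_of_nonneg_of_pos h5 this).ne'
  have h7 : c none = 0 := by
    rw [h6] at h1
    simpa using h1
  apply hc
  ext (_ | i)
  · exact h7
  · exact congrFun h6 i

theorem framePeriod_mul_upper : framePeriod V u * frameUpper V u = frameLower V u := by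
  rw [framePeriod, Matrix.mul_assoc, Matrix.nonsing_inv_mul _ h.isUnit_det_upper, Matrix.mul_one]

theorem lower_eq (d l : Option ι) : frameCol V u d (Sum.inr l) =
    ∑ m, framePeriod V u l m * frameCol V u d (Sum.inl m) :=
  (congrFun (congrFun h.framePeriod_mul_upper l) d).symm

theorem framePeriod_symm : (framePeriod V u).transpose = framePeriod V u := by
  set N := framePeriod V u
  set A := frameUpper V u
  have hA : IsUnit A.det := h.isUnit_det_upper
  have h1 : A.transpose * (N * A) = (N * A).transpose * A := by
    rw [h.framePeriod_mul_upper]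
    ext c d
    have := h.symp_frameCol d c
    simp only [symp, Finset.sum_sub_distrib, sub_eq_zero] at this
    simp only [Matrix.mul_apply, Matrix.transpose_apply]
    refine Eq.trans ?_ (this.trans ?_)
    · exact Finset.sum_congr rfl fun _ _ => mul_comm _ _
    · exact Finset.sum_congr rfl fun _ _ => mul_comm _ _
  rw [Matrix.transpose_mul, Matrix.mul_assoc] at h1
  have hAt : IsUnit A.transpose.det := by rwa [Matrix.det_transpose]
  have h2 : N * A = N.transpose * A := by
    have := congrArg (fun B => A.transpose⁻¹ * B) h1
    simpa only [← Matrix.mul_assoc, Matrix.nonsing_inv_mul _ hAt, Matrix.one_mul] using this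
  have h3 := congrArg (fun B => B * A⁻¹) h2
  simpa only [Matrix.mul_assoc, Matrix.mul_nonsing_inv _ hA, Matrix.mul_one] using h3.symm

/-- A vector in the span of `V` and `Ū_i` that is orthogonal to `V̄` and `U_i` vanishes. -/
theorem eq_zero_of_lower_eq {x : SympVec ι}
    (hx : ∀ l, x (Sum.inr l) = ∑ m, framePeriod V u l m * x (Sum.inl m))
    (h1 : symp x (cbar V) = 0) (h2 : ∀ i, symp x (u i) = 0) : x = 0 := by
  set c : Option ι → ℂ := (frameUpper V u)⁻¹.mulVec fun m => x (Sum.inl m) with hc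
  have hup : (frameUpper V u).mulVec c = fun m => x (Sum.inl m) := by
    rw [hc, Matrix.mulVec_mulVec, Matrix.mul_nonsing_inv _ h.isUnit_det_upper, Matrix.one_mulVec]
  have hlo : (frameLower V u).mulVec c = fun m => x (Sum.inr m) := by
    rw [← h.framePeriod_mul_upper, ← Matrix.mulVec_mulVec, hup]
    ext l
    exact (hx l).symm
  have hxc : x = ∑ d, c d • frameCol V u d := by
    ext (l | l)
    · rw [← frameUpper_mulVec, hup]
    · rw [← frameLower_mulVec, hlo]
  rw [hxc, h.symp_comb_cbar] at h1
  have h3 : g.mulVec (fun i => c (some i)) = 0 := by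
    ext k
    have := h2 k
    rw [hxc, h.symp_comb_u] at this
    simpa using this
  have h4 : (fun i => c (some i)) = 0 := by
    by_contra hne
    have := h.posDef.dotProduct_mulVec_pos hne
    rw [h3] at this
    simp at this
  rw [hxc, Fintype.sum_option]
  have h5 : c none = 0 := by simpa using h1
  have h6 : ∀ i, c (some i) = 0 := fun i => congrFun h4 i
  simp [h5, h6]

/-- A vector orthogonal to `V`, `V̄`, `U_i` and `Ū_i` vanishes. -/
theorem eq_zero_of_orthogonal {x : SympVec ι} (h1 : symp x V = 0) (h2 : symp x (cbar V) = 0)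
    (h3 : ∀ i, symp x (u i) = 0) (h4 : ∀ i, symp x (cbar (u i)) = 0) : x = 0 := by
  refine h.eq_zero_of_lower_eq (fun l => ?_) h2 h3
  have h5 : ∀ d, symp x (frameCol V u d) = 0 := by rintro (_ | i); exacts [h1, h4 i]
  set a : Option ι → ℂ := fun l => x (Sum.inl l)
  set b : Option ι → ℂ := fun l => x (Sum.inr l)
  have h6 : Matrix.vecMul b (frameUpper V u) = Matrix.vecMul a (frameLower V u) := by
    ext d
    have := h5 d
    simp only [symp, Finset.sum_sub_distrib, sub_eq_zero] at this
    exact this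
  rw [← h.framePeriod_mul_upper, ← Matrix.vecMul_vecMul] at h6
  have h7 : b = Matrix.vecMul a (framePeriod V u) := by
    have := congrArg (fun v => Matrix.vecMul v (frameUpper V u)⁻¹) h6
    simpa only [Matrix.vecMul_vecMul, Matrix.mul_assoc, Matrix.mul_nonsing_inv _ h.isUnit_det_upper,
      Matrix.mul_one, Matrix.vecMul_one] using this
  rw [← Matrix.mulVec_transpose, h.framePeriod_symm] at h7
  exact congrFun h7 l

/-- `g_{i k̄} = -2 f_i^Λ (Im N_{ΛΣ}) f̄_k̄^Σ`. -/
theorem metric_eq (i k : ι) : g i k = -2 * ∑ x, ∑ y, u i (Sum.inl x) *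
    ((framePeriod V u x y).im : ℂ) * conj (u k (Sum.inl y)) := by
  have h1 := h.symp_u_cbar_u i k
  have hk : ∀ l, conj (u k (Sum.inr l)) =
      ∑ m, framePeriod V u l m * conj (u k (Sum.inl m)) := fun l => h.lower_eq (some k) l
  have hi : ∀ l, u i (Sum.inr l) = ∑ m, conj (framePeriod V u l m) * u i (Sum.inl m) := by
    intro l
    have := congrArg conj (h.lower_eq (some i) l)
    simpa [frameCol, cbar] using this
  have hs : ∀ x y, framePeriod V u x y = framePeriod V u y x := fun x y =>
    congrFun (congrFun h.framePeriod_symm.symm x) y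
  simp only [symp, cbar, hk, hi, Finset.sum_sub_distrib, Finset.sum_mul, Finset.mul_sum] at h1
  rw [Finset.sum_comm] at h1
  have h2 : I * g i k = ∑ x, ∑ y, u i (Sum.inl x) *
      (conj (framePeriod V u x y) - framePeriod V u x y) * conj (u k (Sum.inl y)) := by
    rw [← h1, ← Finset.sum_sub_distrib]
    refine Finset.sum_congr rfl fun x _ => ?_
    rw [← Finset.sum_sub_distrib]
    refine Finset.sum_congr rfl fun y _ => ?_
    rw [hs y x]; ring
  have h3 : ∀ w : ℂ, conj w - w = -2 * I * (w.im : ℂ) := fun w => by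
    apply Complex.ext <;> simp; ring
  have h4 : I * g i k = I * (-2 * ∑ x, ∑ y, u i (Sum.inl x) *
      ((framePeriod V u x y).im : ℂ) * conj (u k (Sum.inl y))) := by
    rw [h2]
    simp only [Finset.mul_sum, h3]
    exact Finset.sum_congr rfl fun x _ => Finset.sum_congr rfl fun y _ => by ring
  exact mul_left_cancel₀ I_ne_zero h4

end IsFrame

end Frame

section MatrixSmooth

variable {𝕜 : Type*} [NontriviallyNormedField 𝕜] [NormedAlgebra 𝕜 ℂ] {E : Type*}
  [NormedAddCommGroup E] [NormedSpace 𝕜 E] {κ : Type*} [Fintype κ] [DecidableEq κ]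
  {A : E → Matrix κ κ ℂ} {x : E} {n : WithTop ℕ∞}

theorem contDiffAt_det (hA : ∀ i k, ContDiffAt 𝕜 n (fun y => A y i k) x) :
    ContDiffAt 𝕜 n (fun y => (A y).det) x := by
  simp only [Matrix.det_apply']
  exact ContDiffAt.sum fun σ _ => contDiffAt_const.mul (contDiffAt_prod fun i _ => hA _ _)

theorem contDiffAt_inv_apply (hA : ∀ i k, ContDiffAt 𝕜 n (fun y => A y i k) x)
    (hx : IsUnit (A x).det) (i k : κ) : ContDiffAt 𝕜 n (fun y => (A y)⁻¹ i k) x := by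
  simp only [Matrix.inv_def, Ring.inverse_eq_inv', Matrix.smul_apply, smul_eq_mul,
    Matrix.adjugate_apply]
  refine ((contDiffAt_det hA).inv hx.ne_zero).mul (contDiffAt_det fun a b => ?_)
  by_cases hak : a = k
  · subst hak
    simpa using contDiffAt_const
  · simpa [Matrix.updateRow_ne hak] using hA a b

end MatrixSmooth

section VectorWirtinger

variable {ι : Type} [Fintype ι] [DecidableEq ι] {v u : (ι → ℂ) → SympVec ι} {z : ι → ℂ}

/-- The componentwise Wirtinger derivative `∂_i`. -/
def dzV {κ : Type} (i : ι) (v : (ι → ℂ) → SympVec κ) (z : ι → ℂ) : SympVec κ :=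
  fun s => dz i (fun w => v w s) z

/-- The componentwise Wirtinger derivative `∂_ī`. -/
def dzbarV {κ : Type} (i : ι) (v : (ι → ℂ) → SympVec κ) (z : ι → ℂ) : SympVec κ :=
  fun s => dzbar i (fun w => v w s) z

theorem dz_symp (i : ι) (hv : ∀ s, DifferentiableAt ℝ (fun w => v w s) z)
    (hu : ∀ s, DifferentiableAt ℝ (fun w => u w s) z) :
    dz i (fun w => symp (v w) (u w)) z = symp (dzV i v z) (u z) + symp (v z) (dzV i u z) := by
  simp only [symp, dzV]
  rw [dz_sum _ _ fun l _ => ((hv _).fun_mul (hu _)).fun_sub ((hv _).fun_mul (hu _)),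
    ← Finset.sum_add_distrib]
  refine Finset.sum_congr rfl fun l _ => ?_
  rw [dz_sub i ((hv _).fun_mul (hu _)) ((hv _).fun_mul (hu _)), dz_mul i (hv _) (hu _),
    dz_mul i (hv _) (hu _)]
  ring

theorem dzbar_symp (i : ι) (hv : ∀ s, DifferentiableAt ℝ (fun w => v w s) z)
    (hu : ∀ s, DifferentiableAt ℝ (fun w => u w s) z) :
    dzbar i (fun w => symp (v w) (u w)) z =
      symp (dzbarV i v z) (u z) + symp (v z) (dzbarV i u z) := by
  simp only [symp, dzbarV]
  rw [dzbar_sum _ _ fun l _ => ((hv _).fun_mul (hu _)).fun_sub ((hv _).fun_mul (hu _)),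
    ← Finset.sum_add_distrib]
  refine Finset.sum_congr rfl fun l _ => ?_
  rw [dzbar_sub i ((hv _).fun_mul (hu _)) ((hv _).fun_mul (hu _)), dzbar_mul i (hv _) (hu _),
    dzbar_mul i (hv _) (hu _)]
  ring

theorem differentiableAt_conj {f : (ι → ℂ) → ℂ} (hf : DifferentiableAt ℝ f z) :
    DifferentiableAt ℝ (fun w => conj (f w)) z :=
  conjCLE.toContinuousLinearMap.differentiableAt.comp z hf

theorem dz_symp_cbar (i : ι) (hv : ∀ s, DifferentiableAt ℝ (fun w => v w s) z)
    (hu : ∀ s, DifferentiableAt ℝ (fun w => u w s) z) :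
    dz i (fun w => symp (v w) (cbar (u w))) z =
      symp (dzV i v z) (cbar (u z)) + symp (v z) (cbar (dzbarV i u z)) := by
  rw [dz_symp (u := fun w => cbar (u w)) i hv fun s => differentiableAt_conj (hu s)]
  congr 2
  ext s
  exact dz_conj i (hu s)

theorem dzbar_symp_cbar (i : ι) (hv : ∀ s, DifferentiableAt ℝ (fun w => v w s) z)
    (hu : ∀ s, DifferentiableAt ℝ (fun w => u w s) z) :
    dzbar i (fun w => symp (v w) (cbar (u w))) z =
      symp (dzbarV i v z) (cbar (u z)) + symp (v z) (cbar (dzV i u z)) := by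
  rw [dzbar_symp (u := fun w => cbar (u w)) i hv fun s => differentiableAt_conj (hu s)]
  congr 2
  ext s
  exact dzbar_conj i (hu s)

end VectorWirtinger

/-- The section `Ω` is holomorphic and satisfies the special Kähler conditions on the open
set `U`. -/
structure SpecialOn {ι : Type} [Fintype ι] [DecidableEq ι] (Ω : (ι → ℂ) → SympVec ι)
    (U : Set (ι → ℂ)) : Prop where
  isOpen : IsOpen U
  differentiableOn : ∀ s, DifferentiableOn ℂ (fun z => Ω z s) U
  special : ∀ z ∈ U, SpecialAt Ω z

/-- `∂_ī K`. -/
def dKbar {ι : Type} [Fintype ι] [DecidableEq ι] (Ω : (ι → ℂ) → SympVec ι) (i : ι)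
    (z : ι → ℂ) : ℂ := dzbar i (fun w => (kahlerPot Ω w : ℂ)) z

theorem contDiffAt_ofReal {ι : Type} [Fintype ι] {f : (ι → ℂ) → ℝ} {z : ι → ℂ}
    (hf : ContDiffAt ℝ ∞ f z) : ContDiffAt ℝ ∞ (fun w => (f w : ℂ)) z :=
  ofRealCLM.contDiff.contDiffAt.comp z hf

theorem contDiffAt_symp {ι κ : Type} [Fintype ι] [Fintype κ] {v u : (κ → ℂ) → SympVec ι}
    {z : κ → ℂ}
    (hv : ∀ s, ContDiffAt ℝ ∞ (fun w => v w s) z) (hu : ∀ s, ContDiffAt ℝ ∞ (fun w => u w s) z) :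
    ContDiffAt ℝ ∞ (fun w => symp (v w) (u w)) z :=
  ContDiffAt.sum fun _ _ => ((hv _).mul (hu _)).sub ((hv _).mul (hu _))

theorem I_mul_symp_cbar {ι : Type} [Fintype ι] (v : SympVec ι) :
    I * symp v (cbar v) = ((I * symp v (cbar v)).re : ℂ) := by
  symm
  rw [← conj_eq_iff_re, map_mul, conj_I, ← symp_cbar, cbar_cbar, symp_swap]
  ring

namespace SpecialOn

variable {ι : Type} [Fintype ι] [DecidableEq ι] {Ω : (ι → ℂ) → SympVec ι} {U : Set (ι → ℂ)}
  {z : ι → ℂ} (h : SpecialOn Ω U) (hz : z ∈ U)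

include h in
theorem dz_eqOn {f g : (ι → ℂ) → ℂ} (hfg : ∀ w ∈ U, f w = g w) (hz : z ∈ U) (i : ι) :
    dz i f z = dz i g z :=
  dz_congr i (Filter.eventuallyEq_of_mem (h.isOpen.mem_nhds hz) hfg)

include h in
theorem dzbar_eqOn {f g : (ι → ℂ) → ℂ} (hfg : ∀ w ∈ U, f w = g w) (hz : z ∈ U) (i : ι) :
    dzbar i f z = dzbar i g z :=
  dzbar_congr i (Filter.eventuallyEq_of_mem (h.isOpen.mem_nhds hz) hfg)

include h hz

theorem differentiableAt_sec (s) : DifferentiableAt ℂ (fun w => Ω w s) z :=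
  (h.differentiableOn s).differentiableAt (h.isOpen.mem_nhds hz)

theorem contDiffAt_sec (s) : ContDiffAt ℝ ∞ (fun w => Ω w s) z :=
  (contDiffAt_of_differentiableOn h.isOpen (h.differentiableOn s) hz).restrict_scalars ℝ

theorem contDiffAt_hermNorm : ContDiffAt ℝ ∞ (hermNorm Ω) z := by
  have h1 := contDiffAt_symp (h.contDiffAt_sec hz) fun s => contDiffAt_conj (h.contDiffAt_sec hz s)
  exact reCLM.contDiff.contDiffAt.comp z (contDiffAt_const.mul h1)

theorem contDiffAt_kahlerPot_real : ContDiffAt ℝ ∞ (kahlerPot Ω) z :=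
  ((h.contDiffAt_hermNorm hz).log (h.special z hz).norm_pos.ne').neg

theorem contDiffAt_kahlerPot : ContDiffAt ℝ ∞ (fun w => (kahlerPot Ω w : ℂ)) z :=
  contDiffAt_ofReal (h.contDiffAt_kahlerPot_real hz)

theorem contDiffAt_exp_half : ContDiffAt ℝ ∞ (fun w => (Real.exp (kahlerPot Ω w / 2) : ℂ)) z :=
  contDiffAt_ofReal ((h.contDiffAt_kahlerPot_real hz).div_const 2).exp

theorem contDiffAt_covSec (s) : ContDiffAt ℝ ∞ (fun w => covSec Ω w s) z :=
  (h.contDiffAt_exp_half hz).mul (h.contDiffAt_sec hz s)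

theorem contDiffAt_dK (i : ι) : ContDiffAt ℝ ∞ (dK Ω i) z :=
  contDiffAt_dz i (h.contDiffAt_kahlerPot hz)

theorem contDiffAt_dKbar (i : ι) : ContDiffAt ℝ ∞ (dKbar Ω i) z :=
  contDiffAt_dzbar i (h.contDiffAt_kahlerPot hz)

theorem contDiffAt_metric (i k : ι) : ContDiffAt ℝ ∞ (fun w => metric Ω w i k) z :=
  contDiffAt_dz i (h.contDiffAt_dKbar hz k)

theorem isUnit_det_metric : IsUnit (metric Ω z).det :=
  isUnit_iff_ne_zero.2 (h.special z hz).metric_pos.det_pos.ne'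

theorem contDiffAt_invMetric (i k : ι) : ContDiffAt ℝ ∞ (fun w => invMetric Ω w i k) z :=
  contDiffAt_inv_apply (h.contDiffAt_metric hz) (h.isUnit_det_metric hz) k i

theorem contDiffAt_christoffel (k i l : ι) : ContDiffAt ℝ ∞ (christoffel Ω k i l) z :=
  ContDiffAt.sum fun m _ =>
    (h.contDiffAt_invMetric hz k m).mul (contDiffAt_dz i (h.contDiffAt_metric hz l m))

theorem contDiffAt_covD (i : ι) (s) : ContDiffAt ℝ ∞ (fun w => covD Ω i w s) z :=
  (contDiffAt_dz i (h.contDiffAt_covSec hz s)).add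
    ((contDiffAt_const.mul (h.contDiffAt_dK hz i)).mul (h.contDiffAt_covSec hz s))

theorem contDiffAt_covDD (i k : ι) (s) : ContDiffAt ℝ ∞ (fun w => covDD Ω i k w s) z :=
  ((contDiffAt_dz i (h.contDiffAt_covD hz k s)).add
    ((contDiffAt_const.mul (h.contDiffAt_dK hz i)).mul (h.contDiffAt_covD hz k s))).sub
    (ContDiffAt.sum fun m _ => (h.contDiffAt_christoffel hz m i k).mul (h.contDiffAt_covD hz m s))

theorem metric_conj (i k : ι) : conj (metric Ω z i k) = metric Ω z k i :=
  (h.special z hz).metric_pos.isHermitian.apply k i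

theorem sum_metric_mul_inv (i k : ι) :
    ∑ l, metric Ω z i l * invMetric Ω z k l = if i = k then 1 else 0 := by
  have := congrFun (congrFun (Matrix.mul_nonsing_inv _ (h.isUnit_det_metric hz)) i) k
  rwa [Matrix.mul_apply, Matrix.one_apply] at this

theorem sum_inv_mul_metric (l q : ι) :
    ∑ k, invMetric Ω z k l * metric Ω z k q = if l = q then 1 else 0 := by
  have := congrFun (congrFun (Matrix.nonsing_inv_mul _ (h.isUnit_det_metric hz)) l) q
  rwa [Matrix.mul_apply, Matrix.one_apply] at this

theorem sum_christoffel_mul_metric (i k q : ι) :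
    ∑ m, christoffel Ω m i k z * metric Ω z m q = dz i (fun w => metric Ω w k q) z := by
  simp only [christoffel, Finset.sum_mul]
  rw [Finset.sum_comm]
  have : ∀ l, ∑ m, invMetric Ω z m l * dz i (fun w => metric Ω w k l) z * metric Ω z m q =
      (if l = q then 1 else 0) * dz i (fun w => metric Ω w k l) z := fun l => by
    rw [← h.sum_inv_mul_metric hz, Finset.sum_mul]
    exact Finset.sum_congr rfl fun _ _ => by ring
  simp [this]

theorem dz_metric_symm (i k l : ι) :
    dz i (fun w => metric Ω w k l) z = dz k (fun w => metric Ω w i l) z :=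
  dz_dz_comm (h.contDiffAt_dKbar hz l) i k

theorem christoffel_symm (m i k : ι) : christoffel Ω m i k z = christoffel Ω m k i z :=
  Finset.sum_congr rfl fun l _ => by rw [h.dz_metric_symm hz]

theorem dzbar_dK (i k : ι) : dzbar k (dK Ω i) z = metric Ω z i k :=
  (dz_dzbar_comm (h.contDiffAt_kahlerPot hz) i k).symm

theorem dKbar_eq (i : ι) : dKbar Ω i z = conj (dK Ω i z) := by
  rw [dKbar, dK, ← dzbar_conj i (h.contDiffAt_kahlerPot hz).differentiableAt_top]
  simp only [conj_ofReal]

theorem dzbarV_covSec (k : ι) : dzbarV k (covSec Ω) z = ((1 / 2) * dKbar Ω k z) • covSec Ω z := by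
  ext s
  have h1 : dzbar k (fun w => covSec Ω w s) z = _ :=
    dzbar_mul k (h.contDiffAt_exp_half hz).differentiableAt_top
      (h.contDiffAt_sec hz s).differentiableAt_top
  rw [dzbarV, h1, dzbar_of_holomorphic k (h.differentiableAt_sec hz s),
    dzbar_exp_half ((h.contDiffAt_kahlerPot_real hz).differentiableAt (by simp))]
  simp only [Pi.smul_apply, smul_eq_mul, covSec, dKbar]
  ring

theorem dzV_covSec (i : ι) :
    dzV i (covSec Ω) z = covD Ω i z - ((1 / 2) * dK Ω i z) • covSec Ω z := by
  ext s
  simp [dzV, covD]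

/-- `∇_i V = e^{K/2} (∂_i + ∂_i K) Ω`. -/
theorem covD_eq (i : ι) :
    covD Ω i z = (Real.exp (kahlerPot Ω z / 2) : ℂ) • (dzV i Ω z + dK Ω i z • Ω z) := by
  ext s
  have h1 : dz i (fun w => covSec Ω w s) z = _ :=
    dz_mul i (h.contDiffAt_exp_half hz).differentiableAt_top
      (h.contDiffAt_sec hz s).differentiableAt_top
  rw [covD, h1, dz_exp_half ((h.contDiffAt_kahlerPot_real hz).differentiableAt (by simp))]
  simp only [Pi.smul_apply, smul_eq_mul, covSec, dK, Pi.add_apply, dzV]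
  ring

theorem dzbarV_covD (i k : ι) : dzbarV k (covD Ω i) z =
    metric Ω z i k • covSec Ω z + ((1 / 2) * dKbar Ω k z) • covD Ω i z := by
  ext s
  have hV := h.contDiffAt_covSec hz s
  have hK := h.contDiffAt_dK hz i
  have h0 : dzbar k (dz i fun w => covSec Ω w s) z =
      (1 / 2) * (metric Ω z i k * covSec Ω z s + dKbar Ω k z * dz i (fun w => covSec Ω w s) z) := by
    rw [← dz_dzbar_comm hV, h.dz_eqOn (g := fun w => (1 / 2) * (dKbar Ω k w * covSec Ω w s))
      (fun w hw => ?_) hz,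
      dz_const_mul _ _ ((h.contDiffAt_dKbar hz k).mul hV).differentiableAt_top,
      dz_mul _ (h.contDiffAt_dKbar hz k).differentiableAt_top hV.differentiableAt_top]
    · rfl
    · have := congrFun (h.dzbarV_covSec hw k) s
      simp only [Pi.smul_apply, smul_eq_mul, dzbarV] at this
      rw [this]; ring
  have h1 : dzbarV k (covD Ω i) z s = _ :=
    dzbar_add k (contDiffAt_dz i hV).differentiableAt_top
      ((contDiffAt_const (c := (1 / 2 : ℂ)).mul hK).mul hV).differentiableAt_top
  have h2 : dzbar k (fun w => covSec Ω w s) z = _ := congrFun (h.dzbarV_covSec hz k) s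
  rw [h1, h0, dzbar_mul k (contDiffAt_const.mul hK).differentiableAt_top hV.differentiableAt_top,
    dzbar_const_mul _ _ hK.differentiableAt_top, h.dzbar_dK hz, h2]
  simp only [Pi.add_apply, Pi.smul_apply, smul_eq_mul, covD]
  ring

theorem dzV_covD (i k : ι) : dzV i (covD Ω k) z =
    covDD Ω i k z - ((1 / 2) * dK Ω i z) • covD Ω k z +
      ∑ m, christoffel Ω m i k z • covD Ω m z := by
  ext s
  simp [dzV, covDD]; ring

theorem covDD_symm (i k : ι) : covDD Ω i k z = covDD Ω k i z := by
  have key : ∀ i k s, dz i (fun w => covD Ω k w s) z + (1 / 2) * dK Ω i z * covD Ω k z s =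
      dz i (dz k fun w => covSec Ω w s) z + (1 / 2) * (dz i (dK Ω k) z * covSec Ω z s +
      dK Ω k z * dz i (fun w => covSec Ω w s) z + dK Ω i z * dz k (fun w => covSec Ω w s) z) +
      (1 / 4) * dK Ω i z * dK Ω k z * covSec Ω z s := by
    intro i k s
    have hV := h.contDiffAt_covSec hz s
    have hK := h.contDiffAt_dK hz k
    have h1 : dz i (fun w => covD Ω k w s) z = _ :=
      dz_add i (contDiffAt_dz k hV).differentiableAt_top
        ((contDiffAt_const (c := (1 / 2 : ℂ)).mul hK).mul hV).differentiableAt_top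
    rw [h1, dz_mul i (contDiffAt_const.mul hK).differentiableAt_top hV.differentiableAt_top,
      dz_const_mul _ _ hK.differentiableAt_top, covD]
    ring
  ext s
  rw [covDD, covDD, key, key, dz_dz_comm (h.contDiffAt_covSec hz s)]
  have h2 : dz i (dK Ω k) z = dz k (dK Ω i) z := dz_dz_comm (h.contDiffAt_kahlerPot hz) i k
  simp only [h.christoffel_symm hz _ i k, h2]
  ring

end SpecialOn

namespace SpecialOn

variable {ι : Type} [Fintype ι] [DecidableEq ι] {Ω : (ι → ℂ) → SympVec ι} {U : Set (ι → ℂ)}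
  {z : ι → ℂ} (h : SpecialOn Ω U) (hz : z ∈ U)
include h hz

theorem diff_covSec (s) : DifferentiableAt ℝ (fun w => covSec Ω w s) z :=
  (h.contDiffAt_covSec hz s).differentiableAt_top

theorem diff_covD (i : ι) (s) : DifferentiableAt ℝ (fun w => covD Ω i w s) z :=
  (h.contDiffAt_covD hz i s).differentiableAt_top

theorem diff_covDD (i k : ι) (s) : DifferentiableAt ℝ (fun w => covDD Ω i k w s) z :=
  (h.contDiffAt_covDD hz i k s).differentiableAt_top

theorem conj_dKbar (i : ι) : conj (dKbar Ω i z) = dK Ω i z := by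
  rw [h.dKbar_eq hz, conj_conj]

theorem conj_half_dKbar (i : ι) : conj ((1 / 2) * dKbar Ω i z) = (1 / 2) * dK Ω i z := by
  rw [map_mul, h.conj_dKbar hz, map_div₀, map_one, map_ofNat]

theorem symp_covSec_cbar : symp (covSec Ω z) (cbar (covSec Ω z)) = -I := by
  have h1 : covSec Ω z = (Real.exp (kahlerPot Ω z / 2) : ℂ) • Ω z := rfl
  have h2 : I * symp (Ω z) (cbar (Ω z)) = (hermNorm Ω z : ℂ) := I_mul_symp_cbar _
  have h3 : Real.exp (kahlerPot Ω z / 2) * Real.exp (kahlerPot Ω z / 2) * hermNorm Ω z = 1 := by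
    rw [← Real.exp_add, add_halves, kahlerPot, Real.exp_neg,
      Real.exp_log (h.special z hz).norm_pos, inv_mul_cancel₀ (h.special z hz).norm_pos.ne']
  have h4 : (Real.exp (kahlerPot Ω z / 2) : ℂ) * (Real.exp (kahlerPot Ω z / 2) : ℂ) *
      (hermNorm Ω z : ℂ) = 1 := by exact_mod_cast h3
  rw [h1, cbar_smul, symp_smul_left, symp_smul_right, conj_ofReal]
  rw [← h2] at h4
  linear_combination (-I) * h4 + (Real.exp (kahlerPot Ω z / 2) : ℂ) *
    (Real.exp (kahlerPot Ω z / 2) : ℂ) * symp (Ω z) (cbar (Ω z)) * I_mul_I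

theorem symp_covSec_covD (i : ι) : symp (covSec Ω z) (covD Ω i z) = 0 := by
  have h1 : covSec Ω z = (Real.exp (kahlerPot Ω z / 2) : ℂ) • Ω z := rfl
  have h2 : symp (Ω z) (dzV i Ω z) = 0 := (h.special z hz).legendre i
  rw [h1, h.covD_eq hz, symp_smul_left, symp_smul_right, symp_add_right, symp_smul_right,
    symp_self, h2]
  ring

theorem symp_covD_cbar_covSec (i : ι) : symp (covD Ω i z) (cbar (covSec Ω z)) = 0 := by
  have h1 := dz_symp_cbar i (h.diff_covSec hz) (h.diff_covSec hz)
  rw [h.dz_eqOn (g := fun _ => -I) (fun w hw => h.symp_covSec_cbar hw) hz, dz_const,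
    h.dzV_covSec hz, h.dzbarV_covSec hz, cbar_smul, h.conj_half_dKbar hz, symp_sub_left,
    symp_smul_left, symp_smul_right] at h1
  linear_combination -h1

theorem symp_covD_cbar_covD (i k : ι) :
    symp (covD Ω i z) (cbar (covD Ω k z)) = I * metric Ω z i k := by
  have h1 := dzbar_symp_cbar k (h.diff_covD hz i) (h.diff_covSec hz)
  rw [h.dzbar_eqOn (g := fun _ => 0) (fun w hw => h.symp_covD_cbar_covSec hw i) hz, dzbar_const,
    h.dzbarV_covD hz, h.dzV_covSec hz, cbar_sub, cbar_smul, symp_sub_right, symp_add_left,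
    symp_smul_left, symp_smul_left, symp_smul_right, h.symp_covSec_cbar hz,
    h.symp_covD_cbar_covSec hz] at h1
  linear_combination -h1

theorem symp_covD_covD_add (i k : ι) :
    symp (covD Ω i z) (covD Ω k z) + symp (covSec Ω z) (covDD Ω i k z) = 0 := by
  have h1 := dz_symp i (h.diff_covSec hz) (h.diff_covD hz k)
  rw [h.dz_eqOn (g := fun _ => 0) (fun w hw => h.symp_covSec_covD hw k) hz, dz_const,
    h.dzV_covSec hz, h.dzV_covD hz, symp_sub_left, symp_add_right, symp_sub_right, symp_sum_right,
    symp_smul_left, symp_smul_right] at h1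
  simp only [symp_smul_right, h.symp_covSec_covD hz] at h1
  simp only [mul_zero, Finset.sum_const_zero] at h1
  linear_combination -h1

theorem symp_covD_covD (i k : ι) : symp (covD Ω i z) (covD Ω k z) = 0 := by
  have h1 := h.symp_covD_covD_add hz i k
  have h2 := h.symp_covD_covD_add hz k i
  rw [h.covDD_symm hz k i, symp_swap] at h2
  linear_combination (h1 - h2) / 2

theorem isFrame : IsFrame (covSec Ω z) (fun i => covD Ω i z) (metric Ω z) where
  symp_V_cbar := h.symp_covSec_cbar hz
  symp_V_u := h.symp_covSec_covD hz
  symp_u_u := h.symp_covD_covD hz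
  symp_u_cbar_V := h.symp_covD_cbar_covSec hz
  symp_u_cbar_u := h.symp_covD_cbar_covD hz
  posDef := (h.special z hz).metric_pos

theorem symp_covDD_covSec (i k : ι) : symp (covDD Ω i k z) (covSec Ω z) = 0 := by
  have h1 := h.symp_covD_covD_add hz i k
  rw [h.symp_covD_covD hz, symp_swap] at h1
  linear_combination -h1

theorem symp_covDD_cbar_covSec (i k : ι) : symp (covDD Ω i k z) (cbar (covSec Ω z)) = 0 := by
  have h1 := dz_symp_cbar i (h.diff_covD hz k) (h.diff_covSec hz)
  rw [h.dz_eqOn (g := fun _ => 0) (fun w hw => h.symp_covD_cbar_covSec hw k) hz, dz_const,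
    h.dzV_covD hz, h.dzbarV_covSec hz, cbar_smul, symp_smul_right, symp_add_left, symp_sub_left,
    symp_sum_left, symp_smul_left] at h1
  simp only [symp_smul_left, h.symp_covD_cbar_covSec hz] at h1
  simp only [mul_zero, Finset.sum_const_zero] at h1
  linear_combination -h1

theorem symp_covDD_cbar_covD (i k l : ι) : symp (covDD Ω i k z) (cbar (covD Ω l z)) = 0 := by
  have h1 := dz_symp_cbar i (h.diff_covD hz k) (h.diff_covD hz l)
  rw [h.dz_eqOn (g := fun w => I * metric Ω w k l) (fun w hw => h.symp_covD_cbar_covD hw k l) hz,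
    dz_const_mul _ _ (h.contDiffAt_metric hz k l).differentiableAt_top,
    h.dzV_covD hz, h.dzbarV_covD hz, cbar_add, cbar_smul, cbar_smul, h.conj_half_dKbar hz,
    symp_add_right, symp_smul_right, symp_smul_right, symp_add_left, symp_sub_left,
    symp_sum_left, symp_smul_left, ← h.sum_christoffel_mul_metric hz, Finset.mul_sum] at h1
  simp only [symp_smul_left, h.symp_covD_cbar_covSec hz, h.symp_covD_cbar_covD hz] at h1
  have h2 : ∀ m, christoffel Ω m i k z * (I * metric Ω z m l) =
    I * (christoffel Ω m i k z * metric Ω z m l) := fun m => by ring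
  simp only [h2] at h1
  linear_combination -h1

theorem symp_cbar_covD_covSec (l : ι) : symp (cbar (covD Ω l z)) (covSec Ω z) = 0 :=
  (h.isFrame hz).symp_frameCol (some l) none

/-- `∇_i ∇_k V = i C_{ikp} g^{p r̄} Ū_r̄`. -/
theorem covDD_eq (i k : ι) : covDD Ω i k z =
    ∑ p, ∑ r, (I * cTensor Ω i k p z * invMetric Ω z p r) • cbar (covD Ω r z) := by
  rw [← sub_eq_zero]
  apply (h.isFrame hz).eq_zero_of_orthogonal
  · simp only [symp_sub_left, symp_sum_left, symp_smul_left, h.symp_covDD_covSec hz,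
      h.symp_cbar_covD_covSec hz, mul_zero, Finset.sum_const_zero, sub_zero]
  · simp only [symp_sub_left, symp_sum_left, symp_smul_left, h.symp_covDD_cbar_covSec hz,
      symp_cbar, symp_swap (covD Ω _ z) (covSec Ω z), h.symp_covSec_covD hz, neg_zero, map_zero,
      mul_zero, Finset.sum_const_zero, sub_zero]
  · intro m
    simp only [symp_sub_left, symp_sum_left, symp_smul_left, (h.isFrame hz).symp_cbar_u_u]
    have h1 : ∀ p r, I * cTensor Ω i k p z * invMetric Ω z p r * (-I * metric Ω z m r) =
        cTensor Ω i k p z * (metric Ω z m r * invMetric Ω z p r) := fun p r => by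
      linear_combination (-(cTensor Ω i k p z * invMetric Ω z p r * metric Ω z m r)) * I_mul_I
    simp only [h1, ← Finset.mul_sum, h.sum_metric_mul_inv hz]
    simp [cTensor]
  · intro m
    simp only [symp_sub_left, symp_sum_left, symp_smul_left, h.symp_covDD_cbar_covD hz,
      symp_cbar, h.symp_covD_covD hz, map_zero, mul_zero, Finset.sum_const_zero, sub_zero]

theorem cTensor_symm_left (i k m : ι) : cTensor Ω i k m z = cTensor Ω k i m z := by
  rw [cTensor, h.covDD_symm hz, cTensor]

theorem cTensor_symm_right (i k m : ι) : cTensor Ω i k m z = cTensor Ω i m k z := by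
  have h1 := dz_symp i (h.diff_covD hz k) (h.diff_covD hz m)
  rw [h.dz_eqOn (g := fun _ => 0) (fun w hw => h.symp_covD_covD hw k m) hz, dz_const,
    h.dzV_covD hz, h.dzV_covD hz, symp_add_left, symp_sub_left, symp_sum_left, symp_add_right,
    symp_sub_right, symp_sum_right] at h1
  simp only [symp_smul_left, symp_smul_right, h.symp_covD_covD hz, mul_zero,
    Finset.sum_const_zero] at h1
  rw [symp_swap (covD Ω k z)] at h1
  rw [cTensor, cTensor]
  linear_combination -h1

theorem dzbarV_covDD (i k l : ι) : dzbarV l (covDD Ω i k) z =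
    ((1 / 2) * dKbar Ω l z) • covDD Ω i k z + metric Ω z k l • covD Ω i z +
      metric Ω z i l • covD Ω k z + ∑ m, curv Ω m k i l z • covD Ω m z := by
  ext s
  have hV := h.contDiffAt_covSec hz s
  have hU := fun m => h.contDiffAt_covD hz m s
  have hK := h.contDiffAt_dK hz i
  have hKb := h.contDiffAt_dKbar hz l
  have hg := h.contDiffAt_metric hz k l
  have hΓ := fun m => h.contDiffAt_christoffel hz m i k
  have hdU : ∀ m, ∀ w ∈ U, dzbar l (fun y => covD Ω m y s) w =
      metric Ω w m l * covSec Ω w s + (1 / 2) * (dKbar Ω l w * covD Ω m w s) := fun m w hw => by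
    have := congrFun (h.dzbarV_covD hw m l) s
    simp only [Pi.add_apply, Pi.smul_apply, smul_eq_mul] at this
    rw [← mul_assoc]; exact this
  have hKV : dz i (dKbar Ω l) z = metric Ω z i l := rfl
  have h0 : dzbar l (dz i fun w => covD Ω k w s) z =
      dz i (fun w => metric Ω w k l) z * covSec Ω z s +
      metric Ω z k l * dz i (fun w => covSec Ω w s) z +
      (1 / 2) * (metric Ω z i l * covD Ω k z s + dKbar Ω l z * dz i (fun w => covD Ω k w s) z) := by
    rw [← dz_dzbar_comm (hU k), h.dz_eqOn (hdU k) hz,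
      dz_add _ (hg.mul hV).differentiableAt_top
        (contDiffAt_const.mul (hKb.mul (hU k))).differentiableAt_top,
      dz_mul _ hg.differentiableAt_top hV.differentiableAt_top,
      dz_const_mul _ _ (hKb.mul (hU k)).differentiableAt_top,
      dz_mul _ hKb.differentiableAt_top (hU k).differentiableAt_top, hKV]
  have h1 : dzbarV l (covDD Ω i k) z s = _ :=
    dzbar_sub l ((contDiffAt_dz i (hU k)).add
      ((contDiffAt_const (c := (1 / 2 : ℂ)).mul hK).mul (hU k))).differentiableAt_top
      (ContDiffAt.sum (s := Finset.univ) fun m _ => (hΓ m).mul (hU m)).differentiableAt_top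
  have hs : ∀ m, dzbar l (fun w => christoffel Ω m i k w * covD Ω m w s) z =
      -(curv Ω m k i l z * covD Ω m z s) + (christoffel Ω m i k z * metric Ω z m l) * covSec Ω z s +
      (1 / 2) * dKbar Ω l z * (christoffel Ω m i k z * covD Ω m z s) := fun m => by
    rw [dzbar_mul _ (hΓ m).differentiableAt_top (hU m).differentiableAt_top, hdU m z hz, curv]
    ring
  rw [h1, dzbar_add _ (contDiffAt_dz i (hU k)).differentiableAt_top
      ((contDiffAt_const (c := (1 / 2 : ℂ)).mul hK).mul (hU k)).differentiableAt_top, h0,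
    dzbar_mul _ (contDiffAt_const.mul hK).differentiableAt_top (hU k).differentiableAt_top,
    dzbar_const_mul _ _ hK.differentiableAt_top, h.dzbar_dK hz, hdU k z hz,
    dzbar_sum _ _ fun m _ => ((hΓ m).mul (hU m)).differentiableAt_top]
  simp only [hs, Finset.sum_add_distrib, ← Finset.sum_mul, ← Finset.mul_sum,
    h.sum_christoffel_mul_metric hz, Finset.sum_neg_distrib, Pi.add_apply, Pi.smul_apply,
    smul_eq_mul, Finset.sum_apply]
  have h3 : covDD Ω i k z s = dz i (fun w => covD Ω k w s) z + (1 / 2) * dK Ω i z * covD Ω k z s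
    - ∑ m, christoffel Ω m i k z * covD Ω m z s := rfl
  have h4 : covD Ω i z s = dz i (fun w => covSec Ω w s) z + (1 / 2) * dK Ω i z * covSec Ω z s := rfl
  rw [h3, h4]
  ring

theorem symp_covDD_cbar_covDD (i k l q : ι) : symp (covDD Ω i k z) (cbar (covDD Ω l q z)) =
    -I * ∑ p, ∑ r, cTensor Ω i k p z * invMetric Ω z p r * conj (cTensor Ω l q r z) := by
  conv_lhs => rw [h.covDD_eq hz i k]
  simp only [symp_sum_left, symp_smul_left, symp_cbar, Finset.mul_sum]
  refine Finset.sum_congr rfl fun p _ => Finset.sum_congr rfl fun r _ => ?_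
  rw [symp_swap (covD Ω r z), map_neg, cTensor, cTensor]
  ring

/-- `g_{m q̄} R^m_{k i l̄} = - g_{k l̄} g_{i q̄} - g_{i l̄} g_{k q̄} + C_{ikp} g^{p r̄} C̄_{lqr}`. -/
theorem sum_curv_mul_metric (i k l q : ι) : ∑ m, curv Ω m k i l z * metric Ω z m q =
    -(metric Ω z k l * metric Ω z i q + metric Ω z i l * metric Ω z k q) +
      ∑ p, ∑ r, cTensor Ω i k p z * invMetric Ω z p r * conj (cTensor Ω l q r z) := by
  have h1 := dzbar_symp_cbar l (h.diff_covDD hz i k) (h.diff_covD hz q)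
  rw [h.dzbar_eqOn (g := fun _ => 0) (fun w hw => h.symp_covDD_cbar_covD hw i k q) hz, dzbar_const,
    h.dzbarV_covDD hz, h.dzV_covD hz, cbar_add, cbar_sub, cbar_sum] at h1
  simp only [symp_add_left, symp_sum_left, symp_smul_left, symp_add_right, symp_sub_right,
    symp_sum_right, symp_smul_right, cbar_smul, h.symp_covDD_cbar_covD hz,
    h.symp_covD_cbar_covD hz, h.symp_covDD_cbar_covDD hz, mul_zero, Finset.sum_const_zero] at h1
  have h2 : ∑ m, curv Ω m k i l z * (I * metric Ω z m q) =
      I * ∑ m, curv Ω m k i l z * metric Ω z m q := by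
    rw [Finset.mul_sum]; exact Finset.sum_congr rfl fun _ _ => by ring
  rw [h2] at h1
  apply mul_left_cancel₀ I_ne_zero
  linear_combination -h1

theorem curv_eq (m i k l : ι) : curv Ω m k i l z = ∑ q, invMetric Ω z m q *
    (-(metric Ω z k l * metric Ω z i q + metric Ω z i l * metric Ω z k q) +
      ∑ p, ∑ r, cTensor Ω i k p z * invMetric Ω z p r * conj (cTensor Ω l q r z)) := by
  simp only [← h.sum_curv_mul_metric hz, Finset.mul_sum]
  rw [Finset.sum_comm]
  have h1 : ∀ n, ∑ q, invMetric Ω z m q * (curv Ω n k i l z * metric Ω z n q) =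
      curv Ω n k i l z * if n = m then 1 else 0 := fun n => by
    rw [← h.sum_metric_mul_inv hz, Finset.mul_sum]
    exact Finset.sum_congr rfl fun _ _ => by ring
  simp [h1]

end SpecialOn

section ChainRule

variable {κ ι : Type} [Fintype κ] [DecidableEq κ] [Fintype ι] [DecidableEq ι]
  {T : (κ → ℂ) → ι → ℂ} {f : (ι → ℂ) → ℂ} {w : κ → ℂ}

theorem fderiv_comp_eq_sum (hf : DifferentiableAt ℝ f (T w))
    (hT : ∀ i, DifferentiableAt ℂ (fun y => T y i) w) (v : κ → ℂ) :
    fderiv ℝ (fun y => f (T y)) w v =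
      ∑ i, (fderiv ℂ (fun y => T y i) w v * dz i f (T w) +
        conj (fderiv ℂ (fun y => T y i) w v) * dzbar i f (T w)) := by
  have h1 : HasFDerivAt T (ContinuousLinearMap.pi fun i => fderiv ℂ (fun y => T y i) w) w :=
    hasFDerivAt_pi.2 fun i => (hT i).hasFDerivAt
  have h2 := hf.hasFDerivAt.comp w (h1.restrictScalars ℝ)
  have h3 : fderiv ℝ (fun y => f (T y)) w = _ := h2.fderiv
  rw [h3, ContinuousLinearMap.comp_apply, fderiv_eq_sum_dz]
  rfl

theorem dz_comp (hf : DifferentiableAt ℝ f (T w))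
    (hT : ∀ i, DifferentiableAt ℂ (fun y => T y i) w) (a : κ) :
    dz a (fun y => f (T y)) w = ∑ i, dz i f (T w) * dz a (fun y => T y i) w := by
  rw [dz, fderiv_comp_eq_sum hf hT, fderiv_comp_eq_sum hf hT, Finset.mul_sum,
    ← Finset.sum_sub_distrib, Finset.mul_sum]
  refine Finset.sum_congr rfl fun i _ => ?_
  rw [dz_of_holomorphic a (hT i), single_I_eq, map_smul, smul_eq_mul, map_mul, conj_I]
  linear_combination (1 / 2 * (conj (fderiv ℂ (fun y => T y i) w (Pi.single a 1)) * dzbar i f (T w)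
    - fderiv ℂ (fun y => T y i) w (Pi.single a 1) * dz i f (T w))) * I_mul_I

theorem dzbar_comp (hf : DifferentiableAt ℝ f (T w))
    (hT : ∀ i, DifferentiableAt ℂ (fun y => T y i) w) (a : κ) :
    dzbar a (fun y => f (T y)) w =
      ∑ i, dzbar i f (T w) * conj (dz a (fun y => T y i) w) := by
  rw [dzbar, fderiv_comp_eq_sum hf hT, fderiv_comp_eq_sum hf hT, Finset.mul_sum,
    ← Finset.sum_add_distrib, Finset.mul_sum]
  refine Finset.sum_congr rfl fun i _ => ?_
  rw [dz_of_holomorphic a (hT i), single_I_eq, map_smul, smul_eq_mul, map_mul, conj_I]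
  linear_combination (1 / 2 * (fderiv ℂ (fun y => T y i) w (Pi.single a 1) * dz i f (T w) -
    conj (fderiv ℂ (fun y => T y i) w (Pi.single a 1)) * dzbar i f (T w))) * I_mul_I

/-- Holomorphic change of variables for the mixed second derivatives. -/
theorem dz_dzbar_comp {B : Set (κ → ℂ)} (hB : IsOpen B)
    (hT : ∀ i, DifferentiableOn ℂ (fun y => T y i) B) {f' : (κ → ℂ) → ℂ}
    (hf' : ∀ y ∈ B, f' y = f (T y)) (hf : ∀ y ∈ B, ContDiffAt ℝ ∞ f (T y)) (hw : w ∈ B) (a b : κ) :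
    dz a (dzbar b f') w = ∑ i, ∑ k, dz a (fun y => T y i) w * dz i (dzbar k f) (T w) *
      conj (dz b (fun y => T y k) w) := by
  have hTd : ∀ y ∈ B, ∀ i, DifferentiableAt ℂ (fun y => T y i) y := fun y hy i =>
    (hT i).differentiableAt (hB.mem_nhds hy)
  have h1 : ∀ y ∈ B, dzbar b f' y = ∑ k, dzbar k f (T y) * conj (dz b (fun y => T y k) y) := by
    intro y hy
    rw [dzbar_congr b (Filter.eventuallyEq_of_mem (hB.mem_nhds hy) hf'),
      dzbar_comp (hf y hy).differentiableAt_top (hTd y hy)]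
  have hJ : ∀ k, DifferentiableAt ℂ (dz b fun y => T y k) w := by
    intro k
    have h2 := (differentiableOn_fderiv_apply hB (hT k) (Pi.single b 1)).differentiableAt
      (hB.mem_nhds hw)
    exact h2.congr_of_eventuallyEq (Filter.eventuallyEq_of_mem (hB.mem_nhds hw) fun y hy =>
      dz_of_holomorphic b (hTd y hy k))
  have hT1 : DifferentiableAt ℝ T w :=
    (differentiableAt_pi.2 (hTd w hw)).restrictScalars ℝ
  have hD : ∀ k, DifferentiableAt ℝ (dzbar k f) (T w) := fun k =>
    (contDiffAt_dzbar k (hf w hw)).differentiableAt_top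
  have hDT : ∀ k, DifferentiableAt ℝ (fun y => dzbar k f (T y)) w := fun k => (hD k).comp w hT1
  have hJc : ∀ k, DifferentiableAt ℝ (fun y => conj (dz b (fun y => T y k) y)) w := fun k =>
    differentiableAt_conj ((hJ k).restrictScalars ℝ)
  rw [dz_congr a (Filter.eventuallyEq_of_mem (hB.mem_nhds hw) h1),
    dz_sum _ _ fun k _ => (hDT k).fun_mul (hJc k), Finset.sum_comm]
  refine Finset.sum_congr rfl fun k _ => ?_
  rw [dz_mul a (hDT k) (hJc k), dz_conj a ((hJ k).restrictScalars ℝ),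
    dzbar_of_holomorphic a (hJ k), dz_comp (hD k) (hTd w hw), map_zero, mul_zero, add_zero,
    Finset.sum_mul]
  exact Finset.sum_congr rfl fun i _ => by ring

end ChainRule

section Restriction

variable {nC nV' : ℕ}

theorem cbar_restrictVec (v : SympVec (Fin nC ⊕ Fin nV')) :
    cbar (restrictVec v) = restrictVec (cbar v) := by
  ext (x | x) <;> rfl

theorem restrictVec_smul (c : ℂ) (v : SympVec (Fin nC ⊕ Fin nV')) :
    restrictVec (c • v) = c • restrictVec v := by
  ext (x | x) <;> rfl

theorem sum_option_sum {α : Type*} [AddCommMonoid α] (f : Option (Fin nC ⊕ Fin nV') → α) :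
    ∑ l, f l = ∑ x, f (vecX x) + ∑ l, f (vecΛ l) := by
  rw [Fintype.sum_option, Fintype.sum_option, Fintype.sum_sum_type, add_assoc]
  rfl

theorem symp_eq_restrictVec_add (v w : SympVec (Fin nC ⊕ Fin nV')) :
    symp v w = symp (restrictVec v) (restrictVec w) +
      ∑ l, (v (Sum.inr (vecΛ l)) * w (Sum.inl (vecΛ l)) -
        v (Sum.inl (vecΛ l)) * w (Sum.inr (vecΛ l))) := by
  rw [symp, sum_option_sum]
  rfl

/-- The transversal components of `v` vanish. -/
def IsTangent (v : SympVec (Fin nC ⊕ Fin nV')) : Prop :=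
  ∀ l, v (Sum.inl (vecΛ l)) = 0 ∧ v (Sum.inr (vecΛ l)) = 0

theorem symp_restrictVec_of_upper {v w : SympVec (Fin nC ⊕ Fin nV')}
    (hv : ∀ l, v (Sum.inl (vecΛ l)) = 0) (hw : ∀ l, w (Sum.inl (vecΛ l)) = 0) :
    symp (restrictVec v) (restrictVec w) = symp v w := by
  rw [symp_eq_restrictVec_add v w]
  simp [hv, hw]

theorem symp_restrictVec_of_tangent (v : SympVec (Fin nC ⊕ Fin nV'))
    {w : SympVec (Fin nC ⊕ Fin nV')} (hw : IsTangent w) :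
    symp (restrictVec v) (restrictVec w) = symp v w := by
  rw [symp_eq_restrictVec_add v w]
  simp [fun l => (hw l).1, fun l => (hw l).2]

/-- `ΩR` is the restriction of the section `Ω` along the holomorphic map `T`, along which the
components `X^Λ` vanish. -/
structure IsRestriction (Ω : (Fin nC ⊕ Fin nV' → ℂ) → SympVec (Fin nC ⊕ Fin nV'))
    (U : Set (Fin nC ⊕ Fin nV' → ℂ)) (T : (Fin nC → ℂ) → Fin nC ⊕ Fin nV' → ℂ)
    (ΩR : (Fin nC → ℂ) → SympVec (Fin nC)) (B : Set (Fin nC → ℂ)) : Prop where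
  specialOn : SpecialOn Ω U
  isOpen : IsOpen B
  differentiableOn : ∀ i, DifferentiableOn ℂ (fun w => T w i) B
  mapsTo : ∀ w ∈ B, T w ∈ U
  eq : ∀ w ∈ B, ΩR w = restrictVec (Ω (T w))
  upper_zero : ∀ w ∈ B, ∀ l, Ω (T w) (Sum.inl (vecΛ l)) = 0

namespace IsRestriction

variable {Ω : (Fin nC ⊕ Fin nV' → ℂ) → SympVec (Fin nC ⊕ Fin nV')}
    {U : Set (Fin nC ⊕ Fin nV' → ℂ)} {T : (Fin nC → ℂ) → Fin nC ⊕ Fin nV' → ℂ}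
    {ΩR : (Fin nC → ℂ) → SympVec (Fin nC)} {B : Set (Fin nC → ℂ)}
    (h : IsRestriction Ω U T ΩR B) {w : Fin nC → ℂ} (hw : w ∈ B)
include h hw

theorem diff_T (i) : DifferentiableAt ℂ (fun w => T w i) w :=
  (h.differentiableOn i).differentiableAt (h.isOpen.mem_nhds hw)

theorem hermNorm_eq : hermNorm ΩR w = hermNorm Ω (T w) := by
  rw [hermNorm, hermNorm, h.eq w hw, cbar_restrictVec,
    symp_restrictVec_of_upper (h.upper_zero w hw) fun l => ?_]
  simp [cbar, h.upper_zero w hw]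

theorem kahlerPot_eq : kahlerPot ΩR w = kahlerPot Ω (T w) := by
  rw [kahlerPot, kahlerPot, h.hermNorm_eq hw]

theorem covSec_eq : covSec ΩR w = restrictVec (covSec Ω (T w)) := by
  have h1 : covSec Ω (T w) = (Real.exp (kahlerPot Ω (T w) / 2) : ℂ) • Ω (T w) := rfl
  rw [h1, restrictVec_smul, ← h.eq w hw, ← h.kahlerPot_eq hw]
  rfl

theorem metric_eq (a b : Fin nC) : metric ΩR w a b =
    ∑ i, ∑ k, dz a (fun y => T y i) w * metric Ω (T w) i k *
      conj (dz b (fun y => T y k) w) :=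
  dz_dzbar_comp h.isOpen h.differentiableOn
    (fun y hy => by rw [h.kahlerPot_eq hy])
    (fun y hy => h.specialOn.contDiffAt_kahlerPot (h.mapsTo y hy)) hw a b

theorem dz_sec_eq (a : Fin nC) (s) : dz a (fun y => Ω (T y) s) w =
    ∑ i, dz i (fun y => Ω y s) (T w) * dz a (fun y => T y i) w :=
  dz_comp (f := fun y => Ω y s)
    (h.specialOn.contDiffAt_sec (h.mapsTo w hw) s).differentiableAt_top (h.diff_T hw) a

theorem specialAt (hJ : ∀ c : Fin nC → ℂ, (∀ i, ∑ a, dz a (fun y => T y i) w * c a = 0) → c = 0) :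
    SpecialAt ΩR w where
  norm_pos := by
    rw [h.hermNorm_eq hw]
    exact (h.specialOn.special _ (h.mapsTo w hw)).norm_pos
  legendre a := by
    set D : SympVec (Fin nC ⊕ Fin nV') := fun s => dz a (fun y => Ω (T y) s) w with hD
    have h1 : (fun s => dz a (fun y => ΩR y s) w) = restrictVec D := by
      ext (x | x)
      · exact dz_congr a (Filter.eventuallyEq_of_mem (h.isOpen.mem_nhds hw) fun y hy => by
          rw [h.eq y hy]; rfl)
      · exact dz_congr a (Filter.eventuallyEq_of_mem (h.isOpen.mem_nhds hw) fun y hy => by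
          rw [h.eq y hy]; rfl)
    have h2 : ∀ l, D (Sum.inl (vecΛ l)) = 0 := fun l => by
      show dz a (fun y => Ω (T y) (Sum.inl (vecΛ l))) w = 0
      rw [dz_congr (g := fun _ => 0) a
        (Filter.eventuallyEq_of_mem (h.isOpen.mem_nhds hw) fun y hy => h.upper_zero y hy l),
        dz_const]
    have h3 : D = ∑ i, dz a (fun y => T y i) w • dzV i Ω (T w) := by
      ext s
      simp only [hD, Finset.sum_apply, Pi.smul_apply, smul_eq_mul]
      rw [h.dz_sec_eq hw]
      exact Finset.sum_congr rfl fun i _ => mul_comm _ _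
    rw [h1, h.eq w hw, symp_restrictVec_of_upper (h.upper_zero w hw) h2, h3, symp_sum_right]
    refine Finset.sum_eq_zero fun i _ => ?_
    have h4 : symp (Ω (T w)) (dzV i Ω (T w)) = 0 :=
      (h.specialOn.special _ (h.mapsTo w hw)).legendre i
    rw [symp_smul_right, h4, mul_zero]
  metric_pos := by
    set J : Matrix (Fin nC ⊕ Fin nV') (Fin nC) ℂ :=
      Matrix.of fun i a => conj (dz a (fun y => T y i) w) with hJdef
    have h1 : metric ΩR w = J.conjTranspose * metric Ω (T w) * J := by
      ext a b
      rw [h.metric_eq hw]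
      simp only [Matrix.mul_apply, Finset.sum_mul, hJdef, Matrix.conjTranspose_apply, Matrix.of_apply]
      rw [Finset.sum_comm]
      simp
    rw [h1]
    refine (h.specialOn.special _ (h.mapsTo w hw)).metric_pos.conjTranspose_mul_mul_same ?_
    intro x y hxy
    have h2 : J.mulVec (x - y) = 0 := by rw [Matrix.mulVec_sub, sub_eq_zero]; exact hxy
    have h3 := hJ (fun a => conj ((x - y) a)) fun i => by
      have := congrArg conj (congrFun h2 i)
      simpa [Matrix.mulVec, dotProduct, hJdef] using this
    ext a
    have := congrArg conj (congrFun h3 a)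
    simp only [conj_conj, Pi.zero_apply, map_zero] at this
    exact sub_eq_zero.1 this

end IsRestriction

end Restriction

section Slice

variable {nC nV' : ℕ}

/-- The slice `z^α = 0`. -/
def sliceEmb (nV' : ℕ) (w : Fin nC → ℂ) : Fin nC ⊕ Fin nV' → ℂ := Sum.elim w 0

theorem differentiable_slice (i : Fin nC ⊕ Fin nV') :
    Differentiable ℂ (fun w : Fin nC → ℂ => sliceEmb nV' w i) := by
  rcases i with i | α
  · exact differentiable_apply i
  · exact differentiable_const 0

theorem dz_slice_inl (a i : Fin nC) (w : Fin nC → ℂ) :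
    dz a (fun y => sliceEmb nV' y (Sum.inl i)) w = if i = a then 1 else 0 := by
  rw [dz_of_holomorphic a (differentiable_slice _ _)]
  have : HasFDerivAt (fun y : Fin nC → ℂ => sliceEmb nV' y (Sum.inl i))
    (ContinuousLinearMap.proj (R := ℂ) (φ := fun _ : Fin nC => ℂ) i) w :=
    (ContinuousLinearMap.proj (R := ℂ) (φ := fun _ : Fin nC => ℂ) i).hasFDerivAt
  rw [this.fderiv]
  simp [Pi.single_apply]

theorem dz_slice_inr (a : Fin nC) (α : Fin nV') (w : Fin nC → ℂ) :
    dz a (fun y => sliceEmb nV' y (Sum.inr α)) w = 0 := dz_const a 0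

theorem dz_comp_slice {f : (Fin nC ⊕ Fin nV' → ℂ) → ℂ} {w : Fin nC → ℂ}
    (hf : DifferentiableAt ℝ f (sliceEmb nV' w)) (a : Fin nC) :
    dz a (fun y => f (sliceEmb nV' y)) w = dz (Sum.inl a) f (sliceEmb nV' w) := by
  rw [dz_comp hf fun i => differentiable_slice i w, Fintype.sum_sum_type]
  simp [dz_slice_inl, dz_slice_inr]

theorem inv_block_zero {κ ν : Type*} [Fintype κ] [Fintype ν] [DecidableEq κ] [DecidableEq ν]
    {g : Matrix (κ ⊕ ν) (κ ⊕ ν) ℂ} (hg : IsUnit g.det)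
    (h12 : ∀ i α, g (Sum.inl i) (Sum.inr α) = 0) (h21 : ∀ i α, g (Sum.inr α) (Sum.inl i) = 0)
    (i : κ) (α : ν) : g⁻¹ (Sum.inl i) (Sum.inr α) = 0 := by
  set y : κ ⊕ ν → ℂ := Sum.elim (fun i => g⁻¹ (Sum.inl i) (Sum.inr α)) 0 with hy
  have h1 : g.mulVec y = 0 := by
    ext (k | β)
    · have := congrFun (congrFun (Matrix.mul_nonsing_inv g hg) (Sum.inl k)) (Sum.inr α)
      rw [Matrix.mul_apply, Fintype.sum_sum_type] at this
      simpa [Matrix.mulVec, dotProduct, Fintype.sum_sum_type, hy, h12] using this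
    · simp [Matrix.mulVec, dotProduct, Fintype.sum_sum_type, hy, h21]
  have h2 : y = 0 := by
    rw [← Matrix.one_mulVec y, ← Matrix.nonsing_inv_mul g hg, ← Matrix.mulVec_mulVec, h1,
      Matrix.mulVec_zero]
  exact congrFun h2 (Sum.inl i)

/-- The slice `z^α = 0` over `B` is an orthogonal slice along which `L^Λ` and `f_i^Λ` vanish. -/
structure AdaptedSlice (Ω : (Fin nC ⊕ Fin nV' → ℂ) → SympVec (Fin nC ⊕ Fin nV'))
    (U : Set (Fin nC ⊕ Fin nV' → ℂ)) (B : Set (Fin nC → ℂ)) : Prop where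
  specialOn : SpecialOn Ω U
  isOpen : IsOpen B
  mapsTo : ∀ w ∈ B, sliceEmb nV' w ∈ U
  orthogonal : ∀ w ∈ B, ∀ i α, metric Ω (sliceEmb nV' w) (Sum.inl i) (Sum.inr α) = 0
  secL_zero : ∀ w ∈ B, ∀ l, secL Ω (vecΛ l) (sliceEmb nV' w) = 0
  secf_zero : ∀ w ∈ B, ∀ i l, secf Ω (Sum.inl i) (vecΛ l) (sliceEmb nV' w) = 0

/-- The matrix of the transversal components `f̄_ᾱ^Λ`. -/
def transMat (Ω : (Fin nC ⊕ Fin nV' → ℂ) → SympVec (Fin nC ⊕ Fin nV'))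
    (z : Fin nC ⊕ Fin nV' → ℂ) : Matrix (Fin nV') (Fin nV') ℂ :=
  Matrix.of fun l α => conj (secf Ω (Sum.inr α) (vecΛ l) z)

namespace AdaptedSlice

variable {Ω : (Fin nC ⊕ Fin nV' → ℂ) → SympVec (Fin nC ⊕ Fin nV')}
    {U : Set (Fin nC ⊕ Fin nV' → ℂ)} {B : Set (Fin nC → ℂ)}
    (h : AdaptedSlice Ω U B) {w : Fin nC → ℂ} (hw : w ∈ B)
include h hw

theorem mem : sliceEmb nV' w ∈ U := h.mapsTo w hw

theorem dz_eq_zero {f : (Fin nC ⊕ Fin nV' → ℂ) → ℂ} (hf : DifferentiableAt ℝ f (sliceEmb nV' w))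
    (h0 : ∀ y ∈ B, f (sliceEmb nV' y) = 0) (i : Fin nC) : dz (Sum.inl i) f (sliceEmb nV' w) = 0 := by
  rw [← dz_comp_slice hf, dz_congr (g := fun _ => 0) i
    (Filter.eventuallyEq_of_mem (h.isOpen.mem_nhds hw) h0), dz_const]

theorem orthogonal' (i α) : metric Ω (sliceEmb nV' w) (Sum.inr α) (Sum.inl i) = 0 := by
  rw [← h.specialOn.metric_conj (h.mem hw), h.orthogonal w hw, map_zero]

theorem invMetric_zero (i α) : invMetric Ω (sliceEmb nV' w) (Sum.inr α) (Sum.inl i) = 0 :=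
  inv_block_zero (h.specialOn.isUnit_det_metric (h.mem hw)) (h.orthogonal w hw)
    (fun i α => h.orthogonal' hw i α) i α

theorem invMetric_zero' (i α) : invMetric Ω (sliceEmb nV' w) (Sum.inl i) (Sum.inr α) = 0 := by
  have h1 := (h.specialOn.special _ (h.mem hw)).metric_pos.isHermitian.inv.apply
    (Sum.inr α) (Sum.inl i)
  have h2 : (metric Ω (sliceEmb nV' w))⁻¹ (Sum.inl i) (Sum.inr α) = 0 := h.invMetric_zero hw i α
  rw [h2, star_zero] at h1
  exact h1.symm

theorem christoffel_zero (i k α) :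
    christoffel Ω (Sum.inr α) (Sum.inl i) (Sum.inl k) (sliceEmb nV' w) = 0 := by
  rw [christoffel, Fintype.sum_sum_type]
  have h1 : ∀ β, dz (Sum.inl i) (fun w => metric Ω w (Sum.inl k) (Sum.inr β)) (sliceEmb nV' w) = 0 :=
    fun β => h.dz_eq_zero hw
      (h.specialOn.contDiffAt_metric (h.mem hw) _ _).differentiableAt_top
      (fun y hy => h.orthogonal y hy k β) i
  simp [h.invMetric_zero hw, h1]

theorem covD_upper_zero (i l) : covD Ω (Sum.inl i) (sliceEmb nV' w) (Sum.inl (vecΛ l)) = 0 :=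
  h.secf_zero w hw i l

theorem covSec_upper_zero (l) : covSec Ω (sliceEmb nV' w) (Sum.inl (vecΛ l)) = 0 :=
  h.secL_zero w hw l

theorem sec_upper_zero (l) : Ω (sliceEmb nV' w) (Sum.inl (vecΛ l)) = 0 := by
  have h1 : (Real.exp (kahlerPot Ω (sliceEmb nV' w) / 2) : ℂ) * Ω (sliceEmb nV' w) (Sum.inl (vecΛ l)) = 0 :=
    h.secL_zero w hw l
  exact (mul_eq_zero.1 h1).resolve_left (by exact_mod_cast (Real.exp_pos _).ne')

theorem covDD_upper_zero (i k l) :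
    covDD Ω (Sum.inl i) (Sum.inl k) (sliceEmb nV' w) (Sum.inl (vecΛ l)) = 0 := by
  rw [covDD, h.dz_eq_zero hw (h.specialOn.diff_covD (h.mem hw) _ _)
    (fun y hy => h.covD_upper_zero hy k l), h.covD_upper_zero hw, Fintype.sum_sum_type]
  simp [h.covD_upper_zero hw, h.christoffel_zero hw]

theorem isUnit_det_transMat : IsUnit (transMat Ω (sliceEmb nV' w)).det := by
  rw [isUnit_iff_ne_zero]
  intro hdet
  obtain ⟨s, hs, hs0⟩ := Matrix.exists_vecMul_eq_zero_iff.2 hdet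
  set t : Option (Fin nC ⊕ Fin nV') → ℂ := fun l => l.elim 0 (Sum.elim 0 s) with ht
  have htX : ∀ x : Option (Fin nC), t (vecX x) = 0 := by rintro (_ | x) <;> rfl
  have htΛ : ∀ l, t (vecΛ l) = s l := fun l => rfl
  have h1 : Matrix.vecMul t (upperMat Ω (sliceEmb nV' w)) = 0 := by
    ext c
    rw [Matrix.vecMul, dotProduct, sum_option_sum]
    simp only [htX, htΛ, zero_mul, Finset.sum_const_zero, zero_add]
    rcases c with _ | i | α
    · exact Finset.sum_eq_zero fun l _ => by
        rw [upperMat, Matrix.of_apply, Option.elim_none, h.secL_zero w hw, mul_zero]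
    · exact Finset.sum_eq_zero fun l _ => by
        rw [upperMat, Matrix.of_apply, Option.elim_some, h.secf_zero w hw, map_zero, mul_zero]
    · exact congrFun hs0 α
  have h2 : (upperMat Ω (sliceEmb nV' w)).det ≠ 0 := by
    rw [upperMat_eq]
    exact ((h.specialOn.isFrame (h.mem hw)).isUnit_det_upper).ne_zero
  apply h2
  rw [← Matrix.exists_vecMul_eq_zero_iff]
  refine ⟨t, fun h0 => hs ?_, h1⟩
  ext l
  rw [← htΛ, h0]; rfl

theorem sum_cTensor_zero (i k l) : I * ∑ α, ∑ β,
    cTensor Ω (Sum.inl i) (Sum.inl k) (Sum.inr α) (sliceEmb nV' w) *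
      invMetric Ω (sliceEmb nV' w) (Sum.inr α) (Sum.inr β) *
      conj (secf Ω (Sum.inr β) (vecΛ l) (sliceEmb nV' w)) = 0 := by
  have h1 := congrFun (h.specialOn.covDD_eq (h.mem hw) (Sum.inl i) (Sum.inl k))
    (Sum.inl (vecΛ l))
  rw [h.covDD_upper_zero hw] at h1
  simp only [Finset.sum_apply, Pi.smul_apply, smul_eq_mul] at h1
  simp only [Fintype.sum_sum_type, h.invMetric_zero' hw, cbar, h.covD_upper_zero hw, map_zero, mul_zero,
    zero_mul, Finset.sum_const_zero, zero_add] at h1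
  rw [h1]
  simp only [Finset.mul_sum]
  exact Finset.sum_congr rfl fun _ _ => Finset.sum_congr rfl fun _ _ => by
    simp only [secf]; ring

theorem cTensor_zero (i k α) :
    cTensor Ω (Sum.inl i) (Sum.inl k) (Sum.inr α) (sliceEmb nV' w) = 0 := by
  set a : Fin nV' → ℂ := fun β => ∑ α,
    cTensor Ω (Sum.inl i) (Sum.inl k) (Sum.inr α) (sliceEmb nV' w) *
      invMetric Ω (sliceEmb nV' w) (Sum.inr α) (Sum.inr β) with ha
  have h1 : (transMat Ω (sliceEmb nV' w)).mulVec a = 0 := by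
    ext l
    have h2 := (mul_eq_zero.1 (h.sum_cTensor_zero hw i k l)).resolve_left I_ne_zero
    rw [Finset.sum_comm] at h2
    rw [Pi.zero_apply, ← h2, Matrix.mulVec, dotProduct]
    refine Finset.sum_congr rfl fun β _ => ?_
    rw [ha, mul_comm, Finset.sum_mul]; rfl
  have h3 : a = 0 := by
    rw [← Matrix.one_mulVec a, ← Matrix.nonsing_inv_mul _ (h.isUnit_det_transMat hw),
      ← Matrix.mulVec_mulVec, h1, Matrix.mulVec_zero]
  have h4 : ∑ β, metric Ω (sliceEmb nV' w) (Sum.inr α) (Sum.inr β) * a β =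
      cTensor Ω (Sum.inl i) (Sum.inl k) (Sum.inr α) (sliceEmb nV' w) := by
    simp only [ha, Finset.mul_sum]
    rw [Finset.sum_comm]
    have h5 : ∀ δ, ∑ β, metric Ω (sliceEmb nV' w) (Sum.inr α) (Sum.inr β) *
        (cTensor Ω (Sum.inl i) (Sum.inl k) (Sum.inr δ) (sliceEmb nV' w) *
          invMetric Ω (sliceEmb nV' w) (Sum.inr δ) (Sum.inr β)) =
        cTensor Ω (Sum.inl i) (Sum.inl k) (Sum.inr δ) (sliceEmb nV' w) * if α = δ then 1 else 0 := by
      intro δ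
      have h6 := h.specialOn.sum_metric_mul_inv (h.mem hw) (Sum.inr α) (Sum.inr δ)
      rw [Fintype.sum_sum_type] at h6
      simp only [h.invMetric_zero hw, mul_zero, Finset.sum_const_zero, zero_add,
        Sum.inr.injEq] at h6
      rw [← h6, Finset.mul_sum]
      exact Finset.sum_congr rfl fun _ _ => by ring
    simp [h5]
  rw [← h4, h3]
  simp

theorem cTensor_zero_left (i k α) :
    cTensor Ω (Sum.inr α) (Sum.inl i) (Sum.inl k) (sliceEmb nV' w) = 0 := by
  rw [h.specialOn.cTensor_symm_left (h.mem hw), h.specialOn.cTensor_symm_right (h.mem hw),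
    h.cTensor_zero hw]

theorem cTensor_zero_mid (i k α) :
    cTensor Ω (Sum.inl i) (Sum.inr α) (Sum.inl k) (sliceEmb nV' w) = 0 := by
  rw [h.specialOn.cTensor_symm_right (h.mem hw), h.cTensor_zero hw]

theorem curv_inl_inr_zero (i α k l) :
    curv Ω (Sum.inl i) (Sum.inr α) (Sum.inl k) (Sum.inl l) (sliceEmb nV' w) = 0 := by
  simp [h.specialOn.curv_eq (h.mem hw), Fintype.sum_sum_type, h.invMetric_zero hw,
    h.invMetric_zero' hw, h.orthogonal' hw, h.cTensor_zero hw, h.cTensor_zero_mid hw]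

theorem curv_inr_inl_zero (i α k l) :
    curv Ω (Sum.inr α) (Sum.inl i) (Sum.inl k) (Sum.inl l) (sliceEmb nV' w) = 0 := by
  simp [h.specialOn.curv_eq (h.mem hw), Fintype.sum_sum_type, h.invMetric_zero hw,
    h.invMetric_zero' hw, h.orthogonal w hw, h.cTensor_zero hw, h.cTensor_zero_mid hw]

theorem curv_inl_inr_inr_zero
    (hC : ∀ α β γ, cTensor Ω (Sum.inr α) (Sum.inr β) (Sum.inr γ) (sliceEmb nV' w) = 0) (i α β γ) :
    curv Ω (Sum.inl i) (Sum.inr α) (Sum.inr β) (Sum.inr γ) (sliceEmb nV' w) = 0 := by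
  simp [h.specialOn.curv_eq (h.mem hw), Fintype.sum_sum_type, h.invMetric_zero hw,
    h.invMetric_zero' hw, h.orthogonal' hw, h.cTensor_zero_left hw, hC]

theorem curv_eq_sum (i α k l) :
    curv Ω (Sum.inl i) (Sum.inr α) (Sum.inl k) (Sum.inl l) (sliceEmb nV' w) =
        ∑ q, invMetric Ω (sliceEmb nV' w) (Sum.inl i) (Sum.inl q) *
          ((∑ p, ∑ r, cTensor Ω (Sum.inr α) (Sum.inl k) (Sum.inl p) (sliceEmb nV' w) *
              invMetric Ω (sliceEmb nV' w) (Sum.inl p) (Sum.inl r) *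
              conj (cTensor Ω (Sum.inl q) (Sum.inl l) (Sum.inl r) (sliceEmb nV' w))) +
            ∑ β, ∑ γ, cTensor Ω (Sum.inr α) (Sum.inl k) (Sum.inr β) (sliceEmb nV' w) *
              invMetric Ω (sliceEmb nV' w) (Sum.inr β) (Sum.inr γ) *
              conj (cTensor Ω (Sum.inl q) (Sum.inl l) (Sum.inr γ) (sliceEmb nV' w))) := by
  simp only [h.specialOn.curv_eq (h.mem hw), Fintype.sum_sum_type, h.invMetric_zero hw,
    h.invMetric_zero' hw, h.orthogonal' hw, zero_mul, mul_zero, Finset.sum_const_zero, add_zero,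
    zero_add, neg_zero, h.specialOn.cTensor_symm_left (h.mem hw) (Sum.inr α),
    h.specialOn.cTensor_symm_left (h.mem hw) (Sum.inl l)]

end AdaptedSlice

end Slice

section Restricted

variable {nC nV' : ℕ}

theorem restrictVec_add (v w : SympVec (Fin nC ⊕ Fin nV')) :
    restrictVec (v + w) = restrictVec v + restrictVec w := by
  ext (x | x) <;> rfl

theorem IsTangent.cbar {v : SympVec (Fin nC ⊕ Fin nV')} (hv : IsTangent v) :
    IsTangent (cbar v) := fun l => by simp [SpecialGeometry.cbar, (hv l).1, (hv l).2]

namespace AdaptedSlice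

variable {Ω : (Fin nC ⊕ Fin nV' → ℂ) → SympVec (Fin nC ⊕ Fin nV')}
    {U : Set (Fin nC ⊕ Fin nV' → ℂ)} {B : Set (Fin nC → ℂ)}
    (h : AdaptedSlice Ω U B)
include h

theorem isRestriction {ΩR : (Fin nC → ℂ) → SympVec (Fin nC)}
    (hR : ∀ w ∈ B, ΩR w = restrictVec (Ω (sliceEmb nV' w))) :
    IsRestriction Ω U (sliceEmb nV') ΩR B where
  specialOn := h.specialOn
  isOpen := h.isOpen
  differentiableOn i := (differentiable_slice i).differentiableOn
  mapsTo := h.mapsTo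
  eq := hR
  upper_zero _ hw l := h.sec_upper_zero hw l

variable {w : Fin nC → ℂ} (hw : w ∈ B)
include hw

theorem isFrame_restrict : IsFrame (restrictVec (covSec Ω (sliceEmb nV' w)))
    (fun i => restrictVec (covD Ω (Sum.inl i) (sliceEmb nV' w)))
    ((metric Ω (sliceEmb nV' w)).submatrix Sum.inl Sum.inl) := by
  have hF := h.specialOn.isFrame (h.mem hw)
  have hV := fun l => h.covSec_upper_zero hw l
  have hU := fun i l => h.covD_upper_zero hw i l
  have hVc : ∀ l, cbar (covSec Ω (sliceEmb nV' w)) (Sum.inl (vecΛ l)) = 0 := fun l => by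
    simp [cbar, hV]
  have hUc : ∀ i l, cbar (covD Ω (Sum.inl i) (sliceEmb nV' w)) (Sum.inl (vecΛ l)) = 0 := fun i l => by
    simp [cbar, hU]
  constructor
  · rw [cbar_restrictVec, symp_restrictVec_of_upper hV hVc, hF.symp_V_cbar]
  · intro i
    rw [symp_restrictVec_of_upper hV (hU i), hF.symp_V_u]
  · intro i k
    rw [symp_restrictVec_of_upper (hU i) (hU k), hF.symp_u_u]
  · intro i
    rw [cbar_restrictVec, symp_restrictVec_of_upper (hU i) hVc, hF.symp_u_cbar_V]
  · intro i k
    rw [cbar_restrictVec, symp_restrictVec_of_upper (hU i) (hUc k), hF.symp_u_cbar_u]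
    rfl
  · exact hF.posDef.submatrix Sum.inl_injective

theorem framePeriod_restrict (x y : Option (Fin nC)) :
    framePeriod (restrictVec (covSec Ω (sliceEmb nV' w)))
      (fun i => restrictVec (covD Ω (Sum.inl i) (sliceEmb nV' w))) x y =
    period Ω (sliceEmb nV' w) (vecX x) (vecX y) := by
  have hF := h.specialOn.isFrame (h.mem hw)
  have hR := h.isFrame_restrict hw
  set N : Matrix (Option (Fin nC)) (Option (Fin nC)) ℂ :=
    Matrix.of fun x y => period Ω (sliceEmb nV' w) (vecX x) (vecX y) with hN
  set V := covSec Ω (sliceEmb nV' w)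
  set u := fun i => covD Ω i (sliceEmb nV' w)
  have hcol : ∀ c, frameCol (restrictVec V) (fun i => restrictVec (u (Sum.inl i))) c =
      restrictVec (frameCol V u (vecX c)) := by
    rintro (_ | i)
    · rfl
    · exact cbar_restrictVec _
  have hup : ∀ c l, frameCol V u (vecX c) (Sum.inl (vecΛ l)) = 0 := by
    rintro (_ | i) l
    · exact h.covSec_upper_zero hw l
    · show conj (covD Ω (Sum.inl i) (sliceEmb nV' w) (Sum.inl (vecΛ l))) = 0
      rw [h.covD_upper_zero hw, map_zero]
  have h1 : N * frameUpper (restrictVec V) (fun i => restrictVec (u (Sum.inl i))) =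
      frameLower (restrictVec V) (fun i => restrictVec (u (Sum.inl i))) := by
    ext a c
    have h2 := hF.lower_eq (vecX c) (vecX a)
    rw [sum_option_sum] at h2
    simp only [hup, mul_zero, Finset.sum_const_zero, add_zero] at h2
    rw [Matrix.mul_apply]
    simp only [frameUpper, frameLower, Matrix.of_apply, hcol, hN, period_eq]
    exact h2.symm
  have h3 : framePeriod (restrictVec V) (fun i => restrictVec (u (Sum.inl i))) = N := by
    rw [framePeriod, ← h1, Matrix.mul_assoc, Matrix.mul_nonsing_inv _ hR.isUnit_det_upper,
      Matrix.mul_one]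
  rw [h3]
  rfl

theorem period_symm (x y) : period Ω (sliceEmb nV' w) x y = period Ω (sliceEmb nV' w) y x := by
  rw [period_eq]
  exact congrFun (congrFun (h.specialOn.isFrame (h.mem hw)).framePeriod_symm.symm x) y

theorem metric_eq_period (i k : Fin nC) : metric Ω (sliceEmb nV' w) (Sum.inl i) (Sum.inl k) =
    -2 * ∑ x, ∑ y, secf Ω (Sum.inl i) (vecX x) (sliceEmb nV' w) *
      ((period Ω (sliceEmb nV' w) (vecX x) (vecX y)).im : ℂ) *
      conj (secf Ω (Sum.inl k) (vecX y) (sliceEmb nV' w)) := by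
  have h1 := (h.isFrame_restrict hw).metric_eq i k
  simp only [h.framePeriod_restrict hw] at h1
  exact h1

section Section

variable {ΩR : (Fin nC → ℂ) → SympVec (Fin nC)}
    (hR : ∀ w ∈ B, ΩR w = restrictVec (Ω (sliceEmb nV' w)))
include hR

theorem metric_restrict (i k : Fin nC) :
    metric ΩR w i k = metric Ω (sliceEmb nV' w) (Sum.inl i) (Sum.inl k) := by
  rw [(h.isRestriction hR).metric_eq hw]
  simp only [Fintype.sum_sum_type, dz_slice_inl, dz_slice_inr]
  simp [apply_ite]

theorem covD_restrict (i : Fin nC) :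
    covD ΩR i w = restrictVec (covD Ω (Sum.inl i) (sliceEmb nV' w)) := by
  have hR' := h.isRestriction hR
  have hK : dK ΩR i w = dK Ω (Sum.inl i) (sliceEmb nV' w) := by
    rw [dK, dK, ← dz_comp_slice (f := fun w => (kahlerPot Ω w : ℂ))
      (h.specialOn.contDiffAt_kahlerPot (h.mem hw)).differentiableAt_top]
    exact dz_congr i (Filter.eventuallyEq_of_mem (h.isOpen.mem_nhds hw) fun y hy => by
      simp only [hR'.kahlerPot_eq hy])
  have hV : ∀ s s', (∀ v : SympVec (Fin nC ⊕ Fin nV'), restrictVec v s = v s') →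
      dz i (fun y => covSec ΩR y s) w =
        dz (Sum.inl i) (fun y => covSec Ω y s') (sliceEmb nV' w) := by
    intro s s' hs
    rw [← dz_comp_slice (f := fun y => covSec Ω y s') (h.specialOn.diff_covSec (h.mem hw) s')]
    exact dz_congr i (Filter.eventuallyEq_of_mem (h.isOpen.mem_nhds hw) fun y hy => by
      simp only [hR'.covSec_eq hy, hs])
  have hU : ∀ s s', (∀ v : SympVec (Fin nC ⊕ Fin nV'), restrictVec v s = v s') →
      covD ΩR i w s = restrictVec (covD Ω (Sum.inl i) (sliceEmb nV' w)) s := by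
    intro s s' hs
    rw [hs, covD, covD, hV s s' hs, hK, hR'.covSec_eq hw, hs]
  ext (x | x)
  · exact hU _ _ fun v => rfl
  · exact hU _ _ fun v => rfl

theorem period_restrict (x y : Option (Fin nC)) :
    period ΩR w x y = period Ω (sliceEmb nV' w) (vecX x) (vecX y) := by
  rw [← h.framePeriod_restrict hw, period_eq, (h.isRestriction hR).covSec_eq hw]
  simp only [h.covD_restrict hw hR]

end Section

section PeriodZero

variable (hN : ∀ x l, period Ω (sliceEmb nV' w) (vecX x) (vecΛ l) = 0)
include hN

theorem lower_transversal (c) (l : Fin nV') :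
    frameCol (covSec Ω (sliceEmb nV' w)) (fun i => covD Ω i (sliceEmb nV' w)) c (Sum.inr (vecΛ l)) =
      ∑ m, period Ω (sliceEmb nV' w) (vecΛ l) (vecΛ m) *
        frameCol (covSec Ω (sliceEmb nV' w)) (fun i => covD Ω i (sliceEmb nV' w)) c
          (Sum.inl (vecΛ m)) := by
  rw [(h.specialOn.isFrame (h.mem hw)).lower_eq, sum_option_sum, ← period_eq]
  simp only [h.period_symm hw (vecΛ l) (vecX _), hN, zero_mul, Finset.sum_const_zero, zero_add]

theorem isTangent_covSec : IsTangent (covSec Ω (sliceEmb nV' w)) := fun l =>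
  ⟨h.covSec_upper_zero hw l, (h.lower_transversal hw hN none l).trans
    (Finset.sum_eq_zero fun m _ => by
      rw [frameCol, Option.elim_none, h.covSec_upper_zero hw, mul_zero])⟩

theorem isTangent_sec : IsTangent (Ω (sliceEmb nV' w)) := fun l => by
  have he : (Real.exp (kahlerPot Ω (sliceEmb nV' w) / 2) : ℂ) ≠ 0 := by
    exact_mod_cast (Real.exp_pos _).ne'
  have h1 := h.isTangent_covSec hw hN l
  exact ⟨(mul_eq_zero.1 h1.1).resolve_left he, (mul_eq_zero.1 h1.2).resolve_left he⟩

theorem isTangent_covD (i) : IsTangent (covD Ω (Sum.inl i) (sliceEmb nV' w)) := fun l => by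
  refine ⟨h.covD_upper_zero hw i l, ?_⟩
  have h1 := h.lower_transversal hw hN (some (Sum.inl i)) l
  simp only [frameCol, Option.elim_some, cbar, h.covD_upper_zero hw, map_zero, mul_zero,
    Finset.sum_const_zero] at h1
  simpa using h1

theorem isTangent_dz (i) : IsTangent (dzV (Sum.inl i) Ω (sliceEmb nV' w)) := fun l => by
  have he : (Real.exp (kahlerPot Ω (sliceEmb nV' w) / 2) : ℂ) ≠ 0 := by
    exact_mod_cast (Real.exp_pos _).ne'
  have h1 := h.isTangent_covD hw hN i l
  have h2 := h.isTangent_sec hw hN l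
  rw [h.specialOn.covD_eq (h.mem hw)] at h1
  simpa [h2.1, h2.2, he] using h1

/-- `f_α^X = 0` and `h_{Xα} = 0`. -/
theorem restrictVec_covD_inr (α : Fin nV') :
    restrictVec (covD Ω (Sum.inr α) (sliceEmb nV' w)) = 0 := by
  have hF := h.specialOn.isFrame (h.mem hw)
  have h0 : restrictVec (cbar (covD Ω (Sum.inr α) (sliceEmb nV' w))) = 0 := by
    apply (h.isFrame_restrict hw).eq_zero_of_lower_eq
    · intro x
      have h1 := hF.lower_eq (some (Sum.inr α)) (vecX x)
      rw [sum_option_sum, ← period_eq] at h1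
      simp only [hN, zero_mul, Finset.sum_const_zero, add_zero] at h1
      simp only [h.framePeriod_restrict hw]
      exact h1
    · rw [cbar_restrictVec, symp_restrictVec_of_tangent _ (h.isTangent_covSec hw hN).cbar,
        symp_cbar, symp_swap, hF.symp_V_u, neg_zero, map_zero]
    · intro i
      rw [symp_restrictVec_of_tangent _ (h.isTangent_covD hw hN i), hF.symp_cbar_u_u,
        h.orthogonal w hw, mul_zero]
  rw [← cbar_restrictVec] at h0
  rw [← cbar_cbar (restrictVec _), h0]
  ext
  simp [cbar]

theorem covD_inr_zero (α : Fin nV') (x : Option (Fin nC)) :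
    secf Ω (Sum.inr α) (vecX x) (sliceEmb nV' w) = 0 ∧
      sech Ω (Sum.inr α) (vecX x) (sliceEmb nV' w) = 0 :=
  ⟨congrFun (h.restrictVec_covD_inr hw hN α) (Sum.inl x),
    congrFun (h.restrictVec_covD_inr hw hN α) (Sum.inr x)⟩

theorem covD_inr_transversal (α l : Fin nV') :
    covD Ω (Sum.inr α) (sliceEmb nV' w) (Sum.inl (vecΛ l)) =
      (Real.exp (kahlerPot Ω (sliceEmb nV' w) / 2) : ℂ) *
        dz (Sum.inr α) (fun y => Ω y (Sum.inl (vecΛ l))) (sliceEmb nV' w) ∧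
    covD Ω (Sum.inr α) (sliceEmb nV' w) (Sum.inr (vecΛ l)) =
      (Real.exp (kahlerPot Ω (sliceEmb nV' w) / 2) : ℂ) *
        dz (Sum.inr α) (fun y => Ω y (Sum.inr (vecΛ l))) (sliceEmb nV' w) := by
  have h2 := h.isTangent_sec hw hN l
  rw [h.specialOn.covD_eq (h.mem hw)]
  simp [h2.1, h2.2, dzV]

/-- `∂_α F_Λ = N̄_{ΛΣ} ∂_α X^Σ` along the slice. -/
theorem dz_lower_eq (α l : Fin nV') :
    dz (Sum.inr α) (fun y => Ω y (Sum.inr (vecΛ l))) (sliceEmb nV' w) =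
      ∑ m, conj (period Ω (sliceEmb nV' w) (vecΛ l) (vecΛ m)) *
        dz (Sum.inr α) (fun y => Ω y (Sum.inl (vecΛ m))) (sliceEmb nV' w) := by
  have he : (Real.exp (kahlerPot Ω (sliceEmb nV' w) / 2) : ℂ) ≠ 0 := by
    exact_mod_cast (Real.exp_pos _).ne'
  have h1 := congrArg conj (h.lower_transversal hw hN (some (Sum.inr α)) l)
  simp only [frameCol, Option.elim_some, cbar, map_sum, map_mul, conj_conj,
    (h.covD_inr_transversal hw hN α _).1, (h.covD_inr_transversal hw hN α _).2] at h1
  apply mul_left_cancel₀ he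
  rw [h1, Finset.mul_sum]
  exact Finset.sum_congr rfl fun _ _ => by ring

theorem isUnit_det_dz :
    IsUnit (Matrix.of fun l α => dz (Sum.inr α) (fun y => Ω y (Sum.inl (vecΛ l)))
      (sliceEmb nV' w) : Matrix (Fin nV') (Fin nV') ℂ).det := by
  have he : (Real.exp (kahlerPot Ω (sliceEmb nV' w) / 2) : ℂ) ≠ 0 := by
    exact_mod_cast (Real.exp_pos _).ne'
  have h1 := h.isUnit_det_transMat hw
  set P : Matrix (Fin nV') (Fin nV') ℂ := Matrix.of fun l α =>
    dz (Sum.inr α) (fun y => Ω y (Sum.inl (vecΛ l))) (sliceEmb nV' w) with hP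
  have h2 : transMat Ω (sliceEmb nV' w) = (starRingEnd ℂ).mapMatrix
      ((Real.exp (kahlerPot Ω (sliceEmb nV' w) / 2) : ℂ) • P) := by
    ext l α
    simp only [transMat, Matrix.of_apply, secf, (h.covD_inr_transversal hw hN α l).1]
    rfl
  rw [h2, ← RingHom.map_det, Matrix.det_smul, isUnit_iff_ne_zero] at h1
  rw [isUnit_iff_ne_zero]
  intro h3
  rw [h3] at h1
  simp at h1

end PeriodZero

end AdaptedSlice

end Restricted

section Prepotential

variable {ι : Type} [Fintype ι] [DecidableEq ι] {W : Set (Option ι → ℂ)}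
  {F : (Option ι → ℂ) → ℂ}

namespace IsPrepotential

variable (h : IsPrepotential W F)
include h

theorem differentiableOn_gradF (l : Option ι) : DifferentiableOn ℂ (gradF F l) W :=
  differentiableOn_fderiv_apply h.isOpen h.holomorphic _

theorem gradF_smul (l : Option ι) {x : Option ι → ℂ} (hx : x ∈ W) {c : ℂ} (hc : c ≠ 0) :
    gradF F l (c • x) = c * gradF F l x := by
  have hd : ∀ y ∈ W, HasFDerivAt F (fderiv ℂ F y) y := fun y hy =>
    (h.holomorphic.differentiableAt (h.isOpen.mem_nhds hy)).hasFDerivAt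
  have h1 : HasFDerivAt (fun y => F (c • y)) _ x :=
    (hd _ (h.cone x hx c hc)).comp x ((hasFDerivAt_id x).const_smul c)
  have h2 : HasFDerivAt (fun y => c ^ 2 * F y) _ x := (hd x hx).const_mul (c ^ 2)
  have h3 := (h2.congr_of_eventuallyEq (Filter.eventuallyEq_of_mem (h.isOpen.mem_nhds hx)
    fun y hy => h.homogeneous y hy c hc)).unique h1
  have h4 := DFunLike.congr_fun h3 (Pi.single l 1)
  simp only [smul_apply, smul_eq_mul, ContinuousLinearMap.comp_apply,
    map_smul, ContinuousLinearMap.id_apply] at h4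
  apply mul_left_cancel₀ hc
  rw [gradF, gradF, ← h4]
  ring

/-- Euler's relation `F_{ΣΛ} X^Σ = F_Λ`. -/
theorem sum_hessF (l : Option ι) {x : Option ι → ℂ} (hx : x ∈ W) :
    ∑ m, x m * hessF F m l x = gradF F l x := by
  have hd := ((h.differentiableOn_gradF l).differentiableAt (h.isOpen.mem_nhds hx)).hasFDerivAt
  have h0 : HasDerivAt (fun c : ℂ => c • x) x 1 := by
    simpa using (hasDerivAt_id (1 : ℂ)).smul_const x
  have h1 : HasDerivAt (fun c : ℂ => gradF F l (c • x)) (fderiv ℂ (gradF F l) x x) 1 := by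
    rw [← one_smul ℂ x] at hd
    have := hd.comp_hasDerivAt (1 : ℂ) h0
    rwa [one_smul] at this
  have h2 : HasDerivAt (fun c : ℂ => c * gradF F l x) (gradF F l x) 1 := by
    simpa using (hasDerivAt_id (1 : ℂ)).mul_const (gradF F l x)
  have h3 : (fun c : ℂ => gradF F l (c • x)) =ᶠ[𝓝 1] fun c => c * gradF F l x := by
    filter_upwards [isOpen_ne.mem_nhds (one_ne_zero : (1 : ℂ) ≠ 0)] with c hc
    exact h.gradF_smul l hx hc
  rw [(h2.congr_of_eventuallyEq h3).unique h1]
  have h4 : x = ∑ m, x m • (Pi.single m 1 : Option ι → ℂ) := by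
    ext k
    simp [Finset.sum_apply, Pi.single_apply]
  conv_rhs => rw [h4, map_sum, ← h4]
  exact Finset.sum_congr rfl fun m _ => by rw [map_smul, smul_eq_mul, hessF]

end IsPrepotential

end Prepotential

section Restricted

variable {nC nV' : ℕ}

namespace AdaptedSlice

variable {Ω : (Fin nC ⊕ Fin nV' → ℂ) → SympVec (Fin nC ⊕ Fin nV')}
    {U : Set (Fin nC ⊕ Fin nV' → ℂ)} {B : Set (Fin nC → ℂ)}
    (h : AdaptedSlice Ω U B)
include h

theorem contDiffAt_dz_slice {w : Fin nC → ℂ} (hw : w ∈ B) (i s) :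
    ContDiffAt ℂ ∞ (fun y => dz i (fun z => Ω z s) (sliceEmb nV' y)) w := by
  refine contDiffAt_of_differentiableOn h.isOpen (fun y hy => ?_) hw
  have h1 : DifferentiableAt ℂ (fun z => fderiv ℂ (fun z => Ω z s) z (Pi.single i 1))
      (sliceEmb nV' y) :=
    (differentiableOn_fderiv_apply h.specialOn.isOpen (h.specialOn.differentiableOn s)
      _).differentiableAt (h.specialOn.isOpen.mem_nhds (h.mem hy))
  have h2 : DifferentiableAt ℂ (sliceEmb nV' : (Fin nC → ℂ) → _) y :=
    differentiableAt_pi.2 fun i => differentiable_slice i y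
  have h3 : DifferentiableAt ℂ
    (fun y => fderiv ℂ (fun z => Ω z s) (sliceEmb nV' y) (Pi.single i 1)) y := h1.comp y h2
  refine (h3.congr_of_eventuallyEq (Filter.eventuallyEq_of_mem (h.isOpen.mem_nhds hy)
    fun x hx => ?_)).differentiableWithinAt
  exact dz_of_holomorphic i (h.specialOn.differentiableAt_sec (h.mem hx) s)

theorem differentiableOn_conj_period
    (hN : ∀ w ∈ B, ∀ x l, period Ω (sliceEmb nV' w) (vecX x) (vecΛ l) = 0) (l m : Fin nV') :
    DifferentiableOn ℂ (fun w => conj (period Ω (sliceEmb nV' w) (vecΛ l) (vecΛ m))) B := by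
  intro w hw
  set P : (Fin nC → ℂ) → Matrix (Fin nV') (Fin nV') ℂ := fun w => Matrix.of fun l α =>
    dz (Sum.inr α) (fun y => Ω y (Sum.inl (vecΛ l))) (sliceEmb nV' w) with hP
  have h1 : ∀ y ∈ B, conj (period Ω (sliceEmb nV' y) (vecΛ l) (vecΛ m)) =
      ∑ α, dz (Sum.inr α) (fun y => Ω y (Sum.inr (vecΛ l))) (sliceEmb nV' y) * (P y)⁻¹ α m := by
    intro y hy
    simp only [h.dz_lower_eq hy (hN y hy), Finset.sum_mul]
    rw [Finset.sum_comm]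
    have h2 : ∀ k, ∑ α, conj (period Ω (sliceEmb nV' y) (vecΛ l) (vecΛ k)) *
        dz (Sum.inr α) (fun y => Ω y (Sum.inl (vecΛ k))) (sliceEmb nV' y) * (P y)⁻¹ α m =
        conj (period Ω (sliceEmb nV' y) (vecΛ l) (vecΛ k)) * if k = m then 1 else 0 := fun k => by
      have h3 := congrFun (congrFun (Matrix.mul_nonsing_inv (P y)
        (h.isUnit_det_dz hy (hN y hy))) k) m
      rw [Matrix.mul_apply, Matrix.one_apply] at h3
      rw [← h3, Finset.mul_sum]
      exact Finset.sum_congr rfl fun _ _ => mul_assoc _ _ _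
    simp [h2]
  have h4 : ContDiffAt ℂ ∞ (fun y => ∑ α, dz (Sum.inr α) (fun y => Ω y (Sum.inr (vecΛ l)))
      (sliceEmb nV' y) * (P y)⁻¹ α m) w :=
    ContDiffAt.sum fun α _ => (h.contDiffAt_dz_slice hw _ _).mul
      (contDiffAt_inv_apply (fun i k => h.contDiffAt_dz_slice hw _ _)
        (h.isUnit_det_dz hw (hN w hw)) α m)
  exact ((h4.differentiableAt (by simp)).congr_of_eventuallyEq
    (Filter.eventuallyEq_of_mem (h.isOpen.mem_nhds hw) h1)).differentiableWithinAt

/-- `N_{ΛΣ} = F̄_{ΛΣ}` along the slice. -/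
theorem period_eq_hessF {w : Fin nC → ℂ} (hw : w ∈ B)
    (hN : ∀ x l, period Ω (sliceEmb nV' w) (vecX x) (vecΛ l) = 0)
    {W : Set (Option (Fin nC ⊕ Fin nV') → ℂ)} {F : (Option (Fin nC ⊕ Fin nV') → ℂ) → ℂ}
    (hF : HasPrepotential Ω W F (sliceEmb nV' w)) (l m : Fin nV') :
    period Ω (sliceEmb nV' w) (vecΛ l) (vecΛ m) =
      conj (hessF F (vecΛ l) (vecΛ m) (fun s => Ω (sliceEmb nV' w) (Sum.inl s))) := by
  obtain ⟨hP, hev⟩ := hF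
  set z := sliceEmb nV' w with hz
  set X : (Fin nC ⊕ Fin nV' → ℂ) → Option (Fin nC ⊕ Fin nV') → ℂ :=
    fun y s => Ω y (Sum.inl s) with hX
  have hXW : X z ∈ W := hev.self_of_nhds.1
  have hXd : ∀ s, DifferentiableAt ℂ (fun y => X y s) z := fun s =>
    h.specialOn.differentiableAt_sec (h.mem hw) (Sum.inl s)
  have hgrad : ∀ k, DifferentiableAt ℂ (gradF F k) (X z) := fun k =>
    (hP.differentiableOn_gradF k).differentiableAt (hP.isOpen.mem_nhds hXW)
  have hchain : ∀ i k, dz i (fun y => Ω y (Sum.inr k)) z =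
      ∑ s, hessF F s k (X z) * dz i (fun y => X y s) z := by
    intro i k
    rw [dz_congr i (hev.mono fun y hy => hy.2 k :
      (fun y => Ω y (Sum.inr k)) =ᶠ[𝓝 z] fun y => gradF F k (X y)),
      dz_comp ((hgrad k).restrictScalars ℝ) hXd]
    exact Finset.sum_congr rfl fun s _ => by rw [dz_of_holomorphic s (hgrad k)]; rfl
  have hlow : ∀ α (x : Option (Fin nC)), dz (Sum.inr α) (fun y => X y (vecX x)) z =
      - (dK Ω (Sum.inr α) z * X z (vecX x)) := by
    intro α x
    have he : (Real.exp (kahlerPot Ω z / 2) : ℂ) ≠ 0 := by exact_mod_cast (Real.exp_pos _).ne'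
    have h1 : covD Ω (Sum.inr α) z (Sum.inl (vecX x)) = 0 := (h.covD_inr_zero hw hN α x).1
    rw [h.specialOn.covD_eq (h.mem hw)] at h1
    exact eq_neg_of_add_eq_zero_left ((mul_eq_zero.1 h1).resolve_left he)
  have heuler : ∀ k : Fin nV', ∑ x : Option (Fin nC), X z (vecX x) *
      hessF F (vecX x) (vecΛ k) (X z) = 0 := by
    intro k
    have h1 := hP.sum_hessF (vecΛ k) hXW
    rw [sum_option_sum, ← hev.self_of_nhds.2, (h.isTangent_sec hw hN k).2] at h1
    have h2 : ∀ k : Fin nV', X z (vecΛ k) = 0 := fun k => h.sec_upper_zero hw k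
    simpa only [h2, zero_mul, Finset.sum_const_zero, add_zero] using h1
  set P : Matrix (Fin nV') (Fin nV') ℂ := Matrix.of fun l α =>
    dz (Sum.inr α) (fun y => Ω y (Sum.inl (vecΛ l))) z with hPdef
  have hPu : IsUnit P.det := h.isUnit_det_dz hw hN
  set N : Matrix (Fin nV') (Fin nV') ℂ := Matrix.of fun l m => conj (period Ω z (vecΛ l) (vecΛ m))
  set H : Matrix (Fin nV') (Fin nV') ℂ := Matrix.of fun l m => hessF F (vecΛ m) (vecΛ l) (X z)
  have hNH : N * P = H * P := by
    ext k α
    have h1 := h.dz_lower_eq hw hN α k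
    rw [← hz, hchain, sum_option_sum] at h1
    have h2 : ∑ x : Option (Fin nC), hessF F (vecX x) (vecΛ k) (X z) *
        dz (Sum.inr α) (fun y => X y (vecX x)) z = 0 := by
      have h3 := heuler k
      rw [← neg_eq_zero, ← mul_eq_zero_of_right (dK Ω (Sum.inr α) z) h3, neg_eq_iff_eq_neg,
        Finset.mul_sum, ← Finset.sum_neg_distrib]
      exact Finset.sum_congr rfl fun x _ => by rw [hlow]; ring
    rw [h2, zero_add] at h1
    simp only [Matrix.mul_apply]
    exact h1.symm
  have hNH' : N = H := by
    have := congrArg (fun A => A * P⁻¹) hNH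
    simpa only [Matrix.mul_assoc, Matrix.mul_nonsing_inv _ hPu, Matrix.mul_one] using this
  have h1 := congrArg conj (congrFun (congrFun hNH' m) l)
  simp only [N, H, Matrix.of_apply, conj_conj] at h1
  rw [h.period_symm hw, ← hz, h1]

end AdaptedSlice

/-- The tangential indices of a symplectic vector. -/
def resIdx (q : Option (Fin nC) ⊕ Option (Fin nC)) :
    Option (Fin nC ⊕ Fin nV') ⊕ Option (Fin nC ⊕ Fin nV') := Sum.map vecX vecX q

/-- The transversal indices of a symplectic vector. -/
def transIdx (t : Fin nV' ⊕ Fin nV') :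
    Option (Fin nC ⊕ Fin nV') ⊕ Option (Fin nC ⊕ Fin nV') := Sum.map vecΛ vecΛ t

theorem restrictVec_apply (v : SympVec (Fin nC ⊕ Fin nV')) (q) :
    restrictVec v q = v (resIdx q) := by
  rcases q with x | x <;> rfl

theorem IsTangent.transIdx {v : SympVec (Fin nC ⊕ Fin nV')} (hv : IsTangent v) (t) :
    v (transIdx t) = 0 := by
  rcases t with l | l
  exacts [(hv l).1, (hv l).2]

theorem sum_resIdx {α : Type*} [AddCommMonoid α]
    (f : Option (Fin nC ⊕ Fin nV') ⊕ Option (Fin nC ⊕ Fin nV') → α) :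
    ∑ p, f p = ∑ q, f (resIdx q) + ∑ t, f (transIdx t) := by
  rw [Fintype.sum_sum_type, Fintype.sum_sum_type, Fintype.sum_sum_type, sum_option_sum,
    sum_option_sum]
  exact add_add_add_comm _ _ _ _

/-- The transition matrices map tangential vectors to tangential vectors along the slice. -/
theorem transition_block_zero {Ωa Ωb : (Fin nC ⊕ Fin nV' → ℂ) → SympVec (Fin nC ⊕ Fin nV')}
    {Ua Ub : Set (Fin nC ⊕ Fin nV' → ℂ)} {Ba Bb : Set (Fin nC → ℂ)}
    (ha : AdaptedSlice Ωa Ua Ba) (hb : AdaptedSlice Ωb Ub Bb) {w : Fin nC → ℂ}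
    (hwa : w ∈ Ba) (hwb : w ∈ Bb)
    (hNa : ∀ x l, period Ωa (sliceEmb nV' w) (vecX x) (vecΛ l) = 0)
    (hNb : ∀ x l, period Ωb (sliceEmb nV' w) (vecX x) (vecΛ l) = 0)
    {c : (Fin nC ⊕ Fin nV' → ℂ) → ℂ}
    {S : Matrix (Option (Fin nC ⊕ Fin nV') ⊕ Option (Fin nC ⊕ Fin nV'))
      (Option (Fin nC ⊕ Fin nV') ⊕ Option (Fin nC ⊕ Fin nV')) ℝ}
    (hc : DifferentiableAt ℂ c (sliceEmb nV' w)) (hc0 : c (sliceEmb nV' w) ≠ 0)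
    (hΩ : ∀ᶠ z in 𝓝 (sliceEmb nV' w), Ωa z = c z • (S.map Complex.ofReal).mulVec (Ωb z)) (t q) :
    S (transIdx t) (resIdx q) = 0 := by
  set z := sliceEmb nV' w with hz
  have hrow : ∑ p, (S (transIdx t) p : ℂ) * Ωb z p = 0 := by
    have h1 := congrFun hΩ.self_of_nhds (transIdx t)
    rw [(ha.isTangent_sec hwa hNa).transIdx t] at h1
    exact (mul_eq_zero.1 h1.symm).resolve_left hc0
  have hdrow : ∀ i, ∑ p, (S (transIdx t) p : ℂ) * dzV (Sum.inl i) Ωb z p = 0 := by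
    intro i
    have hd : ∀ p, DifferentiableAt ℝ (fun y => Ωb y p) z := fun p =>
      (hb.specialOn.contDiffAt_sec (hb.mem hwb) p).differentiableAt_top
    have hds : DifferentiableAt ℝ (fun y => ∑ p, (S (transIdx t) p : ℂ) * Ωb y p) z :=
      DifferentiableAt.fun_sum fun p _ => (hd p).const_mul _
    have h1 : dz (Sum.inl i) (fun y => Ωa y (transIdx t)) z = 0 :=
      (ha.isTangent_dz hwa hNa i).transIdx t
    rw [dz_congr (g := fun y => c y * ∑ p, (S (transIdx t) p : ℂ) * Ωb y p) (Sum.inl i)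
      (hΩ.mono fun y hy => congrFun hy (transIdx t)),
      dz_mul _ (hc.restrictScalars ℝ) hds, hrow, mul_zero, zero_add,
      dz_sum _ _ fun p _ => (hd p).const_mul _] at h1
    have h2 := (mul_eq_zero.1 h1).resolve_left hc0
    rw [← h2]
    exact Finset.sum_congr rfl fun p _ => (dz_const_mul _ _ (hd p)).symm
  set y : SympVec (Fin nC) := Sum.elim (fun x => -(S (transIdx t) (resIdx (Sum.inr x)) : ℂ))
    (fun x => (S (transIdx t) (resIdx (Sum.inl x)) : ℂ)) with hy
  have hyc : cbar y = y := by
    ext (x | x) <;> simp [hy, cbar]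
  have hsymp : ∀ v : SympVec (Fin nC ⊕ Fin nV'), IsTangent v →
      symp y (restrictVec v) = ∑ p, (S (transIdx t) p : ℂ) * v p := by
    intro v hv
    rw [sum_resIdx]
    simp only [hv.transIdx, mul_zero, Finset.sum_const_zero, add_zero]
    rw [Fintype.sum_sum_type, ← Finset.sum_add_distrib]
    refine Finset.sum_congr rfl fun x _ => ?_
    simp only [hy, Sum.elim_inl, Sum.elim_inr, restrictVec_apply]
    ring
  have hV : symp y (restrictVec (covSec Ωb z)) = 0 := by
    have h1 : covSec Ωb z = (Real.exp (kahlerPot Ωb z / 2) : ℂ) • Ωb z := rfl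
    rw [h1, restrictVec_smul, symp_smul_right, hsymp _ (hb.isTangent_sec hwb hNb), hrow, mul_zero]
  have hU : ∀ i, symp y (restrictVec (covD Ωb (Sum.inl i) z)) = 0 := by
    intro i
    rw [hb.specialOn.covD_eq (hb.mem hwb), restrictVec_smul, symp_smul_right, restrictVec_add,
      symp_add_right, restrictVec_smul, symp_smul_right, hsymp _ (hb.isTangent_sec hwb hNb), hrow,
      hsymp _ (hb.isTangent_dz hwb hNb i), hdrow]
    simp
  have hconj : ∀ v, symp y v = 0 → symp y (cbar v) = 0 := fun v hv => by
    rw [← hyc, symp_cbar, hv, map_zero]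
  have hy0 : y = 0 := (hb.isFrame_restrict hwb).eq_zero_of_orthogonal hV (hconj _ hV) hU
    fun i => hconj _ (hU i)
  rcases q with x | x
  · have := congrFun hy0 (Sum.inr x)
    simpa [hy] using this
  · have := congrFun hy0 (Sum.inl x)
    simpa [hy] using this

end Restricted

section Manifold

open IsManifold

variable {nC nV' : ℕ} {M R P : Type*}
  [TopologicalSpace M] [ChartedSpace (Fin nC ⊕ Fin nV' → ℂ) M]
  [IsManifold 𝓘(ℂ, Fin nC ⊕ Fin nV' → ℂ) ω M]
  [TopologicalSpace R] [ChartedSpace (Fin nC → ℂ) R] [IsManifold 𝓘(ℂ, Fin nC → ℂ) ω R]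
  {dom : P → Set M} {sec : P → M → SympVec (Fin nC ⊕ Fin nV')} {j : R → M}

theorem mdifferentiableOn_chart {ι : Type} [Fintype ι] {X : Type*} [TopologicalSpace X]
    [ChartedSpace (ι → ℂ) X] [IsManifold 𝓘(ℂ, ι → ℂ) ω X] {φ : OpenPartialHomeomorph X (ι → ℂ)}
    (hφ : φ ∈ maximalAtlas 𝓘(ℂ, ι → ℂ) ω X) :
    MDifferentiableOn 𝓘(ℂ, ι → ℂ) 𝓘(ℂ, ι → ℂ) φ φ.source :=
  (contMDiffOn_of_mem_maximalAtlas hφ).mdifferentiableOn (by simp)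

theorem mdifferentiableOn_chart_symm {ι : Type} [Fintype ι] {X : Type*} [TopologicalSpace X]
    [ChartedSpace (ι → ℂ) X] [IsManifold 𝓘(ℂ, ι → ℂ) ω X] {φ : OpenPartialHomeomorph X (ι → ℂ)}
    (hφ : φ ∈ maximalAtlas 𝓘(ℂ, ι → ℂ) ω X) :
    MDifferentiableOn 𝓘(ℂ, ι → ℂ) 𝓘(ℂ, ι → ℂ) φ.symm φ.target :=
  (contMDiffOn_symm_of_mem_maximalAtlas hφ).mdifferentiableOn (by simp)

/-- Functions that are holomorphic on a manifold are holomorphic in coordinates. -/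
theorem differentiableOn_coord {ι : Type} [Fintype ι] {X : Type*} [TopologicalSpace X]
    [ChartedSpace (ι → ℂ) X] [IsManifold 𝓘(ℂ, ι → ℂ) ω X] {φ : OpenPartialHomeomorph X (ι → ℂ)}
    (hφ : φ ∈ maximalAtlas 𝓘(ℂ, ι → ℂ) ω X) {E : Type*} [NormedAddCommGroup E] [NormedSpace ℂ E]
    {f : X → E} {s : Set X} (hf : MDifferentiableOn 𝓘(ℂ, ι → ℂ) 𝓘(ℂ, E) f s) :
    DifferentiableOn ℂ (f ∘ φ.symm) (φ.target ∩ φ.symm ⁻¹' s) := by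
  rw [← mdifferentiableOn_iff_differentiableOn]
  exact hf.comp ((mdifferentiableOn_chart_symm hφ).mono Set.inter_subset_left) fun z hz => hz.2

theorem IsSpecialKahler.specialOn {ι : Type} [Fintype ι] [DecidableEq ι] {X : Type*}
    [TopologicalSpace X] [ChartedSpace (ι → ℂ) X] [IsManifold 𝓘(ℂ, ι → ℂ) ω X]
    {dom : P → Set X} {sec : P → X → SympVec ι}
    (h : IsSpecialKahler dom sec) {φ : OpenPartialHomeomorph X (ι → ℂ)}
    (hφ : φ ∈ maximalAtlas 𝓘(ℂ, ι → ℂ) ω X) (a : P) :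
    SpecialOn (sec a ∘ φ.symm) (φ.target ∩ φ.symm ⁻¹' dom a) where
  isOpen := φ.isOpen_inter_preimage_symm (h.isOpen_dom a)
  differentiableOn := differentiableOn_pi.1 (differentiableOn_coord hφ (h.holomorphic a))
  special z hz := by
    have := h.special φ hφ a (φ.symm z) (φ.map_target hz.1) hz.2
    rwa [φ.right_inv hz.1] at this

namespace AdaptedCharts

variable {φ : OpenPartialHomeomorph M (Fin nC ⊕ Fin nV' → ℂ)}
  {ψ : OpenPartialHomeomorph R (Fin nC → ℂ)} (h : AdaptedCharts dom sec j φ ψ)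
include h

theorem chart_eq {r : R} (hr : r ∈ ψ.source) : φ (j r) = sliceEmb nV' (ψ r) := h.slice r hr

theorem eq_symm {r : R} (hr : r ∈ ψ.source) : j r = φ.symm (sliceEmb nV' (ψ r)) := by
  rw [← h.chart_eq hr, φ.left_inv (h.mapsTo hr)]

theorem slice_mem {w : Fin nC → ℂ} (hw : w ∈ ψ.target) : sliceEmb nV' w ∈ φ.target := by
  have h1 := h.chart_eq (ψ.map_target hw)
  rw [ψ.right_inv hw] at h1
  rw [← h1]
  exact φ.map_source (h.mapsTo (ψ.map_target hw))

theorem symm_slice {w : Fin nC → ℂ} (hw : w ∈ ψ.target) :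
    φ.symm (sliceEmb nV' w) = j (ψ.symm w) := by
  rw [h.eq_symm (ψ.map_target hw), ψ.right_inv hw]

theorem mdifferentiableOn :
    MDifferentiableOn 𝓘(ℂ, Fin nC → ℂ) 𝓘(ℂ, Fin nC ⊕ Fin nV' → ℂ) j ψ.source := by
  have h1 : MDifferentiable 𝓘(ℂ, Fin nC → ℂ) 𝓘(ℂ, Fin nC ⊕ Fin nV' → ℂ)
      (sliceEmb nV' : (Fin nC → ℂ) → _) := by
    rw [mdifferentiable_iff_differentiable]
    exact differentiable_pi.2 differentiable_slice
  have h2 := (mdifferentiableOn_chart_symm h.mem_φ).comp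
    (h1.comp_mdifferentiableOn (mdifferentiableOn_chart h.mem_ψ))
    (fun r hr => h.slice_mem (ψ.map_source hr))
  exact h2.congr fun r hr => h.eq_symm hr

theorem continuousOn : ContinuousOn j ψ.source := h.mdifferentiableOn.continuousOn

theorem isOpen_slice (hM : IsSpecialKahler dom sec) (a : P) :
    IsOpen {w | w ∈ ψ.target ∧ j (ψ.symm w) ∈ dom a} := by
  have h1 : ContinuousOn (j ∘ ψ.symm) ψ.target :=
    h.continuousOn.comp ψ.continuousOn_symm fun w hw => ψ.map_target hw
  exact h1.isOpen_inter_preimage ψ.open_target (hM.isOpen_dom a)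

theorem adaptedSlice (hM : IsSpecialKahler dom sec)
    (hL : Along dom sec j fun Ω z => ∀ l, secL Ω (vecΛ l) z = 0)
    (hf : Along dom sec j fun Ω z => ∀ i l, secf Ω (Sum.inl i) (vecΛ l) z = 0) (a : P) :
    AdaptedSlice (sec a ∘ φ.symm) (φ.target ∩ φ.symm ⁻¹' dom a)
      {w | w ∈ ψ.target ∧ j (ψ.symm w) ∈ dom a} where
  specialOn := hM.specialOn h.mem_φ a
  isOpen := h.isOpen_slice hM a
  mapsTo w hw := ⟨h.slice_mem hw.1, by rw [Set.mem_preimage, h.symm_slice hw.1]; exact hw.2⟩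
  orthogonal w hw i α := by
    have := h.orthogonal a _ (ψ.map_target hw.1) hw.2 i α
    rwa [h.chart_eq (ψ.map_target hw.1), ψ.right_inv hw.1] at this
  secL_zero w hw l := by
    have := hL φ ψ h a _ (ψ.map_target hw.1) hw.2 l
    rwa [h.chart_eq (ψ.map_target hw.1), ψ.right_inv hw.1] at this
  secf_zero w hw i l := by
    have := hf φ ψ h a _ (ψ.map_target hw.1) hw.2 i l
    rwa [h.chart_eq (ψ.map_target hw.1), ψ.right_inv hw.1] at this

theorem mem_slice {r : R} (hr : r ∈ ψ.source) {a : P} (hra : j r ∈ dom a) :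
    ψ r ∈ {w | w ∈ ψ.target ∧ j (ψ.symm w) ∈ dom a} :=
  ⟨ψ.map_source hr, by rwa [ψ.left_inv hr]⟩

theorem restrict_eq (a : P) : ∀ w ∈ {w | w ∈ ψ.target ∧ j (ψ.symm w) ∈ dom a},
    ((fun r => restrictVec (sec a (j r))) ∘ ψ.symm) w =
      restrictVec ((sec a ∘ φ.symm) (sliceEmb nV' w)) := fun w hw => by
  simp only [Function.comp_apply, h.symm_slice hw.1]

/-- The restricted section is special in every chart of the submanifold. -/
theorem specialAt_restrict (hM : IsSpecialKahler dom sec)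
    (hL : Along dom sec j fun Ω z => ∀ l, secL Ω (vecΛ l) z = 0)
    (hf : Along dom sec j fun Ω z => ∀ i l, secf Ω (Sum.inl i) (vecΛ l) z = 0) (a : P)
    {ψ' : OpenPartialHomeomorph R (Fin nC → ℂ)}
    (hψ' : ψ' ∈ maximalAtlas 𝓘(ℂ, Fin nC → ℂ) ω R) {r : R} (hr : r ∈ ψ.source)
    (hr' : r ∈ ψ'.source) (hra : j r ∈ dom a) :
    SpecialAt ((fun r => restrictVec (sec a (j r))) ∘ ψ'.symm) (ψ' r) := by
  have hS := h.adaptedSlice hM hL hf a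
  set τ : (Fin nC → ℂ) → Fin nC → ℂ := ψ ∘ ψ'.symm with hτ
  have hτd : DifferentiableOn ℂ τ (ψ'.target ∩ ψ'.symm ⁻¹' ψ.source) :=
    differentiableOn_coord hψ' (mdifferentiableOn_chart h.mem_ψ)
  have hτd' : DifferentiableOn ℂ (ψ' ∘ ψ.symm) (ψ.target ∩ ψ.symm ⁻¹' ψ'.source) :=
    differentiableOn_coord h.mem_ψ (mdifferentiableOn_chart hψ')
  have hopen : IsOpen (ψ'.target ∩ ψ'.symm ⁻¹' ψ.source) :=
    ψ'.isOpen_inter_preimage_symm ψ.open_source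
  have hopen' : IsOpen (ψ.target ∩ ψ.symm ⁻¹' ψ'.source) :=
    ψ.isOpen_inter_preimage_symm ψ'.open_source
  set B : Set (Fin nC → ℂ) := (ψ'.target ∩ ψ'.symm ⁻¹' ψ.source) ∩
    τ ⁻¹' {w | w ∈ ψ.target ∧ j (ψ.symm w) ∈ dom a} with hB
  have hRes : IsRestriction (sec a ∘ φ.symm) (φ.target ∩ φ.symm ⁻¹' dom a)
      (fun w => sliceEmb nV' (τ w)) ((fun r => restrictVec (sec a (j r))) ∘ ψ'.symm) B :=
    { specialOn := hS.specialOn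
      isOpen := hτd.continuousOn.isOpen_inter_preimage hopen hS.isOpen
      differentiableOn := fun i => ((differentiable_slice i).comp_differentiableOn hτd).mono
        Set.inter_subset_left
      mapsTo := fun w hw => hS.mapsTo _ hw.2
      eq := fun w hw => by
        rw [← h.restrict_eq a _ hw.2]
        simp only [hτ, Function.comp_apply, ψ.left_inv hw.1.2]
      upper_zero := fun w hw l => hS.sec_upper_zero hw.2 l }
  have hmem : ψ' r ∈ ψ'.target ∩ ψ'.symm ⁻¹' ψ.source :=
    ⟨ψ'.map_source hr', by rw [Set.mem_preimage, ψ'.left_inv hr']; exact hr⟩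
  have hτr : τ (ψ' r) = ψ r := by rw [hτ, Function.comp_apply, ψ'.left_inv hr']
  have hwB : ψ' r ∈ B := ⟨hmem, by rw [Set.mem_preimage, hτr]; exact h.mem_slice hr hra⟩
  refine hRes.specialAt hwB fun c hc => ?_
  have h1 := (hτd.differentiableAt (hopen.mem_nhds hmem)).hasFDerivAt
  have hmem' : τ (ψ' r) ∈ ψ.target ∩ ψ.symm ⁻¹' ψ'.source :=
    ⟨by rw [hτr]; exact ψ.map_source hr, by
      rw [Set.mem_preimage, hτr, ψ.left_inv hr]; exact hr'⟩
  have h2 := ((hτd'.differentiableAt (hopen'.mem_nhds hmem')).hasFDerivAt.comp _ h1)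
  have h3 : HasFDerivAt ((ψ' ∘ ψ.symm) ∘ τ) (ContinuousLinearMap.id ℂ (Fin nC → ℂ)) (ψ' r) :=
    (hasFDerivAt_id _).congr_of_eventuallyEq
      (Filter.eventuallyEq_of_mem (hopen.mem_nhds hmem) fun w hw => by
        simp only [hτ, Function.comp_apply, ψ.left_inv hw.2, ψ'.right_inv hw.1, id])
  have h4 : fderiv ℂ τ (ψ' r) c = 0 := by
    ext i
    have h5 := hc (Sum.inl i)
    have h6 : HasFDerivAt (fun y => sliceEmb nV' (τ y) (Sum.inl i))
        ((ContinuousLinearMap.proj (R := ℂ) (φ := fun _ : Fin nC => ℂ) i).comp (fderiv ℂ τ (ψ' r)))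
        (ψ' r) :=
      hasFDerivAt_pi'.1 h1 i
    simp only [dz_of_holomorphic _ h6.differentiableAt, h6.fderiv] at h5
    have h7 : c = ∑ a, c a • (Pi.single a 1 : Fin nC → ℂ) := by
      ext k
      simp [Finset.sum_apply, Pi.single_apply]
    rw [h7, map_sum, Finset.sum_apply, Pi.zero_apply, ← h5]
    refine Finset.sum_congr rfl fun a _ => ?_
    rw [map_smul, Pi.smul_apply, smul_eq_mul, mul_comm]
    rfl
  have h8 := DFunLike.congr_fun (h3.unique h2) c
  rw [ContinuousLinearMap.comp_apply, h4, map_zero] at h8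
  exact h8

end AdaptedCharts

end Manifold

section Symplectic

variable {nC nV' : ℕ}

theorem vecX_injective : Function.Injective (vecX : Option (Fin nC) → Option (Fin nC ⊕ Fin nV')) :=
  Option.map_injective Sum.inl_injective

theorem J_resIdx (p q : Option (Fin nC) ⊕ Option (Fin nC)) :
    Matrix.J (Option (Fin nC ⊕ Fin nV')) ℝ (resIdx p) (resIdx q) =
      Matrix.J (Option (Fin nC)) ℝ p q := by
  rcases p with x | x <;> rcases q with y | y <;>
    simp [Matrix.J, resIdx, Matrix.one_apply, vecX_injective.eq_iff]

variable {S T : Matrix (Option (Fin nC ⊕ Fin nV') ⊕ Option (Fin nC ⊕ Fin nV'))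
      (Option (Fin nC ⊕ Fin nV') ⊕ Option (Fin nC ⊕ Fin nV')) ℝ}

/-- The tangential block of a matrix that preserves tangential vectors is multiplicative. -/
theorem submatrix_mul_of_block (hT : ∀ t q, T (transIdx t) (resIdx q) = 0) :
    (S * T).submatrix (resIdx (nC := nC) (nV' := nV')) resIdx =
      S.submatrix resIdx resIdx * T.submatrix resIdx resIdx := by
  ext p q
  simp only [Matrix.submatrix_apply, Matrix.mul_apply, sum_resIdx, hT, mul_zero,
    Finset.sum_const_zero, add_zero]

/-- The tangential block of a symplectic matrix that preserves tangential vectors is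
symplectic. -/
theorem submatrix_mem_symplecticGroup (hS : S ∈ Matrix.symplecticGroup (Option (Fin nC ⊕ Fin nV')) ℝ)
    (h0 : ∀ t q, S (transIdx t) (resIdx q) = 0) :
    S.submatrix (resIdx (nC := nC) (nV' := nV')) resIdx ∈
      Matrix.symplecticGroup (Option (Fin nC)) ℝ := by
  rw [SymplecticGroup.mem_iff'] at hS ⊢
  have hJ : (Matrix.J (Option (Fin nC ⊕ Fin nV')) ℝ).submatrix resIdx resIdx =
      Matrix.J (Option (Fin nC)) ℝ := by
    ext p q
    exact J_resIdx p q
  have h1 := congrArg (fun A => A.submatrix (resIdx (nC := nC) (nV' := nV')) resIdx) hS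
  simp only [hJ] at h1
  refine Eq.trans ?_ h1
  rw [submatrix_mul_of_block h0]
  congr 1
  ext p q
  simp only [Matrix.submatrix_apply, Matrix.mul_apply, Matrix.transpose_apply, sum_resIdx, h0,
    zero_mul, Finset.sum_const_zero, add_zero, J_resIdx]

theorem restrictVec_mulVec (c : ℂ) {v : SympVec (Fin nC ⊕ Fin nV')} (hv : IsTangent v) :
    restrictVec (c • (S.map Complex.ofReal).mulVec v) =
      c • ((S.submatrix resIdx resIdx).map Complex.ofReal).mulVec (restrictVec v) := by
  ext q
  simp only [restrictVec_apply, Pi.smul_apply, Matrix.mulVec, dotProduct, sum_resIdx,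
    hv.transIdx, mul_zero, Finset.sum_const_zero, add_zero]
  rfl

theorem differentiable_restrictVec :
    Differentiable ℂ (restrictVec : SympVec (Fin nC ⊕ Fin nV') → SympVec (Fin nC)) := by
  refine differentiable_pi.2 fun q => ?_
  simp only [restrictVec_apply]
  exact differentiable_apply _

end Symplectic

section Manifold

open IsManifold

variable {nC nV' : ℕ} {M R P : Type*}
  [TopologicalSpace M] [ChartedSpace (Fin nC ⊕ Fin nV' → ℂ) M]
  [IsManifold 𝓘(ℂ, Fin nC ⊕ Fin nV' → ℂ) ω M]
  [TopologicalSpace R] [ChartedSpace (Fin nC → ℂ) R] [IsManifold 𝓘(ℂ, Fin nC → ℂ) ω R]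
  {dom : P → Set M} {sec : P → M → SympVec (Fin nC ⊕ Fin nV')} {j : R → M}

theorem IsAdaptedSubmanifold.mdifferentiable (hR : IsAdaptedSubmanifold dom sec j) :
    MDifferentiable 𝓘(ℂ, Fin nC → ℂ) 𝓘(ℂ, Fin nC ⊕ Fin nV' → ℂ) j := fun r => by
  obtain ⟨φ, ψ, h, hr⟩ := hR r
  exact (h.mdifferentiableOn r hr).mdifferentiableAt (ψ.open_source.mem_nhds hr)

section PeriodZero

variable (hM : IsSpecialKahler dom sec) (hR : IsAdaptedSubmanifold dom sec j)
    (hL : Along dom sec j fun Ω z => ∀ l, secL Ω (vecΛ l) z = 0)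
    (hf : Along dom sec j fun Ω z => ∀ i l, secf Ω (Sum.inl i) (vecΛ l) z = 0)
    (hN : Along dom sec j fun Ω z => ∀ x l, period Ω z (vecX x) (vecΛ l) = 0)
include hM hR hL hf hN

theorem isTangent_sec_of_period {r : R} {a : P} (hra : j r ∈ dom a) :
    IsTangent (sec a (j r)) := by
  obtain ⟨φ, ψ, h, hr⟩ := hR r
  have h1 := hN φ ψ h a r hr hra
  rw [h.chart_eq hr] at h1
  have h2 := (h.adaptedSlice hM hL hf a).isTangent_sec (h.mem_slice hr hra) h1
  rwa [Function.comp_apply, ← h.eq_symm hr] at h2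

theorem transition_transIdx_resIdx {r : R} {a b : P} (hra : j r ∈ dom a) (hrb : j r ∈ dom b)
    {c : M → ℂ} {S : M → Matrix (Option (Fin nC ⊕ Fin nV') ⊕ Option (Fin nC ⊕ Fin nV'))
      (Option (Fin nC ⊕ Fin nV') ⊕ Option (Fin nC ⊕ Fin nV')) ℝ}
    (hc : MDifferentiableOn 𝓘(ℂ, Fin nC ⊕ Fin nV' → ℂ) 𝓘(ℂ, ℂ) c (dom a ∩ dom b))
    (hcS : ∀ p ∈ dom a ∩ dom b, sec a p = c p • ((S p).map Complex.ofReal).mulVec (sec b p))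
    (hc0 : c (j r) ≠ 0) (hS : ∀ᶠ q in 𝓝 (j r), S q = S (j r)) (t q) :
    S (j r) (transIdx t) (resIdx q) = 0 := by
  obtain ⟨φ, ψ, h, hr⟩ := hR r
  have hNa := hN φ ψ h a r hr hra
  have hNb := hN φ ψ h b r hr hrb
  rw [h.chart_eq hr] at hNa hNb
  have hz : φ.symm (sliceEmb nV' (ψ r)) = j r := (h.eq_symm hr).symm
  have hzt : sliceEmb nV' (ψ r) ∈ φ.target := h.slice_mem (ψ.map_source hr)
  have hopen : IsOpen (φ.target ∩ φ.symm ⁻¹' (dom a ∩ dom b)) :=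
    φ.isOpen_inter_preimage_symm ((hM.isOpen_dom a).inter (hM.isOpen_dom b))
  have hmem : sliceEmb nV' (ψ r) ∈ φ.target ∩ φ.symm ⁻¹' (dom a ∩ dom b) :=
    ⟨hzt, by rw [Set.mem_preimage, hz]; exact ⟨hra, hrb⟩⟩
  refine transition_block_zero (c := c ∘ φ.symm) (h.adaptedSlice hM hL hf a)
    (h.adaptedSlice hM hL hf b) (h.mem_slice hr hra) (h.mem_slice hr hrb) hNa hNb
    ((differentiableOn_coord h.mem_φ hc).differentiableAt (hopen.mem_nhds hmem))
    (by rwa [Function.comp_apply, hz]) ?_ t q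
  have h1 : ∀ᶠ z in 𝓝 (sliceEmb nV' (ψ r)), S (φ.symm z) = S (j r) := by
    have h2 := φ.symm.continuousAt (x := sliceEmb nV' (ψ r)) hzt
    rw [ContinuousAt, hz] at h2
    exact h2.eventually hS
  filter_upwards [h1, hopen.mem_nhds hmem] with z hz1 hz2
  simp only [Function.comp_apply]
  rw [hcS _ hz2.2, hz1]

/-- If the mixed block of the period matrix vanishes, the submanifold is special Kähler. -/
theorem isSpecialKahler_restrict :
    IsSpecialKahler (fun a => j ⁻¹' dom a) (fun a r => restrictVec (sec a (j r))) where
  isOpen_dom a := (hM.isOpen_dom a).preimage hR.mdifferentiable.continuous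
  cover r := hM.cover (j r)
  holomorphic a := by
    have h1 := (hM.holomorphic a).comp (hR.mdifferentiable.mdifferentiableOn (s := j ⁻¹' dom a))
      fun r hr => hr
    exact (differentiable_restrictVec.mdifferentiable).comp_mdifferentiableOn h1
  transition := by
    obtain ⟨c, S, hc, hcS, hcoc⟩ := hM.transition
    have h0 : ∀ a b r, j r ∈ dom a → j r ∈ dom b → ∀ t q,
        S a b (j r) (transIdx t) (resIdx q) = 0 := fun a b r ha hb =>
      transition_transIdx_resIdx hM hR hL hf hN ha hb (hc a b)
        (fun p hp => (hcS a b p hp).2.2.2) (hcS a b _ ⟨ha, hb⟩).1 (hcS a b _ ⟨ha, hb⟩).2.2.1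
    refine ⟨fun a b r => c a b (j r), fun a b r => (S a b (j r)).submatrix resIdx resIdx,
      fun a b => (hc a b).comp hR.mdifferentiable.mdifferentiableOn fun r hr => hr,
      fun a b r hr => ⟨(hcS a b _ hr).1, ?_, ?_, ?_⟩, fun a b d r hr =>
        ⟨(hcoc a b d _ hr).1, ?_⟩⟩
    · exact submatrix_mem_symplecticGroup (hcS a b _ hr).2.1 (h0 a b r hr.1 hr.2)
    · filter_upwards [hR.mdifferentiable.continuous.continuousAt.eventually
        (hcS a b _ hr).2.2.1] with q hq
      rw [hq]
    · show restrictVec (sec a (j r)) = _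
      rw [(hcS a b _ hr).2.2.2,
        restrictVec_mulVec _ (isTangent_sec_of_period hM hR hL hf hN hr.2)]
    · show (S a d (j r)).submatrix resIdx resIdx = _
      rw [(hcoc a b d _ hr).2, submatrix_mul_of_block (h0 b d r hr.1.2 hr.2)]
  special ψ' hψ' a r hr' hra := by
    obtain ⟨φ, ψ, h, hr⟩ := hR r
    exact h.specialAt_restrict hM hL hf a hψ' hr hr' hra

end PeriodZero

end Manifold

end SpecialGeometry

end

open SpecialGeometry in
theorem mainTheorem2 {nC nV' : ℕ} {M R P : Type*}
    [TopologicalSpace M] [ChartedSpace (Fin nC ⊕ Fin nV' → ℂ) M]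
    [IsManifold 𝓘(ℂ, Fin nC ⊕ Fin nV' → ℂ) ω M]
    [TopologicalSpace R] [ChartedSpace (Fin nC → ℂ) R] [IsManifold 𝓘(ℂ, Fin nC → ℂ) ω R]
    (dom : P → Set M) (sec : P → M → SympVec (Fin nC ⊕ Fin nV'))
    (hM : IsSpecialKahler dom sec)
    (j : R → M) (hR : IsAdaptedSubmanifold dom sec j)
    -- `L^Λ = 0` and `f_i^Λ = 0` on the submanifold
    (hL : Along dom sec j fun Ω z => ∀ l, secL Ω (vecΛ l) z = 0)
    (hf : Along dom sec j fun Ω z => ∀ i l, secf Ω (Sum.inl i) (vecΛ l) z = 0) :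
    -- integrability `0 = ∇_i ∇_j L^Λ = i C_{ijα} g^{αβ̄} f̄_β̄^Λ`, and `C_{ijα} = 0`
    (Along dom sec j fun Ω z =>
      (∀ i k l, covDD Ω (Sum.inl i) (Sum.inl k) z (Sum.inl (vecΛ l)) = 0 ∧
        I * ∑ α, ∑ β, cTensor Ω (Sum.inl i) (Sum.inl k) (Sum.inr α) z *
          invMetric Ω z (Sum.inr α) (Sum.inr β) * conj (secf Ω (Sum.inr β) (vecΛ l) z) = 0) ∧
      (∀ i k α, cTensor Ω (Sum.inl i) (Sum.inl k) (Sum.inr α) z = 0)) ∧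
    -- the mixed curvature along the submanifold is the `C C̄` combination, and it vanishes
    (Along dom sec j fun Ω z => ∀ i α k l,
      curv Ω (Sum.inl i) (Sum.inr α) (Sum.inl k) (Sum.inl l) z =
        ∑ q, invMetric Ω z (Sum.inl i) (Sum.inl q) *
          ((∑ p, ∑ r, cTensor Ω (Sum.inr α) (Sum.inl k) (Sum.inl p) z *
              invMetric Ω z (Sum.inl p) (Sum.inl r) *
              conj (cTensor Ω (Sum.inl q) (Sum.inl l) (Sum.inl r) z)) +
            ∑ β, ∑ γ, cTensor Ω (Sum.inr α) (Sum.inl k) (Sum.inr β) z *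
              invMetric Ω z (Sum.inr β) (Sum.inr γ) *
              conj (cTensor Ω (Sum.inl q) (Sum.inl l) (Sum.inr γ) z)) ∧
      curv Ω (Sum.inl i) (Sum.inr α) (Sum.inl k) (Sum.inl l) z = 0 ∧
      curv Ω (Sum.inr α) (Sum.inl i) (Sum.inl k) (Sum.inl l) z = 0) ∧
    -- where moreover `C_{αβγ} = 0`, also `R^i_{αβγ̄} = 0`
    (Along dom sec j fun Ω z =>
      (∀ α β γ, cTensor Ω (Sum.inr α) (Sum.inr β) (Sum.inr γ) z = 0) →
      ∀ i α β γ, curv Ω (Sum.inl i) (Sum.inr α) (Sum.inr β) (Sum.inr γ) z = 0) ∧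
    -- `N_{XY}` is the period matrix of the submanifold, whose metric is `g_{i j̄} = -2 f_i^X Im N_{XY} f̄_j̄^Y`
    (∀ φ ψ, AdaptedCharts dom sec j φ ψ → ∀ a, ∀ r ∈ ψ.source, j r ∈ dom a →
      (∀ x y,
        period ((fun r => restrictVec (sec a (j r))) ∘ ψ.symm) (ψ r) x y =
          period (sec a ∘ φ.symm) (φ (j r)) (vecX x) (vecX y)) ∧
      (∀ i k,
        metric ((fun r => restrictVec (sec a (j r))) ∘ ψ.symm) (ψ r) i k =
          metric (sec a ∘ φ.symm) (φ (j r)) (Sum.inl i) (Sum.inl k) ∧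
        metric (sec a ∘ φ.symm) (φ (j r)) (Sum.inl i) (Sum.inl k) =
          -2 * ∑ x, ∑ y, secf (sec a ∘ φ.symm) (Sum.inl i) (vecX x) (φ (j r)) *
            ((period (sec a ∘ φ.symm) (φ (j r)) (vecX x) (vecX y)).im : ℂ) *
            conj (secf (sec a ∘ φ.symm) (Sum.inl k) (vecX y) (φ (j r))))) ∧
    -- if also `N_{XΛ} = 0` along the submanifold, then:
    ((Along dom sec j fun Ω z => ∀ x l, period Ω z (vecX x) (vecΛ l) = 0) →
      -- `f_α^X = 0` and `h_{Xα} = 0`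
      (Along dom sec j fun Ω z => ∀ α x,
        secf Ω (Sum.inr α) (vecX x) z = 0 ∧ sech Ω (Sum.inr α) (vecX x) z = 0) ∧
      -- `N_{ΛΣ}` restricted to the submanifold is antiholomorphic
      (∀ φ ψ, AdaptedCharts dom sec j φ ψ → ∀ a l m,
        DifferentiableOn ℂ
          (fun w => conj (period (sec a ∘ φ.symm) (Sum.elim w 0) (vecΛ l) (vecΛ m)))
          {w | w ∈ ψ.target ∧ j (ψ.symm w) ∈ dom a}) ∧
      -- `N_{ΛΣ} = F̄_{ΛΣ}` for every prepotential `F`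
      (Along dom sec j fun Ω z => ∀ W F, HasPrepotential Ω W F z → ∀ l m,
        period Ω z (vecΛ l) (vecΛ m) =
          conj (hessF F (vecΛ l) (vecΛ m) (fun s => Ω z (Sum.inl s)))) ∧
      -- the submanifold with the section `(X^X, F_X)` is special Kähler
      IsSpecialKahler (fun a => j ⁻¹' dom a) (fun a r => restrictVec (sec a (j r)))) := by
  refine ⟨?_, ?_, ?_, ?_, fun hN => ⟨?_, ?_, ?_, isSpecialKahler_restrict hM hR hL hf hN⟩⟩
  · intro φ ψ h a r hr hra
    have hS := h.adaptedSlice hM hL hf a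
    have hw := h.mem_slice hr hra
    rw [h.chart_eq hr]
    exact ⟨fun i k l => ⟨hS.covDD_upper_zero hw i k l, hS.sum_cTensor_zero hw i k l⟩,
      hS.cTensor_zero hw⟩
  · intro φ ψ h a r hr hra
    have hS := h.adaptedSlice hM hL hf a
    have hw := h.mem_slice hr hra
    rw [h.chart_eq hr]
    exact fun i α k l => ⟨hS.curv_eq_sum hw i α k l, hS.curv_inl_inr_zero hw i α k l,
      hS.curv_inr_inl_zero hw i α k l⟩
  · intro φ ψ h a r hr hra
    have hS := h.adaptedSlice hM hL hf a
    have hw := h.mem_slice hr hra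
    rw [h.chart_eq hr]
    exact fun hC => hS.curv_inl_inr_inr_zero hw hC
  · intro φ ψ h a r hr hra
    have hS := h.adaptedSlice hM hL hf a
    have hw := h.mem_slice hr hra
    rw [h.chart_eq hr]
    exact ⟨hS.period_restrict hw (h.restrict_eq a),
      fun i k => ⟨hS.metric_restrict hw (h.restrict_eq a) i k, hS.metric_eq_period hw i k⟩⟩
  · intro φ ψ h a r hr hra
    have hNr := hN φ ψ h a r hr hra
    rw [h.chart_eq hr] at hNr ⊢
    exact (h.adaptedSlice hM hL hf a).covD_inr_zero (h.mem_slice hr hra) hNr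
  · intro φ ψ h a l m
    refine (h.adaptedSlice hM hL hf a).differentiableOn_conj_period (fun w hw => ?_) l m
    have hNr := hN φ ψ h a _ (ψ.map_target hw.1) hw.2
    rwa [h.chart_eq (ψ.map_target hw.1), ψ.right_inv hw.1] at hNr
  · intro φ ψ h a r hr hra W F hF l m
    have hNr := hN φ ψ h a r hr hra
    rw [h.chart_eq hr] at hNr hF ⊢
    exact (h.adaptedSlice hM hL hf a).period_eq_hessF (h.mem_slice hr hra) hNr hF l m
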